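/- **Setting.** Let $\mathcal P(\mathbb R^d)$ carry the weak topology. Fix times $0=t_0<t_1<\dots<t_n<t_{n+1}=T$ ($n\ge 0$) and a nonempty set of control values $U=A\times B\subset\mathbb R^{k_1}\times\mathbb R^{k_2}$. For $\alpha\in A$ let $$\mathcal G(\alpha)f(x)=\sum_i b_i(x;\alpha)\,\partial_i f(x)+\tfrac12\sum_{i,j}a_{ij}(x;\alpha)\,\partial_{ij}f(x),\qquad \langle\mathcal G^*(\alpha)\mu,f\rangle=\int\mathcal G(\alpha)f\,d\mu ,$$ where $b,a$ are jointly measurable, bounded on $\mathbb R^d\times A$, continuous in $x$, and $a$ is positive semidefinite. Assume that, for each constant $\alpha\in A$ and each initial law, the Fokker–Planck equation $d\mu_t=\mathcal G^*(\alpha)\mu_t\,dt$ has exactly one weakly continuous weak solution on $[0,T]$ (test functions in $C_b^2(\mathbb R^d)$). *Observations.* $\Gamma_1,\dots,\Gamma_n$ are independent random variables on a probability space. If the law just before $t_i$ is $\mu$ and the measurement control is $\beta$, the observation is $Y_i^{\beta,\mu}$, a measurable function of $(\beta,\mu,\Gamma_i)$ (which may depend on $i$), and the law is updated to $K_\beta(\cdot;\mu,Y_i^{\beta,\mu})\,\mu$.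 Here $K$ is jointly measurable, and for $\beta\in B$ the function $K_\beta(\cdot;\mu,y)$ is a probability density with respect to $\mu$, for all $\mu,y$. For each $\beta\in B$ and $i$, the distribution of $K_\beta(\cdot;\mu,Y_i^{\beta,\mu})\mu$ on $\mathcal P(\mathbb R^d)$ depends weakly continuously on $\mu$. *Costs.* The running cost $\ell(t,\mu,\alpha)$ is measurable, continuous in $(t,\mu)\in[0,T]\times\mathcal P(\mathbb R^d)$ for each $\alpha\in A$, bounded below on $[0,T]\times\mathcal P(\mathbb R^d)\times A$, and bounded above in $(t,\mu)$ for each $\alpha\in A$. The measurement cost $h(t_i,\mu,\beta)$ is measurable, continuous in $\mu$ for each $\beta\in B$, bounded below, and bounded above in $\mu$ for each $\beta\in B$. The terminal cost $g$ is continuous and bounded on $\mathcal P(\mathbb R^d)$. *Control problem.* Let $0\le s<T$ and $\mu\in\mathcal P(\mathbb R^d)$. A control $u=(\alpha,\beta)$ on $[s,T]$, together with its state process $\mu^u$, is admissible if the following hold. - With $Y_i$ the actual observations and $\mathcal F_t=\sigma(Y_i: s<t_i\le t)$, the process $\alpha$ is progressively measurable, and $\mu^u$ is adapted. - The process $\beta$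 is piecewise constant and left continuous with jumps only at observation times, and predictable: its value $\beta_i$ on $(t_{i-1},t_i]$ is measurable with respect to $\mathcal F_{t_i^-}=\sigma(Y_j:s<t_j<t_i)$. - $(\alpha_t,\beta_t)\in U$ for all $t\in[s,T]$. - $\mu^u_s=\mu$; between observation times $\mu^u$ is a weakly continuous weak solution of $d\mu_t=\mathcal G^*(\alpha_t)\mu_t\,dt$; at each $t_i>s$ the left limit $\mu^u_{t_i^-}$ exists and $\mu^u_{t_i}=K_{\beta_i}(\cdot;\mu^u_{t_i^-},Y_i)\,\mu^u_{t_i^-}$ with $Y_i=Y_i^{\beta_i,\mu^u_{t_i^-}}$; and $\mu^u$ is continuous at $T$. Its cost is $$J(s,\mu;u)=E\Big[\int_s^T\ell(t,\mu^u_t,\alpha_t)\,dt+\sum_{i:\,t_i>s}h(t_i,\mu^u_{t_i^-},\beta_i)+g(\mu^u_T)\Big].$$ Let $\mathcal U[s,T]$ be the set of admissible controls (with their state processes) whose running and measurement costs are integrable. *HJB system.* A flat derivative of $\Phi:\mathcal P(\mathbb R^d)\to\mathbb R$ is a function $\frac{\delta\Phi}{\delta\mu}$ with $$\Phi(\mu)-\Phi(\nu)=\int_0^1\Big\langle\mu-\nu,\tfrac{\delta\Phi}{\delta\mu}(\nu+\lambda(\mu-\nu),\cdot)\Big\rangle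 d\lambda\quad\text{for all }\mu,\nu .$$ A classical solution is a function $W:[0,T]\times\mathcal P(\mathbb R^d)\to\mathbb R$ such that, on each $[t_i,t_{i+1})$ with $0\le i\le n$, the time derivative $\partial_tW$ (one-sided at $t_i$) and a flat derivative $p(t,\mu,x)=\frac{\delta W}{\delta\mu}(t,\mu,x)$ exist, $p$ is $C^2$ in $x$, the functions $\partial_tW,\ p,\ \partial_xp,\ \partial_x^2p$ are jointly continuous, $p,\partial_xp,\partial_x^2p$ are bounded in $x$ uniformly for $(t,\mu)$ in compact sets, and $$\partial_tW(t,\mu)+\inf_{(\alpha,\beta)\in U}\big\{\langle\mathcal G^*(\alpha)\mu,p(t,\mu,\cdot)\rangle+\ell(t,\mu,\alpha)\big\}=0,\qquad t_i\le t<t_{i+1},\ 0\le i\le n,$$ $$W(t_i^-,\mu)=\inf_{(\alpha,\beta)\in U}\big\{h(t_i,\mu,\beta)+E[W(t_i,K_\beta(\cdot;\mu,Y_i^{\beta,\mu})\mu)]\big\},\qquad 1\le i\le n,$$ $$W(T^-,\mu)=W(T,\mu)=g(\mu),$$ where $W(t_i^-,\mu)=\lim_{t\uparrow t_i,\ \nu\to\mu}W(t,\nu)$,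 and likewise for $W(T^-,\mu)$. **Theorem (Verification).** Let $W$ be a classical solution, with flat derivative $p$. Then $$W(s,\mu)=\inf_{u\in\mathcal U[s,T]}J(s,\mu;u),\qquad 0\le s<T,\ \mu\in\mathcal P(\mathbb R^d).$$ Furthermore, let $\widehat u=(\widehat\alpha,\widehat\beta):[0,T)\times\mathcal P(\mathbb R^d)\to U$ satisfy, for all $\mu$, $$\widehat u(t,\mu)\in\operatorname*{argmin}_{(\alpha,\beta)\in U}\{\langle\mathcal G^*(\alpha)\mu,p(t,\mu,\cdot)\rangle+\ell(t,\mu,\alpha)\},\quad t\notin\{t_1,\dots,t_n\},$$ $$\widehat u(t_i,\mu)\in\operatorname*{argmin}_{(\alpha,\beta)\in U}\{h(t_i,\mu,\beta)+E[W(t_i,K_\beta(\cdot;\mu,Y_i^{\beta,\mu})\mu)]\},\quad 1\le i\le n .$$ Then the feedback control of $\widehat u$ is optimal: if $u^*=(\alpha^*,\beta^*)$ is an admissible control on $[s,T]$ with state process $\mu^*$ started from $\mu$ at time $s$, such that $\alpha^*_t=\widehat\alpha(t,\mu^*_t)$ for $t\in[s,T)\setminus\{t_1,\dots,t_n\}$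 and $\beta^*_i=\widehat\beta(t_i,\mu^*_{t_i^-})$ for all $t_i>s$, then $u^*\in\mathcal U[s,T]$ and $J(s,\mu;u^*)=W(s,\mu)=\min_{u\in\mathcal U[s,T]}J(s,\mu;u)$. -/

import Mathlib

open MeasureTheory ProbabilityTheory Filter Topology Set
open scoped ENNReal

noncomputable section

namespace NoisyObs

/-- The state space `ℝ^k`. -/
abbrev E (k : ℕ) : Type := EuclideanSpace ℝ (Fin k)

/-- `𝒫(ℝ^d)`: probability measures with the topology of weak convergence. -/
abbrev P (d : ℕ) : Type := ProbabilityMeasure (E d)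

/-- The class `C_b²(ℝ^d)`. -/
def IsCb2 {d : ℕ} (f : E d → ℝ) : Prop :=
  ContDiff ℝ 2 f ∧ ∃ C : ℝ, ∀ x,
    |f x| ≤ C ∧ ‖fderiv ℝ f x‖ ≤ C ∧ ‖fderiv ℝ (fderiv ℝ f) x‖ ≤ C

/-- The convex combination `ν + r (μ - ν) = (1 - r) ν + r μ`, for `r ∈ [0,1]`
(other values of `r` are first projected to `[0,1]`). -/
def mix {d : ℕ} (r : ℝ) (μ ν : P d) : P d :=
  ⟨ENNReal.ofReal (1 - (projIcc (0 : ℝ) 1 zero_le_one r : ℝ)) • (ν : Measure (E d)) +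
      ENNReal.ofReal (projIcc (0 : ℝ) 1 zero_le_one r : ℝ) • (μ : Measure (E d)), by
    have h := (projIcc (0 : ℝ) 1 zero_le_one r).2
    constructor
    simp only [Measure.coe_add, Measure.coe_smul, Pi.add_apply, Pi.smul_apply, measure_univ,
      smul_eq_mul, mul_one]
    rw [← ENNReal.ofReal_add (by linarith [h.2]) h.1]
    simp⟩

/-- `D` is a flat derivative of `Φ : 𝒫(ℝ^d) → ℝ`. -/
def IsFlatDerivative {d : ℕ} (Φ : P d → ℝ) (D : P d → E d → ℝ) : Prop :=
  ∀ μ ν : P d, Φ μ - Φ ν =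
    ∫ r in (0 : ℝ)..1, ((∫ x, D (mix r μ ν) x ∂(μ : Measure (E d))) -
      ∫ x, D (mix r μ ν) x ∂(ν : Measure (E d)))

/-- On the time interval `I` the function `W` is continuously differentiable in time, with time
derivative `Wt`, and of class `𝒮^{1,1}` in the measure, with flat derivative `D`: the derivatives
`Wt`, `D`, `∂ₓD`, `∂ₓ²D` are jointly continuous, and `D`, `∂ₓD`, `∂ₓ²D` are bounded in `x`,
locally uniformly in `(t, μ)`. -/
structure IsRegularOn {d : ℕ} (I : Set ℝ) (W Wt : ℝ → P d → ℝ) (D : ℝ → P d → E d → ℝ) :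
    Prop where
  hasDeriv : ∀ t ∈ I, ∀ μ, HasDerivWithinAt (fun r => W r μ) (Wt t μ) I t
  continuous_deriv : ContinuousOn (fun q : ℝ × P d => Wt q.1 q.2) (I ×ˢ univ)
  flat : ∀ t ∈ I, IsFlatDerivative (W t) (D t)
  contDiff : ∀ t ∈ I, ∀ μ, ContDiff ℝ 2 (D t μ)
  continuous_zero : ContinuousOn (fun q : (ℝ × P d) × E d => D q.1.1 q.1.2 q.2)
    ((I ×ˢ univ) ×ˢ univ)
  continuous_one : ContinuousOn (fun q : (ℝ × P d) × E d => fderiv ℝ (D q.1.1 q.1.2) q.2)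
    ((I ×ˢ univ) ×ˢ univ)
  continuous_two : ContinuousOn
    (fun q : (ℝ × P d) × E d => fderiv ℝ (fderiv ℝ (D q.1.1 q.1.2)) q.2) ((I ×ˢ univ) ×ˢ univ)
  bounded : ∀ K : Set (ℝ × P d), IsCompact K → K ⊆ I ×ˢ univ → ∃ C : ℝ, ∀ q ∈ K, ∀ x,
    |D q.1 q.2 x| ≤ C ∧ ‖fderiv ℝ (D q.1 q.2) x‖ ≤ C ∧
      ‖fderiv ℝ (fderiv ℝ (D q.1 q.2)) x‖ ≤ C

/-- The data of the control problem. `Ω` is the probability space, `S` the space of values of the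
observation noise and `O` the space of values of the observations. -/
structure Model (d k₁ k₂ : ℕ) (Ω S O : Type*) [MeasurableSpace Ω] where
  /-- the probability measure on `Ω` -/
  prob : Measure Ω
  /-- the number of observations -/
  n : ℕ
  /-- `τ 0 = 0`, the observation times `τ 1 < ⋯ < τ n`, and the horizon `τ (n + 1) = T` -/
  τ : ℕ → ℝ
  /-- the set of control values `(α, β)` -/
  U : Set (E k₁ × E k₂)
  /-- the drift `b(x; α)` -/
  b : E d → E k₁ → E d
  /-- the diffusion matrix `a(x; α)` -/
  a : E d → E k₁ → Matrix (Fin d) (Fin d) ℝ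
  /-- the Bayes kernel `K_β(x; μ, y)`, with arguments in the order `β μ y x` -/
  K : E k₂ → P d → O → E d → ℝ≥0∞
  /-- the observation `Y_i = obs i β μ Γ_i` as a function of the measurement control, the law
  just before the observation, and the noise -/
  obs : ℕ → E k₂ → P d → S → O
  /-- the observation noises `Γ_i` -/
  Γ : ℕ → Ω → S
  /-- the running cost `ℓ(t, μ, α)` -/
  ℓ : ℝ → P d → E k₁ → ℝ
  /-- the measurement cost `h(t, μ, β)` -/
  h : ℝ → P d → E k₂ → ℝ
  /-- the terminal cost -/
  g : P d → ℝ

/-- A control `(α, β)` together with a state path. The process `β` is piecewise constant and left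
continuous with jumps only at observation times; it is given by its values, `β i` being the value
on `(τ (i-1), τ i]` (and at time `0` if `i = 1`). The measure `μ t ω` is the state at time `t`, and
`pre i ω` is the left limit of the state at `τ i`. -/
structure Path (d k₁ k₂ : ℕ) (Ω : Type*) where
  α : ℝ → Ω → E k₁
  β : ℕ → Ω → E k₂
  μ : ℝ → Ω → P d
  pre : ℕ → Ω → P d

namespace Model

variable {d k₁ k₂ : ℕ} {Ω S O : Type*} [MeasurableSpace Ω] [MeasurableSpace S] [MeasurableSpace O]

/-- The time horizon. -/
def T (M : Model d k₁ k₂ Ω S O) : ℝ := M.τ (M.n + 1)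

/-- The controlled generator `𝒢(α) f = ∑ b_i ∂_i f + ½ ∑ a_ij ∂_ij f`. -/
def gen (M : Model d k₁ k₂ Ω S O) (α : E k₁) (f : E d → ℝ) (x : E d) : ℝ :=
  ∑ i, M.b x α i * fderiv ℝ f x (EuclideanSpace.single i 1) +
    (1 / 2) * ∑ i, ∑ j, M.a x α i j *
      fderiv ℝ (fderiv ℝ f) x (EuclideanSpace.single i 1) (EuclideanSpace.single j 1)

/-- The pairing `⟨𝒢*(α) μ, f⟩ = ∫ 𝒢(α) f dμ`. -/
def pairing (M : Model d k₁ k₂ Ω S O) (α : E k₁) (μ : P d) (f : E d → ℝ) : ℝ :=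
  ∫ x, M.gen α f x ∂(μ : Measure (E d))

/-- On `[t₀, t₁]` the curve `m` is a weakly continuous weak solution of the Fokker--Planck
equation `dm_t = 𝒢*(α_t) m_t dt`. -/
def SolvesFP (M : Model d k₁ k₂ Ω S O) (α : ℝ → E k₁) (m : ℝ → P d) (t₀ t₁ : ℝ) : Prop :=
  ContinuousOn m (Icc t₀ t₁) ∧
    ∀ f : E d → ℝ, IsCb2 f → ∀ t ∈ Icc t₀ t₁,
      ∫ x, f x ∂(m t : Measure (E d)) =
        ∫ x, f x ∂(m t₀ : Measure (E d)) + ∫ r in t₀..t, M.pairing (α r) (m r) f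

open Classical in
/-- The updated measure `K_β(x; μ, y) μ(dx)`. If this is not a probability measure, which does
not happen for the kernels considered, the value is `μ`. -/
def bayes (M : Model d k₁ k₂ Ω S O) (β : E k₂) (μ : P d) (y : O) : P d :=
  if hp : IsProbabilityMeasure ((μ : Measure (E d)).withDensity (M.K β μ y)) then
    ⟨(μ : Measure (E d)).withDensity (M.K β μ y), hp⟩ else μ

/-- The updated law at the `i`-th observation as a function of the randomness. -/
def posterior (M : Model d k₁ k₂ Ω S O) (i : ℕ) (β : E k₂) (μ : P d) (ω : Ω) : P d :=
  M.bayes β μ (M.obs i β μ (M.Γ i ω))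

/-- The standing assumptions on the data. -/
structure Regular (M : Model d k₁ k₂ Ω S O) : Prop where
  isProbabilityMeasure : IsProbabilityMeasure M.prob
  τ_zero : M.τ 0 = 0
  τ_lt : ∀ i ≤ M.n, M.τ i < M.τ (i + 1)
  U_nonempty : M.U.Nonempty
  /-- `U` is a product of a set of values of `α` and a set of values of `β` -/
  U_prod : ∀ u ∈ M.U, ∀ v ∈ M.U, (u.1, v.2) ∈ M.U
  b_measurable : Measurable fun q : E d × E k₁ => M.b q.1 q.2
  b_continuous : ∀ u ∈ M.U, Continuous fun x => M.b x u.1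
  b_bounded : ∃ C : ℝ, ∀ u ∈ M.U, ∀ x, ‖M.b x u.1‖ ≤ C
  a_measurable : ∀ i j, Measurable fun q : E d × E k₁ => M.a q.1 q.2 i j
  a_continuous : ∀ u ∈ M.U, ∀ i j, Continuous fun x => M.a x u.1 i j
  a_bounded : ∃ C : ℝ, ∀ u ∈ M.U, ∀ x, ∀ i j, |M.a x u.1 i j| ≤ C
  a_posSemidef : ∀ u ∈ M.U, ∀ x, (M.a x u.1).PosSemidef
  /-- each `𝒢(α)` generates a diffusion: for a constant control the Fokker--Planck equation has
  exactly one weak solution for every initial law -/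
  wellPosed : ∀ u ∈ M.U, ∀ ν : P d, ∃ m : ℝ → P d,
    (m 0 = ν ∧ M.SolvesFP (fun _ => u.1) m 0 M.T) ∧
      ∀ m' : ℝ → P d, m' 0 = ν → M.SolvesFP (fun _ => u.1) m' 0 M.T → EqOn m' m (Icc 0 M.T)
  Γ_measurable : ∀ i, Measurable (M.Γ i)
  Γ_indep : iIndepFun M.Γ M.prob
  obs_measurable : ∀ i, Measurable fun q : E k₂ × P d × S => M.obs i q.1 q.2.1 q.2.2
  K_measurable : Measurable fun q : E k₂ × P d × O × E d => M.K q.1 q.2.1 q.2.2.1 q.2.2.2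
  /-- `K_β(·; μ, y)` is a probability density with respect to `μ` -/
  K_density : ∀ u ∈ M.U, ∀ μ : P d, ∀ y, ∫⁻ x, M.K u.2 μ y x ∂(μ : Measure (E d)) = 1
  /-- the law of the updated measure depends weakly continuously on the measure before the update -/
  posterior_continuous : ∀ u ∈ M.U, ∀ i ∈ Icc 1 M.n, ∀ Φ : BoundedContinuousFunction (P d) ℝ,
    Continuous fun μ => ∫ ω, Φ (M.posterior i u.2 μ ω) ∂M.prob
  ℓ_measurable : Measurable fun q : ℝ × P d × E k₁ => M.ℓ q.1 q.2.1 q.2.2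
  ℓ_continuous : ∀ u ∈ M.U,
    ContinuousOn (fun q : ℝ × P d => M.ℓ q.1 q.2 u.1) (Icc 0 M.T ×ˢ univ)
  ℓ_bddBelow : ∃ C : ℝ, ∀ u ∈ M.U, ∀ t ∈ Icc 0 M.T, ∀ μ, C ≤ M.ℓ t μ u.1
  ℓ_bddAbove : ∀ u ∈ M.U, ∃ C : ℝ, ∀ t ∈ Icc 0 M.T, ∀ μ, M.ℓ t μ u.1 ≤ C
  h_measurable : ∀ i ∈ Icc 1 M.n, Measurable fun q : P d × E k₂ => M.h (M.τ i) q.1 q.2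
  h_continuous : ∀ u ∈ M.U, ∀ i ∈ Icc 1 M.n, Continuous fun μ => M.h (M.τ i) μ u.2
  h_bddBelow : ∃ C : ℝ, ∀ u ∈ M.U, ∀ i ∈ Icc 1 M.n, ∀ μ, C ≤ M.h (M.τ i) μ u.2
  h_bddAbove : ∀ u ∈ M.U, ∃ C : ℝ, ∀ i ∈ Icc 1 M.n, ∀ μ, M.h (M.τ i) μ u.2 ≤ C
  g_continuous : Continuous M.g
  g_bounded : ∃ C : ℝ, ∀ μ, |M.g μ| ≤ C

/-- The observation `Y_i`. -/
def Y (M : Model d k₁ k₂ Ω S O) (X : Path d k₁ k₂ Ω) (i : ℕ) (ω : Ω) : O :=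
  M.obs i (X.β i ω) (X.pre i ω) (M.Γ i ω)

/-- `ℱ_t`, generated by the observations made after the starting time `s` and up to time `t`. -/
@[reducible] def sigma (M : Model d k₁ k₂ Ω S O) (X : Path d k₁ k₂ Ω) (s t : ℝ) : MeasurableSpace Ω :=
  ⨆ i ∈ {i ∈ Icc 1 M.n | s < M.τ i ∧ M.τ i ≤ t}, MeasurableSpace.comap (M.Y X i) inferInstance

/-- `ℱ_{t-}`, generated by the observations made after the starting time `s` and before `t`. -/
@[reducible] def sigmaPre (M : Model d k₁ k₂ Ω S O) (X : Path d k₁ k₂ Ω) (s t : ℝ) : MeasurableSpace Ω :=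
  ⨆ i ∈ {i ∈ Icc 1 M.n | s < M.τ i ∧ M.τ i < t}, MeasurableSpace.comap (M.Y X i) inferInstance

open Classical in
/-- `⌊t⌋`: the largest `i ≤ n` with `τ i < t`, and `0` if there is none. -/
def lastBefore (M : Model d k₁ k₂ Ω S O) (t : ℝ) : ℕ :=
  Nat.findGreatest (fun i => M.τ i < t) M.n

/-- `X` is an admissible control on `[s, T]` together with its state process started in `μ₀` at
time `s`. -/
structure IsAdmissible (M : Model d k₁ k₂ Ω S O) (s : ℝ) (μ₀ : P d) (X : Path d k₁ k₂ Ω) :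
    Prop where
  /-- `α` is progressively measurable -/
  α_prog : ∀ t ∈ Icc s M.T,
    @Measurable (Icc s t × Ω) (E k₁) (@Prod.instMeasurableSpace _ _ _ (M.sigma X s t)) _
      (fun q => X.α q.1 q.2)
  /-- `β` is predictable -/
  β_pred : ∀ i ∈ Icc 1 (M.n + 1), Measurable[M.sigmaPre X s (M.τ i)] (X.β i)
  mem_U : ∀ ω, ∀ t ∈ Icc s M.T, (X.α t ω, X.β (M.lastBefore t + 1) ω) ∈ M.U
  init : ∀ ω, X.μ s ω = μ₀
  μ_adapted : ∀ t ∈ Icc s M.T, Measurable[M.sigma X s t] (X.μ t)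
  /-- On each interval `[τ i, τ (i+1)) ∩ [s, T]`, the state, closed up by its left limit
  at `τ (i+1)`, solves the Fokker--Planck equation. -/
  fokkerPlanck : ∀ ω, ∀ i ≤ M.n, s < M.τ (i + 1) →
    M.SolvesFP (fun t => X.α t ω)
      (Function.update (fun t => X.μ t ω) (M.τ (i + 1)) (X.pre (i + 1) ω))
      (max s (M.τ i)) (M.τ (i + 1))
  /-- Bayes update at the observation times -/
  update : ∀ ω, ∀ i ∈ Icc 1 M.n, s < M.τ i →
    X.μ (M.τ i) ω = M.bayes (X.β i ω) (X.pre i ω) (M.Y X i ω)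
  /-- no observation at time `T` -/
  no_update : ∀ ω, X.μ M.T ω = X.pre (M.n + 1) ω

/-- The running and measurement costs are integrable. -/
def FiniteCost (M : Model d k₁ k₂ Ω S O) (s : ℝ) (X : Path d k₁ k₂ Ω) : Prop :=
  Integrable (fun q : ℝ × Ω => M.ℓ q.1 (X.μ q.1 q.2) (X.α q.1 q.2))
      ((volume.restrict (Icc s M.T)).prod M.prob) ∧
    ∀ i ∈ Icc 1 M.n, s < M.τ i →
      Integrable (fun ω => M.h (M.τ i) (X.pre i ω) (X.β i ω)) M.prob

open Classical in
/-- The expected cost `J(s, μ; u)`; the measurement costs at the observation times after `s`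
count. -/
def J (M : Model d k₁ k₂ Ω S O) (s : ℝ) (X : Path d k₁ k₂ Ω) : ℝ :=
  ∫ ω, ((∫ t in s..M.T, M.ℓ t (X.μ t ω) (X.α t ω)) +
    (∑ i ∈ Finset.Icc 1 M.n,
      if s < M.τ i then M.h (M.τ i) (X.pre i ω) (X.β i ω) else 0) +
    M.g (X.μ M.T ω)) ∂M.prob

/-- The costs of all admissible controls on `[s, T]` of finite cost, from the initial law `μ₀`. -/
def costs (M : Model d k₁ k₂ Ω S O) (s : ℝ) (μ₀ : P d) : Set ℝ :=
  {c | ∃ X, M.IsAdmissible s μ₀ X ∧ M.FiniteCost s X ∧ M.J s X = c}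

/-- The function minimized in the Hamiltonian. -/
def hamFun (M : Model d k₁ k₂ Ω S O) (t : ℝ) (μ : P d) (p : E d → ℝ) (u : E k₁ × E k₂) : ℝ :=
  M.pairing u.1 μ p + M.ℓ t μ u.1

/-- The Hamiltonian `ℋ(t, μ, p)`. -/
def hamiltonian (M : Model d k₁ k₂ Ω S O) (t : ℝ) (μ : P d) (p : E d → ℝ) : ℝ :=
  sInf (M.hamFun t μ p '' M.U)

/-- The function minimized at the `i`-th observation time. -/
def impFun (M : Model d k₁ k₂ Ω S O) (W : ℝ → P d → ℝ) (i : ℕ) (μ : P d) (u : E k₁ × E k₂) : ℝ :=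
  M.h (M.τ i) μ u.2 + ∫ ω, W (M.τ i) (M.posterior i u.2 μ ω) ∂M.prob

/-- `W` is a classical solution of the interlaced HJB system, with time derivative `Wt` and flat
derivative `D`. The left limits at observation times, and at `T`, are joint limits in `(t, μ)`. -/
structure IsHJBSolution (M : Model d k₁ k₂ Ω S O) (W Wt : ℝ → P d → ℝ) (D : ℝ → P d → E d → ℝ) :
    Prop where
  regular : ∀ i ≤ M.n, IsRegularOn (Ico (M.τ i) (M.τ (i + 1))) W Wt D
  pde : ∀ i ≤ M.n, ∀ t ∈ Ico (M.τ i) (M.τ (i + 1)), ∀ μ,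
    Wt t μ + M.hamiltonian t μ (D t μ) = 0
  impulse : ∀ i ∈ Icc 1 M.n, ∀ μ,
    Tendsto (fun q : ℝ × P d => W q.1 q.2) (𝓝[<] (M.τ i) ×ˢ 𝓝 μ)
      (𝓝 (sInf (M.impFun W i μ '' M.U)))
  terminal : ∀ μ, W M.T μ = M.g μ
  terminal_limit : ∀ μ,
    Tendsto (fun q : ℝ × P d => W q.1 q.2) (𝓝[<] M.T ×ˢ 𝓝 μ) (𝓝 (M.g μ))

/-- `v` selects pointwise minimizers: of the Hamiltonian away from the observation times, and of
the impulse step at the observation times (`v (τ i) μ` being the value at `τ i -`). -/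
structure IsSelector (M : Model d k₁ k₂ Ω S O) (W : ℝ → P d → ℝ) (D : ℝ → P d → E d → ℝ)
    (v : ℝ → P d → E k₁ × E k₂) : Prop where
  mem : ∀ t ∈ Ico 0 M.T, ∀ μ, v t μ ∈ M.U
  ham : ∀ t ∈ Ico 0 M.T, t ∉ M.τ '' Icc 1 M.n → ∀ μ,
    ∀ u ∈ M.U, M.hamFun t μ (D t μ) (v t μ) ≤ M.hamFun t μ (D t μ) u
  imp : ∀ i ∈ Icc 1 M.n, ∀ μ,
    ∀ u ∈ M.U, M.impFun W i μ (v (M.τ i) μ) ≤ M.impFun W i μ u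

/-- The control in `X` is the feedback control of `v` along the state path of `X`. -/
def IsFeedback (M : Model d k₁ k₂ Ω S O) (s : ℝ) (v : ℝ → P d → E k₁ × E k₂)
    (X : Path d k₁ k₂ Ω) : Prop :=
  (∀ ω, ∀ t ∈ Ico s M.T, t ∉ M.τ '' Icc 1 M.n → X.α t ω = (v t (X.μ t ω)).1) ∧
    ∀ ω, ∀ i ∈ Icc 1 M.n, s < M.τ i → X.β i ω = (v (M.τ i) (X.pre i ω)).2

end Model

end NoisyObs

end

/-!
# Verification for the separated control problem with noisy observations

Between two observations the state solves a Fokker--Planck equation, and a classical solution `W`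
of the Hamilton--Jacobi--Bellman equation satisfies along it the chain rule
`W t₁ (m t₁) - W t₀ (m t₀) = ∫ (∂ₜW + ⟨𝒢*(α) m, D⟩)`
(`IsTrajectory.chain_rule`). With the equation for `W`, the
right-hand side is at least `- ∫ ℓ`, with equality for pointwise minimizers (`SolvesHJB.le_cost`,
`SolvesHJB.eq_cost`). At an observation time, the noise is independent of the control and the
state before the observation, so that the mean value after the observation can be computed by
averaging over the noise first (`IsAdmissible.integral_update`). By the impulse condition, the
value before the observation is a lower bound for the result. Summing over all intervals and
observations gives `W s μ₀ ≤ J` for every admissible control of finite cost (`FiniteCost.le_J`),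
and equality for the feedback control of pointwise minimizers
(`IsAdmissible.finiteCost_and_J_eq_of_feedback`).

Minimizers need not exist, so that it remains to construct admissible controls whose cost is close
to `W s μ₀`. By uniqueness and compactness, a constant control generates a continuous flow on the
space of measures (`Regular.exists_flow`), and near each `(t, μ)` some constant control is almost
optimal for a short time (`SolvesHJB.exists_local_control`). All trajectories from a given state
stay in a compact set (`Regular.exists_isCompact_reachable`), which allows these pieces to be
continued up to the next observation (`SolvesHJB.exists_openLoop`). The resulting open-loop
control depends on the state at the beginning of the interval. It is almost optimal for an open
set of such states, so the control can be chosen as a measurable function of the state with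
countably many values (`exists_measurable_selection`, `SolvesHJB.exists_policy`); the same applies
to the measurement controls (`IsHJBSolution.exists_measurement`). Joining these policies gives an
admissible control (`IsPolicy.isAdmissible`) whose cost exceeds `W s μ₀` by an arbitrarily small
amount (`IsHJBSolution.exists_J_le`).

All values are bounded, by backward induction over the observation times
(`IsHJBSolution.exists_bound_valueBefore`). This makes the continuity of the law of the updated
state applicable and guarantees that the means are finite.
-/

set_option linter.unusedSectionVars false

/-! ### The weak topology on probability measures -/

namespace NoisyObs

section Topology

variable {d : ℕ}

/-- The inverse of `ν ↦ charFun ν` is continuous for the compact-open topology by Lévy's theorem,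
and subspaces of `C(ℝ^d, ℂ)` are separable. -/
instance : SecondCountableTopology (P d) := by
  let e : P d → C(E d, ℂ) := fun ν =>
    ⟨fun t => charFun (ν : Measure (E d)) t, continuous_charFun⟩
  have he : Function.Injective e := by
    intro μ ν h
    refine Subtype.ext (Measure.ext_of_charFun (μ := (μ : Measure (E d)))
      (ν := (ν : Measure (E d))) (funext fun t => ?_))
    exact congrArg (fun f : C(E d, ℂ) => f t) h
  let s : Set C(E d, ℂ) := range e
  let f : s → P d := fun x => x.2.choose
  have hf : ∀ x : s, e (f x) = x := fun x => x.2.choose_spec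
  have hc : Continuous f := by
    apply SeqContinuous.continuous
    intro x p hx
    apply ProbabilityMeasure.tendsto_of_tendsto_charFun
    intro t
    have h1 : ∀ y : s, charFun (f y : Measure (E d)) t = (y : C(E d, ℂ)) t := fun y =>
      congrArg (fun g : C(E d, ℂ) => g t) (hf y)
    simp only [Function.comp, h1]
    exact ((continuous_eval_const t).comp continuous_subtype_val).continuousAt.tendsto.comp hx
  have hs : Function.Surjective f := fun ν => ⟨⟨e ν, ν, rfl⟩, he (hf _)⟩
  have : TopologicalSpace.SeparableSpace (P d) := hs.denseRange.separableSpace hc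
  let := TopologicalSpace.pseudoMetrizableSpacePseudoMetric (P d)
  exact UniformSpace.secondCountable_of_separable (P d)

theorem measurable_lintegral_probabilityMeasure (f : E d → ℝ≥0∞) (hf : Measurable f) :
    Measurable fun ν : P d => ∫⁻ x, f x ∂(ν : Measure (E d)) :=
  (Measure.measurable_lintegral hf).comp measurable_subtype_coe

/-- The weak topology is second countable and induced by integrals of bounded continuous
functions, which are measurable for the Giry `σ`-algebra. -/
instance : OpensMeasurableSpace (P d) := by
  constructor
  let T : (P d) → (BoundedContinuousFunction (E d) NNReal → NNReal) := fun ν f =>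
    (∫⁻ x, f x ∂(ν : Measure (E d))).toNNReal
  have hT : IsInducing T := by
    rw [isInducing_iff_nhds]
    intro ν
    apply le_antisymm
    · rw [← map_le_iff_le_comap]
      refine tendsto_pi_nhds.2 fun f => ?_
      exact (ProbabilityMeasure.continuous_testAgainstNN_eval f).continuousAt
    · rw [← tendsto_id']
      rw [ProbabilityMeasure.tendsto_iff_forall_lintegral_tendsto]
      intro f
      have : Tendsto T (comap T (𝓝 (T ν))) (𝓝 (T ν)) := tendsto_comap
      have h2 := (tendsto_pi_nhds.1 this) f
      have h3 := (ENNReal.continuous_coe.tendsto _).comp h2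
      have h4 : ∀ μ : P d, ((T μ f : NNReal) : ℝ≥0∞) = ∫⁻ x, f x ∂(μ : Measure (E d)) := fun μ =>
        ENNReal.coe_toNNReal (BoundedContinuousFunction.lintegral_lt_top_of_nnreal _ f).ne
      simpa [Function.comp_def, h4] using h3
  have hb : (inferInstance : TopologicalSpace (P d)) = TopologicalSpace.generateFrom
      {s | ∃ (f : BoundedContinuousFunction (E d) NNReal) (v : Set NNReal), IsOpen v ∧
        (fun ν => T ν f) ⁻¹' v = s} := by
    apply le_antisymm
    · apply le_generateFrom
      rintro _ ⟨f, v, hv, rfl⟩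
      exact hv.preimage ((continuous_apply f).comp hT.continuous)
    · rw [show (inferInstance : TopologicalSpace (P d)) = _ from hT.eq_induced, Pi.topologicalSpace,
        induced_iInf]
      refine le_iInf fun f => ?_
      rw [induced_compose]
      rintro _ ⟨v, hv, rfl⟩
      exact TopologicalSpace.GenerateOpen.basic _ ⟨f, v, hv, rfl⟩
  rw [borel_eq_generateFrom_of_subbasis hb]
  apply MeasurableSpace.generateFrom_le
  rintro _ ⟨f, v, hv, rfl⟩
  exact hv.measurableSet.preimage (measurable_lintegral_probabilityMeasure _
    f.continuous.measurable.coe_nnreal_ennreal).ennreal_toNNReal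

/-- A closed set is approximated by continuous functions, so that its mass is Borel measurable. -/
instance : BorelSpace (P d) := by
  refine ⟨le_antisymm ?_ OpensMeasurableSpace.borel_le⟩
  have h : @Measurable (P d) (Measure (E d)) (borel (P d)) _ (fun ν => (ν : Measure (E d))) := by
    refine @Measurable.measure_of_isPiSystem_of_isProbabilityMeasure _ _ (borel (P d)) _
      (fun ν : P d => (ν : Measure (E d))) _ {s | IsClosed s} ?_ isPiSystem_isClosed ?_
    · rw [← borel_eq_generateFrom_isClosed]; exact BorelSpace.measurable_eq
    · intro F (hF : IsClosed F)
      let : MeasurableSpace (P d) := borel (P d)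
      have : BorelSpace (P d) := ⟨rfl⟩
      refine measurable_of_tendsto_metrizable
        (f := fun n (ν : P d) => ∫⁻ x, (hF.apprSeq n x : ℝ≥0∞) ∂(ν : Measure (E d))) (fun n => ?_)
        (tendsto_pi_nhds.2 fun ν => HasOuterApproxClosed.tendsto_lintegral_apprSeq hF _)
      exact (ProbabilityMeasure.continuous_lintegral_boundedContinuousFunction _).measurable
  exact h.comap_le.trans' le_rfl

/-- Continuity of integrals when the integrand and the measure vary together. -/
theorem continuous_integral_joint {Q : Type*} [TopologicalSpace Q]
    [TopologicalSpace.PseudoMetrizableSpace Q] [SecondCountableTopology Q] {H : Q × E d → ℝ}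
    (hH : Continuous H) (hb : ∀ K : Set Q, IsCompact K → ∃ C : ℝ, ∀ q ∈ K, ∀ x, |H (q, x)| ≤ C) :
    Continuous fun z : Q × P d => ∫ x, H (z.1, x) ∂(z.2 : Measure (E d)) := by
  rw [← continuousOn_univ]
  apply SeqContinuous.continuous _ |>.continuousOn
  intro z z₀ hz
  have hz1 : Tendsto (fun n => (z n).1) atTop (𝓝 z₀.1) := (continuous_fst.tendsto _).comp hz
  have hz2 : Tendsto (fun n => (z n).2) atTop (𝓝 z₀.2) := (continuous_snd.tendsto _).comp hz
  set K : Set Q := insert z₀.1 (range fun n => (z n).1) with hK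
  obtain ⟨C, hC⟩ := hb K hz1.isCompact_insert_range
  let : MeasurableSpace K := borel K
  have : BorelSpace K := ⟨rfl⟩
  let F : BoundedContinuousFunction (K × E d) ℝ := BoundedContinuousFunction.ofNormedAddCommGroup
    (fun y => H (y.1, y.2)) (by fun_prop) C (fun y => hC _ y.1.2 _)
  have key : ∀ (k : K) (ν : P d), ∫ y, F y ∂((diracProba k).prod ν : Measure (K × E d)) =
      ∫ x, H (k, x) ∂(ν : Measure (E d)) := by
    intro k ν
    rw [ProbabilityMeasure.toMeasure_prod]
    simp only [diracProba, ProbabilityMeasure.coe_mk]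
    rw [Measure.dirac_prod, integral_map (by fun_prop) F.continuous.aestronglyMeasurable]
    rfl
  let k : ℕ → K := fun n => ⟨(z n).1, mem_insert_of_mem _ ⟨n, rfl⟩⟩
  let k₀ : K := ⟨z₀.1, mem_insert _ _⟩
  have hk : Tendsto k atTop (𝓝 k₀) := tendsto_subtype_rng.2 hz1
  have h := ((ProbabilityMeasure.continuous_integral_boundedContinuousFunction F).comp
    (ProbabilityMeasure.continuous_prod.comp (continuous_diracProba.prodMap continuous_id))).tendsto
      (k₀, z₀.2)
  have h2 := h.comp (hk.prodMk_nhds hz2)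
  simp only [Function.comp_def, Prod.map] at h2
  simp only [key] at h2
  exact h2

/-- Measurability of integrals when the integrand and the measure vary together. -/
theorem measurable_integral_joint {Q : Type*} [MeasurableSpace Q] {H : Q → E d → ℝ}
    (hH : Measurable (Function.uncurry H)) {m : Q → P d} (hm : Measurable m) :
    Measurable fun q => ∫ x, H q x ∂(m q : Measure (E d)) := by
  let κ : Kernel Q (E d) := ⟨fun q => (m q : Measure (E d)), measurable_subtype_coe.comp hm⟩
  have : IsMarkovKernel κ := ⟨fun q => (m q).2⟩
  exact (StronglyMeasurable.integral_kernel_prod_right (κ := κ) hH.stronglyMeasurable).measurable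

/-! ### Mixtures of measures -/

theorem integral_mix (r : ℝ) (hr : r ∈ Icc (0 : ℝ) 1) (μ ν : P d) {f : E d → ℝ}
    (hf : Integrable f (μ : Measure (E d))) (hf' : Integrable f (ν : Measure (E d))) :
    ∫ x, f x ∂(mix r μ ν : Measure (E d)) =
      (1 - r) * ∫ x, f x ∂(ν : Measure (E d)) + r * ∫ x, f x ∂(μ : Measure (E d)) := by
  have h : (projIcc (0 : ℝ) 1 zero_le_one r : ℝ) = r := by rw [projIcc_of_mem _ hr]
  unfold mix
  simp only [ProbabilityMeasure.coe_mk, h]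
  rw [integral_add_measure (hf'.smul_measure (by simp)) (hf.smul_measure (by simp)),
    integral_smul_measure, integral_smul_measure, ENNReal.toReal_ofReal (by linarith [hr.2]),
    ENNReal.toReal_ofReal hr.1]
  simp

theorem mix_self (r : ℝ) (μ : P d) : mix r μ μ = μ := by
  apply Subtype.ext
  have h := (projIcc (0 : ℝ) 1 zero_le_one r).2
  simp only [mix]
  rw [← add_smul, ← ENNReal.ofReal_add (by linarith [h.2]) h.1]
  simp

theorem mix_projIcc (r : ℝ) (μ ν : P d) :
    mix (projIcc (0 : ℝ) 1 zero_le_one r) μ ν = mix r μ ν := by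
  apply Subtype.ext
  simp [mix, projIcc_val]

theorem continuous_mix : Continuous fun z : ℝ × P d × P d => mix z.1 z.2.1 z.2.2 := by
  rw [ProbabilityMeasure.continuous_iff_forall_continuous_integral]
  intro f
  have h : ∀ z : ℝ × P d × P d, ∫ x, f x ∂(mix z.1 z.2.1 z.2.2 : Measure (E d)) =
      (1 - (projIcc (0 : ℝ) 1 zero_le_one z.1 : ℝ)) * ∫ x, f x ∂(z.2.2 : Measure (E d)) +
        (projIcc (0 : ℝ) 1 zero_le_one z.1 : ℝ) * ∫ x, f x ∂(z.2.1 : Measure (E d)) := by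
    intro z
    rw [← mix_projIcc, integral_mix _ (projIcc (0 : ℝ) 1 zero_le_one z.1).2 _ _ (f.integrable _)
      (f.integrable _)]
  have hp : Continuous fun z : ℝ × P d × P d => (projIcc (0 : ℝ) 1 zero_le_one z.1 : ℝ) :=
    continuous_subtype_val.comp (continuous_projIcc.comp continuous_fst)
  have hf := ProbabilityMeasure.continuous_integral_boundedContinuousFunction f
  simp only [h]
  exact ((continuous_const.sub hp).mul (hf.comp (by fun_prop))).add (hp.mul (hf.comp (by fun_prop)))

theorem _root_.Continuous.mix {X : Type*} [TopologicalSpace X] {r : X → ℝ} {μ ν : X → P d}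
    (hr : Continuous r) (hμ : Continuous μ) (hν : Continuous ν) :
    Continuous fun z => NoisyObs.mix (r z) (μ z) (ν z) := by
  have h := continuous_mix.comp (hr.prodMk (hμ.prodMk hν))
  exact h

/-! ### Measurable selection -/

/-- A measurable choice among open conditions: by the Lindelöf property, countably many of the
conditions suffice, and the first one that holds is a measurable function of the point. -/
theorem exists_measurable_selection {X I : Type*} [TopologicalSpace X] [SecondCountableTopology X]
    [MeasurableSpace X] [OpensMeasurableSpace X] [Nonempty X] {O : I → Set X}
    (hO : ∀ i, IsOpen (O i)) (hcov : ∀ x, ∃ i, x ∈ O i) :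
    ∃ (e : ℕ → I) (c : X → ℕ), Measurable c ∧ ∀ x, x ∈ O (e (c x)) := by
  classical
  obtain ⟨T, hT, hU⟩ := TopologicalSpace.isOpen_iUnion_countable O hO
  have hU' : ∀ x, ∃ i ∈ T, x ∈ O i := fun x => by
    have : x ∈ ⋃ i ∈ T, O i := hU ▸ mem_iUnion.2 (hcov x)
    simpa using this
  have hne : T.Nonempty := by
    obtain ⟨x⟩ := ‹Nonempty X›
    obtain ⟨i, hi, -⟩ := hU' x
    exact ⟨i, hi⟩
  obtain ⟨e, he⟩ := hT.exists_eq_range hne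
  have hex : ∀ x, ∃ k, x ∈ O (e k) := fun x => by
    obtain ⟨i, hi, hx⟩ := hU' x
    rw [he] at hi
    obtain ⟨k, rfl⟩ := hi
    exact ⟨k, hx⟩
  exact ⟨e, fun x => Nat.find (hex x), measurable_find hex fun k => (hO _).measurableSet,
    fun x => Nat.find_spec (hex x)⟩

instance : Nonempty (P d) := ⟨⟨Measure.dirac 0, inferInstance⟩⟩

end Topology
end NoisyObs

/-! ### Cutoff functions -/

namespace NoisyObs

section Calculus

variable {V : Type*} [NormedAddCommGroup V] [InnerProductSpace ℝ V]

theorem exists_norm_fderiv_le {F : Type*} [NormedAddCommGroup F] [NormedSpace ℝ F] {f : V → F}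
    (hf : ContDiff ℝ 1 f) (hs : HasCompactSupport f) : ∃ B : ℝ, ∀ x, ‖fderiv ℝ f x‖ ≤ B :=
  (hf.continuous_fderiv (by norm_num)).bounded_above_of_compact_support (hs.fderiv ℝ)

theorem norm_fderiv_neg {F : Type*} [NormedAddCommGroup F] [NormedSpace ℝ F] {f : V → F} (x : V) :
    ‖fderiv ℝ (fun x => -f x) x‖ = ‖fderiv ℝ f x‖ := by
  rw [fderiv_fun_neg, norm_neg]

/-- A cutoff function vanishing on the unit ball and equal to `1` off the ball of radius `2`. -/
theorem exists_cutoff [FiniteDimensional ℝ V] : ∃ (f : V → ℝ) (B : ℝ), ContDiff ℝ 2 f ∧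
    (∀ x, 0 ≤ f x) ∧ (∀ x, f x ≤ 1) ∧ (∀ x, ‖x‖ ≤ 1 → f x = 0) ∧ (∀ x, 2 ≤ ‖x‖ → f x = 1) ∧
    ∀ x, ‖fderiv ℝ f x‖ ≤ B ∧ ‖fderiv ℝ (fderiv ℝ f) x‖ ≤ B := by
  obtain ⟨φ, hin, hout⟩ : ∃ φ : ContDiffBump (0 : V), φ.rIn = 1 ∧ φ.rOut = 2 :=
    ⟨⟨1, 2, one_pos, one_lt_two⟩, rfl, rfl⟩
  have hφ : ContDiff ℝ 2 φ := φ.contDiff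
  obtain ⟨B₁, hB₁⟩ := exists_norm_fderiv_le (hφ.of_le (by norm_num)) φ.hasCompactSupport
  obtain ⟨B₂, hB₂⟩ := exists_norm_fderiv_le (hφ.fderiv_right (m := 1) (by norm_num))
    (φ.hasCompactSupport.fderiv ℝ)
  have e1 : fderiv ℝ (fun x => 1 - φ x) = fun x => -fderiv ℝ φ x := by
    funext x; exact fderiv_const_sub 1
  refine ⟨fun x => 1 - φ x, max B₁ B₂, contDiff_const.sub hφ, fun x => ?_, fun x => ?_,
    fun x hx => ?_, fun x hx => ?_, fun x => ⟨?_, ?_⟩⟩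
  · linarith [φ.le_one (x := x)]
  · linarith [φ.nonneg (x := x)]
  · beta_reduce
    rw [φ.one_of_mem_closedBall (by simpa [hin] using hx), sub_self]
  · beta_reduce
    rw [φ.zero_of_le_dist (by simpa [hout] using hx), sub_zero]
  · rw [e1, norm_neg]; exact (hB₁ x).trans (le_max_left _ _)
  · rw [e1, norm_fderiv_neg]; exact (hB₂ x).trans (le_max_right _ _)

theorem norm_fderiv_comp_const_smul {F : Type*} [NormedAddCommGroup F] [NormedSpace ℝ F]
    {f : V → F} (c : ℝ) (x : V) :
    ‖fderiv ℝ (fun x => f (c • x)) x‖ = |c| * ‖fderiv ℝ f (c • x)‖ := by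
  have h : fderiv ℝ (fun x => f (c • x)) x = c • fderiv ℝ f (c • x) := fderiv_comp_smul c
  rw [h, norm_smul, Real.norm_eq_abs]

theorem norm_fderiv_const_smul_comp {F : Type*} [NormedAddCommGroup F] [NormedSpace ℝ F]
    {f : V → F} (hf : Differentiable ℝ f) (c : ℝ) (x : V) :
    ‖fderiv ℝ (fun x => c • f (c • x)) x‖ = |c| * (|c| * ‖fderiv ℝ f (c • x)‖) := by
  have h : fderiv ℝ (fun x => c • f (c • x)) x = c • fderiv ℝ (fun x => f (c • x)) x :=
    fderiv_fun_const_smul (hf.comp (differentiable_id.const_smul c) x) c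
  rw [h, norm_smul, norm_fderiv_comp_const_smul, Real.norm_eq_abs]

theorem norm_fderiv_fderiv_comp_const_smul {f : V → ℝ} (hf : ContDiff ℝ 2 f) (c : ℝ) (x : V) :
    ‖fderiv ℝ (fderiv ℝ (fun x => f (c • x))) x‖ =
      |c| * (|c| * ‖fderiv ℝ (fderiv ℝ f) (c • x)‖) := by
  have hd : Differentiable ℝ (fderiv ℝ f) :=
    (hf.fderiv_right (m := 1) (by norm_num)).differentiable (by norm_num)
  have h : fderiv ℝ (fun x => f (c • x)) = fun x => c • fderiv ℝ f (c • x) := by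
    funext x; exact fderiv_comp_smul c
  rw [h]
  exact norm_fderiv_const_smul_comp hd c x

end Calculus

/-! ### Test functions and tightness -/

section TestFunctions

variable {d : ℕ}

theorem IsCb2.continuous {f : E d → ℝ} (hf : IsCb2 f) : Continuous f := hf.1.continuous

theorem IsCb2.continuous_fderiv {f : E d → ℝ} (hf : IsCb2 f) : Continuous (fderiv ℝ f) :=
  hf.1.continuous_fderiv (by norm_num)

theorem IsCb2.continuous_fderiv_fderiv {f : E d → ℝ} (hf : IsCb2 f) :
    Continuous (fderiv ℝ (fderiv ℝ f)) :=
  (hf.1.fderiv_right (m := 1) (by norm_num)).continuous_fderiv (by norm_num)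

theorem IsCb2.integrable {f : E d → ℝ} (hf : IsCb2 f) (ν : P d) :
    Integrable f (ν : Measure (E d)) := by
  obtain ⟨C, hC⟩ := hf.2
  exact Integrable.of_bound hf.continuous.aestronglyMeasurable C (.of_forall fun x => (hC x).1)

theorem IsCb2.comp_inner {g : ℝ → ℝ} (hg : ContDiff ℝ 2 g) (h0 : ∀ x, |g x| ≤ 1)
    (h1 : ∀ x, |deriv g x| ≤ 1) (h2 : ∀ x, |deriv (deriv g) x| ≤ 1) (v : E d) :
    IsCb2 fun x => g (inner ℝ v x) := by
  let L : E d →L[ℝ] ℝ := innerSL ℝ v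
  have hL : (fun x => g (inner ℝ v x)) = fun x => g (L x) := rfl
  have hg1 : Differentiable ℝ g := hg.differentiable (by norm_num)
  have hg2 : Differentiable ℝ (deriv g) :=
    (ContDiff.iterate_deriv' 1 1 hg).differentiable (by norm_num)
  have e1 : fderiv ℝ (fun x => g (L x)) = fun x => deriv g (L x) • L := by
    funext x
    exact ((hg1 (L x)).hasDerivAt.comp_hasFDerivAt x L.hasFDerivAt).fderiv
  have e2 : ∀ x, fderiv ℝ (fun x => deriv g (L x) • L) x =
      (deriv (deriv g) (L x) • L).smulRight L := by
    intro x
    exact (((hg2 (L x)).hasDerivAt.comp_hasFDerivAt x L.hasFDerivAt).smul_const L).fderiv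
  rw [hL]
  refine ⟨hg.comp L.contDiff, max 1 (max ‖L‖ (‖L‖ * ‖L‖)), fun x => ⟨?_, ?_, ?_⟩⟩
  · exact (h0 _).trans (le_max_left _ _)
  · rw [e1, norm_smul]
    refine le_trans ?_ ((le_max_left _ _).trans (le_max_right _ _))
    calc ‖deriv g (L x)‖ * ‖L‖ ≤ 1 * ‖L‖ := by gcongr; exact h1 _
      _ = ‖L‖ := one_mul _
  · rw [e1, e2, ContinuousLinearMap.norm_smulRight_apply, norm_smul]
    refine le_trans ?_ ((le_max_right _ _).trans (le_max_right _ _))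
    calc ‖deriv (deriv g) (L x)‖ * ‖L‖ * ‖L‖ ≤ 1 * ‖L‖ * ‖L‖ := by gcongr; exact h2 _
      _ = ‖L‖ * ‖L‖ := by ring

theorem charFun_eq_cos_add_sin (ν : P d) (v : E d) :
    charFun (ν : Measure (E d)) v = ((∫ x, Real.cos (inner ℝ v x) ∂(ν : Measure (E d)) : ℝ) : ℂ) +
      ((∫ x, Real.sin (inner ℝ v x) ∂(ν : Measure (E d)) : ℝ) : ℂ) * Complex.I := by
  rw [charFun_apply, ← integral_complex_ofReal, ← integral_complex_ofReal, ← integral_mul_const,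
    ← integral_add]
  · congr 1
    funext x
    rw [Complex.exp_mul_I, ← Complex.ofReal_cos, ← Complex.ofReal_sin, real_inner_comm]
  · refine Integrable.of_bound (by fun_prop) 1 (.of_forall fun x => ?_)
    rw [Complex.norm_real]; exact Real.abs_cos_le_one _
  · refine Integrable.mul_const (Integrable.of_bound (by fun_prop) 1 (.of_forall fun x => ?_)) _
    rw [Complex.norm_real]; exact Real.abs_sin_le_one _

theorem isCb2_cos (v : E d) : IsCb2 fun x => Real.cos (inner ℝ v x) := by
  apply IsCb2.comp_inner Real.contDiff_cos Real.abs_cos_le_one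
  · simpa using Real.abs_sin_le_one
  · intro x
    simpa [Real.deriv_cos'] using Real.abs_cos_le_one x

theorem isCb2_sin (v : E d) : IsCb2 fun x => Real.sin (inner ℝ v x) := by
  apply IsCb2.comp_inner Real.contDiff_sin Real.abs_sin_le_one
  · simpa using Real.abs_cos_le_one
  · intro x
    simpa using Real.abs_sin_le_one x

/-- The trigonometric functions in `C_b²` determine weak convergence, by Lévy's theorem. -/
theorem tendsto_of_isCb2 {ν : ℕ → P d} {ν₀ : P d}
    (h : ∀ f : E d → ℝ, IsCb2 f → Tendsto (fun n => ∫ x, f x ∂(ν n : Measure (E d))) atTop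
      (𝓝 (∫ x, f x ∂(ν₀ : Measure (E d))))) : Tendsto ν atTop (𝓝 ν₀) := by
  apply ProbabilityMeasure.tendsto_of_tendsto_charFun
  intro v
  simp only [charFun_eq_cos_add_sin]
  exact ((Complex.continuous_ofReal.tendsto _).comp (h _ (isCb2_cos v))).add
    (((Complex.continuous_ofReal.tendsto _).comp (h _ (isCb2_sin v))).mul_const _)

theorem continuous_integral_of_isCb2 {f : E d → ℝ} (hf : IsCb2 f) :
    Continuous fun ν : P d => ∫ x, f x ∂(ν : Measure (E d)) := by
  obtain ⟨C, hC⟩ := hf.2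
  exact ProbabilityMeasure.continuous_integral_boundedContinuousFunction
    (BoundedContinuousFunction.ofNormedAddCommGroup f hf.continuous C fun x => (hC x).1)

/-- A set of measures whose integrals of test functions are close to those of a tight set, with an
error controlled by the derivatives of the test function, is tight. -/
theorem isTight_of_close {S R : Set (P d)} {C : ℝ}
    (hS : IsTightMeasureSet {((μ : P d) : Measure (E d)) | μ ∈ S})
    (h : ∀ ν ∈ R, ∃ μ ∈ S, ∀ (f : E d → ℝ) (B : ℝ), IsCb2 f →
      (∀ x, ‖fderiv ℝ f x‖ ≤ B ∧ ‖fderiv ℝ (fderiv ℝ f) x‖ ≤ B) →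
        ∫ x, f x ∂(ν : Measure (E d)) ≤ ∫ x, f x ∂(μ : Measure (E d)) + C * B) :
    IsTightMeasureSet {((μ : P d) : Measure (E d)) | μ ∈ R} := by
  rw [isTightMeasureSet_iff_exists_isCompact_measure_compl_le] at hS ⊢
  intro ε hε
  obtain rfl | hεt := eq_or_ne ε ⊤
  · exact ⟨∅, isCompact_empty, fun _ _ => le_top⟩
  obtain ⟨f, B, hf, hf0, hf1, hfs, hfl, hfB⟩ := exists_cutoff (V := E d)
  have hB : 0 ≤ B := (norm_nonneg _).trans (hfB 0).1
  set η := ε.toReal with hη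
  have hηp : 0 < η := ENNReal.toReal_pos hε.ne' hεt
  obtain ⟨K, hK, hKS⟩ := hS (ENNReal.ofReal (η / 2)) (by simpa using hηp)
  obtain ⟨r₀, hr₀⟩ := hK.isBounded.subset_closedBall 0
  have hex : ∃ r : ℝ, 1 ≤ r ∧ r₀ ≤ r ∧ C * (B / r) ≤ η / 2 := by
    have h1 : Tendsto (fun r : ℝ => C * (B / r)) atTop (𝓝 (C * 0)) :=
      (tendsto_const_nhds.div_atTop tendsto_id).const_mul C
    rw [mul_zero] at h1
    exact ((eventually_ge_atTop 1).and ((eventually_ge_atTop r₀).and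
      (h1.eventually_le_const (by positivity)))).exists
  obtain ⟨r, hr1, hr0, hr⟩ := hex
  -- the rescaled cutoff function `f (x / r)` has derivatives of size `B / r`
  have hrp : 0 < r := by linarith
  have hcr : r⁻¹ ≤ 1 := inv_le_one_of_one_le₀ hr1
  refine ⟨Metric.closedBall 0 (2 * r), isCompact_closedBall _ _, ?_⟩
  rintro _ ⟨ν, hν, rfl⟩
  obtain ⟨μ, hμ, hle⟩ := h ν hν
  let g : E d → ℝ := fun x => f (r⁻¹ • x)
  have hnorm : ∀ x : E d, ‖r⁻¹ • x‖ = ‖x‖ / r := fun x => by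
    rw [norm_smul, norm_inv, Real.norm_of_nonneg hrp.le]; field_simp
  have hgB : ∀ x, ‖fderiv ℝ g x‖ ≤ B / r ∧ ‖fderiv ℝ (fderiv ℝ g) x‖ ≤ B / r := by
    intro x
    have hn : |r⁻¹| = r⁻¹ := abs_of_nonneg (by positivity)
    constructor
    · rw [norm_fderiv_comp_const_smul, hn, div_eq_inv_mul]
      gcongr
      exact (hfB _).1
    · rw [norm_fderiv_fderiv_comp_const_smul hf, hn, div_eq_inv_mul]
      gcongr
      calc r⁻¹ * ‖fderiv ℝ (fderiv ℝ f) (r⁻¹ • x)‖ ≤ 1 * B := by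
            gcongr
            exact (hfB _).2
        _ = B := one_mul B
  have hg : IsCb2 g := by
    refine ⟨hf.comp (contDiff_id.const_smul _), max 1 (B / r), fun x => ⟨?_, ?_, ?_⟩⟩
    · rw [abs_of_nonneg (hf0 _)]; exact (hf1 _).trans (le_max_left _ _)
    · exact (hgB x).1.trans (le_max_right _ _)
    · exact (hgB x).2.trans (le_max_right _ _)
  have h3 := hle g (B / r) hg hgB
  have h4 : (ν : Measure (E d)).real (Metric.closedBall 0 (2 * r))ᶜ ≤
      ∫ x, g x ∂(ν : Measure (E d)) := by
    rw [← integral_indicator_one Metric.isClosed_closedBall.measurableSet.compl]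
    refine integral_mono ((integrable_const 1).indicator
      Metric.isClosed_closedBall.measurableSet.compl) (hg.integrable ν) fun x => ?_
    by_cases hx : x ∈ (Metric.closedBall (0 : E d) (2 * r))ᶜ
    · rw [indicator_of_mem hx]
      simp only [mem_compl_iff, mem_closedBall_zero_iff, not_le] at hx
      refine (hfl _ ?_).ge
      rw [hnorm, le_div_iff₀ hrp]
      exact hx.le
    · rw [indicator_of_notMem hx]; exact hf0 _
  have h5 : ∫ x, g x ∂(μ : Measure (E d)) ≤ (μ : Measure (E d)).real Kᶜ := by
    rw [← integral_indicator_one hK.measurableSet.compl]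
    refine integral_mono (hg.integrable μ) ((integrable_const 1).indicator
      hK.measurableSet.compl) fun x => ?_
    by_cases hx : x ∈ Kᶜ
    · rw [indicator_of_mem hx]; exact hf1 _
    · rw [indicator_of_notMem hx]
      have hxK : ‖x‖ ≤ r := by
        have := hr₀ (not_not.1 hx)
        rw [mem_closedBall_zero_iff] at this
        exact this.trans hr0
      exact (hfs _ (by rw [hnorm]; exact div_le_one_of_le₀ hxK hrp.le)).le
  have h6 : (μ : Measure (E d)).real Kᶜ ≤ η / 2 :=
    ENNReal.toReal_le_of_le_ofReal (by positivity) (hKS _ ⟨μ, hμ, rfl⟩)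
  have h7 : (ν : Measure (E d)).real (Metric.closedBall 0 (2 * r))ᶜ ≤ η := by linarith
  rw [Measure.real, hη, ENNReal.toReal_le_toReal (measure_ne_top _ _) hεt] at h7
  exact h7

end TestFunctions
end NoisyObs

/-! ### The controlled Fokker--Planck equation -/

namespace NoisyObs
namespace Model

variable {d k₁ k₂ : ℕ} {Ω S O : Type*} [MeasurableSpace Ω] [MeasurableSpace S] [MeasurableSpace O]

/-- The set `A` of values of the control of the dynamics. -/
def ctrl (M : Model d k₁ k₂ Ω S O) : Set (E k₁) := Prod.fst '' M.U

/-- The value of `𝒢(α) f` at `x` as a function of the first two derivatives `L`, `H` of `f`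
at `x`. -/
noncomputable def symbol (M : Model d k₁ k₂ Ω S O) (α : E k₁) (x : E d) (L : E d →L[ℝ] ℝ)
    (H : E d →L[ℝ] E d →L[ℝ] ℝ) : ℝ :=
  ∑ i, M.b x α i * L (EuclideanSpace.single i 1) +
    (1 / 2) * ∑ i, ∑ j, M.a x α i j * H (EuclideanSpace.single i 1) (EuclideanSpace.single j 1)

variable {M : Model d k₁ k₂ Ω S O}

theorem gen_eq_symbol (α : E k₁) (f : E d → ℝ) (x : E d) :
    M.gen α f x = M.symbol α x (fderiv ℝ f x) (fderiv ℝ (fderiv ℝ f) x) := rfl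

theorem symbol_sub (α : E k₁) (x : E d) (L L' : E d →L[ℝ] ℝ) (H H' : E d →L[ℝ] E d →L[ℝ] ℝ) :
    M.symbol α x (L - L') (H - H') = M.symbol α x L H - M.symbol α x L' H' := by
  simp only [symbol, sub_apply, mul_sub, Finset.sum_sub_distrib]
  ring

theorem Regular.exists_symbol_bound (hM : M.Regular) : ∃ C : ℝ, 0 ≤ C ∧ ∀ α ∈ M.ctrl, ∀ x L H,
    |M.symbol α x L H| ≤ C * (‖L‖ + ‖H‖) := by
  obtain ⟨Cb, hCb⟩ := hM.b_bounded
  obtain ⟨Ca, hCa⟩ := hM.a_bounded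
  refine ⟨d * |Cb| + d * (d * |Ca|), by positivity, ?_⟩
  rintro α ⟨u, hu, rfl⟩ x L H
  have h1 : |∑ i, M.b x u.1 i * L (EuclideanSpace.single i 1)| ≤ d * |Cb| * ‖L‖ := by
    calc |∑ i, M.b x u.1 i * L (EuclideanSpace.single i 1)|
        ≤ ∑ i : Fin d, |M.b x u.1 i * L (EuclideanSpace.single i 1)| :=
          Finset.abs_sum_le_sum_abs _ _
      _ ≤ ∑ i : Fin d, |Cb| * ‖L‖ := by
          refine Finset.sum_le_sum fun i _ => ?_
          rw [abs_mul]
          refine mul_le_mul ?_ ?_ (abs_nonneg _) (abs_nonneg _)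
          · exact ((PiLp.norm_apply_le (M.b x u.1) i).trans (hCb u hu x)).trans (le_abs_self _)
          · simpa using L.le_opNorm (EuclideanSpace.single i 1)
      _ = d * |Cb| * ‖L‖ := by simp [mul_assoc]
  have h2 : |∑ i, ∑ j, M.a x u.1 i j * H (EuclideanSpace.single i 1) (EuclideanSpace.single j 1)| ≤
      d * (d * |Ca|) * ‖H‖ := by
    calc |∑ i, ∑ j, M.a x u.1 i j * H (EuclideanSpace.single i 1) (EuclideanSpace.single j 1)|
        ≤ ∑ i : Fin d, |∑ j, M.a x u.1 i j *
            H (EuclideanSpace.single i 1) (EuclideanSpace.single j 1)| :=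
          Finset.abs_sum_le_sum_abs _ _
      _ ≤ ∑ i : Fin d, ∑ j : Fin d, |M.a x u.1 i j *
            H (EuclideanSpace.single i 1) (EuclideanSpace.single j 1)| :=
          Finset.sum_le_sum fun i _ => Finset.abs_sum_le_sum_abs _ _
      _ ≤ ∑ i : Fin d, ∑ j : Fin d, |Ca| * ‖H‖ := by
          refine Finset.sum_le_sum fun i _ => Finset.sum_le_sum fun j _ => ?_
          rw [abs_mul]
          refine mul_le_mul ((hCa u hu x i j).trans (le_abs_self _)) ?_ (abs_nonneg _)
            (abs_nonneg _)
          simpa using H.le_opNorm₂ (EuclideanSpace.single i 1) (EuclideanSpace.single j 1)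
      _ = d * (d * |Ca|) * ‖H‖ := by simp [mul_assoc]
  unfold symbol
  have h3 := abs_add_le (∑ i, M.b x u.1 i * L (EuclideanSpace.single i 1))
    ((1 / 2) * ∑ i, ∑ j, M.a x u.1 i j * H (EuclideanSpace.single i 1) (EuclideanSpace.single j 1))
  rw [abs_mul, abs_of_pos (show (0 : ℝ) < 1 / 2 by norm_num)] at h3
  have h4 : 0 ≤ d * |Cb| * ‖H‖ := by positivity
  have h5 : 0 ≤ d * (d * |Ca|) * ‖L‖ := by positivity
  have h6 : 0 ≤ d * (d * |Ca|) * ‖H‖ := by positivity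
  nlinarith

theorem Regular.measurable_symbol (hM : M.Regular) {Q : Type*} [MeasurableSpace Q] {α : Q → E k₁}
    {x : Q → E d} {L : Q → E d →L[ℝ] ℝ} {H : Q → E d →L[ℝ] E d →L[ℝ] ℝ} (hα : Measurable α)
    (hx : Measurable x) (hL : Measurable L) (hH : Measurable H) :
    Measurable fun q => M.symbol (α q) (x q) (L q) (H q) := by
  unfold symbol
  have hb : Measurable fun q => M.b (x q) (α q) := hM.b_measurable.comp (hx.prodMk hα)
  refine (Finset.measurable_fun_sum _ fun i _ => ?_).add
    ((Finset.measurable_fun_sum _ fun i _ => Finset.measurable_fun_sum _ fun j _ => ?_).const_mul _)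
  · exact ((EuclideanSpace.proj i : E d →L[ℝ] ℝ).measurable.comp hb).mul
      (hL.apply_continuousLinearMap _)
  · exact ((hM.a_measurable i j).comp (hx.prodMk hα)).mul
      ((hH.apply_continuousLinearMap _).apply_continuousLinearMap _)

theorem Regular.continuous_symbol (hM : M.Regular) {Q : Type*} [TopologicalSpace Q] {α : E k₁}
    (hα : α ∈ M.ctrl) {x : Q → E d} {L : Q → E d →L[ℝ] ℝ} {H : Q → E d →L[ℝ] E d →L[ℝ] ℝ}
    (hx : Continuous x) (hL : Continuous L) (hH : Continuous H) :
    Continuous fun q => M.symbol α (x q) (L q) (H q) := by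
  obtain ⟨u, hu, rfl⟩ := hα
  unfold symbol
  have hb : Continuous fun q => M.b (x q) u.1 := (hM.b_continuous u hu).comp hx
  refine (continuous_finsetSum _ fun i _ => ?_).add
    (continuous_const.mul (continuous_finsetSum _ fun i _ => continuous_finsetSum _ fun j _ => ?_))
  · exact ((EuclideanSpace.proj i : E d →L[ℝ] ℝ).continuous.comp hb).mul
      (hL.clm_apply continuous_const)
  · exact ((hM.a_continuous u hu i j).comp hx).mul
      ((hH.clm_apply continuous_const).clm_apply continuous_const)

/-- `B` bounds the first and second derivatives of `f`. -/
def DerivBound (f : E d → ℝ) (B : ℝ) : Prop :=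
  ∀ x, ‖fderiv ℝ f x‖ ≤ B ∧ ‖fderiv ℝ (fderiv ℝ f) x‖ ≤ B

theorem _root_.NoisyObs.IsCb2.exists_derivBound {f : E d → ℝ} (hf : IsCb2 f) :
    ∃ B, DerivBound f B := by
  obtain ⟨C, hC⟩ := hf.2
  exact ⟨C, fun x => (hC x).2⟩

theorem Regular.exists_pairing_bound (hM : M.Regular) : ∃ C : ℝ, 0 ≤ C ∧ ∀ α ∈ M.ctrl,
    ∀ (ν : P d) (f : E d → ℝ) (B : ℝ), DerivBound f B → |M.pairing α ν f| ≤ C * B := by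
  obtain ⟨C, hC, h⟩ := hM.exists_symbol_bound
  refine ⟨2 * C, by positivity, fun α hα ν f B hB => ?_⟩
  have h1 : ∀ x, ‖M.gen α f x‖ ≤ 2 * C * B := fun x => by
    refine (h α hα x _ _).trans ?_
    have := hB x
    nlinarith
  have := norm_integral_le_of_norm_le_const (μ := (ν : Measure (E d))) (.of_forall h1)
  simpa [pairing] using this

theorem Regular.continuous_pairing (hM : M.Regular) {α : E k₁} (hα : α ∈ M.ctrl) {f : E d → ℝ}
    (hf : IsCb2 f) : Continuous fun ν : P d => M.pairing α ν f := by
  obtain ⟨C, hC, h⟩ := hM.exists_symbol_bound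
  obtain ⟨B, hB⟩ := hf.exists_derivBound
  refine ProbabilityMeasure.continuous_integral_boundedContinuousFunction
    (BoundedContinuousFunction.ofNormedAddCommGroup (M.gen α f)
      (hM.continuous_symbol hα continuous_id hf.continuous_fderiv hf.continuous_fderiv_fderiv)
      (C * (B + B)) fun x => ?_)
  refine (h α hα x _ _).trans ?_
  have := hB x
  gcongr
  exacts [this.1, this.2]

/-- A weakly continuous solution of the Fokker--Planck equation on `[t₀, t₁]` driven by a
measurable control with values in `A`. -/
structure IsTrajectory (M : Model d k₁ k₂ Ω S O) (α : ℝ → E k₁) (m : ℝ → P d) (t₀ t₁ : ℝ) :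
    Prop where
  le : t₀ ≤ t₁
  solves : M.SolvesFP α m t₀ t₁
  measurable : Measurable fun r : Icc t₀ t₁ => α r
  mem : ∀ r ∈ Icc t₀ t₁, α r ∈ M.ctrl

namespace IsTrajectory

variable {α : ℝ → E k₁} {m : ℝ → P d} {t₀ t₁ : ℝ}

theorem measurable_state (h : M.IsTrajectory α m t₀ t₁) : Measurable fun r : Icc t₀ t₁ => m r :=
  (continuousOn_iff_continuous_domRestrict.1 h.solves.1).measurable

theorem integrableOn_pairing (h : M.IsTrajectory α m t₀ t₁) (hM : M.Regular) {F : ℝ → E d → ℝ}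
    {B : ℝ} (hF₁ : Measurable fun z : Icc t₀ t₁ × E d => fderiv ℝ (F z.1) z.2)
    (hF₂ : Measurable fun z : Icc t₀ t₁ × E d => fderiv ℝ (fderiv ℝ (F z.1)) z.2)
    (hB : ∀ r ∈ Icc t₀ t₁, DerivBound (F r) B) :
    IntegrableOn (fun r => M.pairing (α r) (m r) (F r)) (Icc t₀ t₁) := by
  obtain ⟨C, hC, hb⟩ := hM.exists_pairing_bound
  have hmeas : Measurable fun r : Icc t₀ t₁ => M.pairing (α r) (m r) (F r) := by
    refine measurable_integral_joint (H := fun (r : Icc t₀ t₁) x => M.gen (α r) (F r) x) ?_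
      h.measurable_state
    exact hM.measurable_symbol (h.measurable.comp measurable_fst) measurable_snd hF₁ hF₂
  refine IntegrableOn.of_bound (C := C * B) (by simp)
    (aemeasurable_restrict_of_measurable_subtype measurableSet_Icc hmeas).aestronglyMeasurable ?_
  exact (ae_restrict_iff' measurableSet_Icc).2
    (.of_forall fun r hr => hb _ (h.mem r hr) _ _ _ (hB r hr))

theorem intervalIntegrable_pairing_const (h : M.IsTrajectory α m t₀ t₁) (hM : M.Regular)
    {f : E d → ℝ} (hf : IsCb2 f) {s t : ℝ} (hs : s ∈ Icc t₀ t₁) (ht : t ∈ Icc t₀ t₁) :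
    IntervalIntegrable (fun r => M.pairing (α r) (m r) f) volume s t := by
  obtain ⟨B, hB⟩ := hf.exists_derivBound
  have := h.integrableOn_pairing hM (F := fun _ => f)
    (hf.continuous_fderiv.measurable.comp measurable_snd)
    (hf.continuous_fderiv_fderiv.measurable.comp measurable_snd) (fun _ _ => hB)
  exact (this.mono_set (uIcc_subset_Icc hs ht)).intervalIntegrable

theorem integral_sub (h : M.IsTrajectory α m t₀ t₁) (hM : M.Regular) {f : E d → ℝ} (hf : IsCb2 f)
    {s t : ℝ} (hs : s ∈ Icc t₀ t₁) (ht : t ∈ Icc t₀ t₁) :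
    ∫ x, f x ∂(m t : Measure (E d)) - ∫ x, f x ∂(m s : Measure (E d)) =
      ∫ r in s..t, M.pairing (α r) (m r) f := by
  have h0 := left_mem_Icc.2 h.le
  rw [h.solves.2 f hf t ht, h.solves.2 f hf s hs,
    ← intervalIntegral.integral_interval_sub_left (h.intervalIntegrable_pairing_const hM hf h0 ht)
      (h.intervalIntegrable_pairing_const hM hf h0 hs)]
  ring

theorem mono (h : M.IsTrajectory α m t₀ t₁) (hM : M.Regular) {s t : ℝ} (hs : t₀ ≤ s) (hst : s ≤ t)
    (ht : t ≤ t₁) : M.IsTrajectory α m s t := by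
  have hsub : Icc s t ⊆ Icc t₀ t₁ := Icc_subset_Icc hs ht
  refine ⟨hst, ⟨h.solves.1.mono hsub, fun f hf r hr => ?_⟩,
    h.measurable.comp (measurable_inclusion hsub), fun r hr => h.mem r (hsub hr)⟩
  rw [← h.integral_sub hM hf (hsub (left_mem_Icc.2 hst)) (hsub hr)]
  ring

end IsTrajectory

/-- A constant `C` with `|∫ f dm_t - ∫ f dm_s| ≤ C B |t - s|` along all trajectories. -/
theorem Regular.exists_lipschitz (hM : M.Regular) : ∃ C : ℝ, 0 ≤ C ∧
    ∀ (α : ℝ → E k₁) (m : ℝ → P d) (t₀ t₁ : ℝ), M.IsTrajectory α m t₀ t₁ →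
      ∀ (f : E d → ℝ) (B : ℝ), IsCb2 f → DerivBound f B → ∀ s ∈ Icc t₀ t₁, ∀ t ∈ Icc t₀ t₁,
        |∫ x, f x ∂(m t : Measure (E d)) - ∫ x, f x ∂(m s : Measure (E d))| ≤ C * B * |t - s| := by
  obtain ⟨C, hC, hb⟩ := hM.exists_pairing_bound
  refine ⟨C, hC, fun α m t₀ t₁ h f B hf hB s hs t ht => ?_⟩
  rw [h.integral_sub hM hf hs ht]
  rw [← Real.norm_eq_abs]
  refine intervalIntegral.norm_integral_le_of_norm_le_const fun r hr => ?_
  exact hb _ (h.mem r (uIcc_subset_Icc hs ht (uIoc_subset_uIcc hr))) _ _ _ hB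

/-- Trajectories that start in a compact set stay in a compact set, uniformly in the control. -/
theorem Regular.exists_isCompact_reachable (hM : M.Regular) {K : Set (P d)} (hK : IsCompact K)
    (len : ℝ) : ∃ K' : Set (P d), IsCompact K' ∧ ∀ (α : ℝ → E k₁) (m : ℝ → P d) (t₀ t₁ : ℝ),
      M.IsTrajectory α m t₀ t₁ → t₁ - t₀ ≤ len → m t₀ ∈ K → ∀ t ∈ Icc t₀ t₁, m t ∈ K' := by
  obtain ⟨C, hC, hb⟩ := hM.exists_lipschitz
  let R : Set (P d) := {ν | ∃ (α : ℝ → E k₁) (m : ℝ → P d) (t₀ t₁ t : ℝ),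
    M.IsTrajectory α m t₀ t₁ ∧ t₁ - t₀ ≤ len ∧ m t₀ ∈ K ∧ t ∈ Icc t₀ t₁ ∧ m t = ν}
  have hR : IsTightMeasureSet {((μ : P d) : Measure (E d)) | μ ∈ R} := by
    refine isTight_of_close (S := K) (C := C * len)
      (isTightMeasureSet_of_isCompact_closure (by rwa [hK.isClosed.closure_eq])) ?_
    rintro _ ⟨α, m, t₀, t₁, t, h, hl, h0, ht, rfl⟩
    refine ⟨m t₀, h0, fun f B hf hB => ?_⟩
    have h1 := (abs_le.1 (hb α m t₀ t₁ h f B hf hB t₀ (left_mem_Icc.2 h.le) t ht)).2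
    have h2 : |t - t₀| ≤ len := by
      rw [abs_of_nonneg (by linarith [ht.1])]
      linarith [ht.2]
    have h3 : C * B * |t - t₀| ≤ C * B * len := by
      have : 0 ≤ B := (norm_nonneg _).trans (hB 0).1
      gcongr
    nlinarith
  exact ⟨closure R, isCompact_closure_of_isTightMeasureSet hR,
    fun α m t₀ t₁ h hl h0 t ht => subset_closure ⟨α, m, t₀, t₁, t, h, hl, h0, ht, rfl⟩⟩

theorem SolvesFP.congr {α α' : ℝ → E k₁} {m m' : ℝ → P d} {t₀ t₁ : ℝ} (h : M.SolvesFP α m t₀ t₁)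
    (hα : ∀ r ∈ Ioo t₀ t₁, α' r = α r) (hm : EqOn m' m (Icc t₀ t₁)) : M.SolvesFP α' m' t₀ t₁ := by
  refine ⟨h.1.congr hm, fun f hf t ht => ?_⟩
  have h0 : t₀ ∈ Icc t₀ t₁ := ⟨le_rfl, ht.1.trans ht.2⟩
  rw [hm ht, hm h0, h.2 f hf t ht]
  congr 1
  rw [intervalIntegral.integral_of_le ht.1, intervalIntegral.integral_of_le ht.1,
    integral_Ioc_eq_integral_Ioo, integral_Ioc_eq_integral_Ioo]
  refine setIntegral_congr_fun measurableSet_Ioo fun r hr => ?_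
  have hr' : r ∈ Ioo t₀ t₁ := ⟨hr.1, hr.2.trans_le ht.2⟩
  simp only [hα r hr', hm (Ioo_subset_Icc_self hr')]

theorem SolvesFP.concat (hM : M.Regular) {α : ℝ → E k₁} {m : ℝ → P d} {t₀ t₁ t₂ : ℝ}
    (h₀₁ : t₀ ≤ t₁) (h₁₂ : t₁ ≤ t₂) (h : M.SolvesFP α m t₀ t₁) (h' : M.SolvesFP α m t₁ t₂)
    (hα : Measurable α) (hmem : ∀ r, α r ∈ M.ctrl) : M.SolvesFP α m t₀ t₂ := by
  have T₁ : M.IsTrajectory α m t₀ t₁ := ⟨h₀₁, h, hα.comp measurable_subtype_coe, fun r _ => hmem r⟩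
  have T₂ : M.IsTrajectory α m t₁ t₂ := ⟨h₁₂, h', hα.comp measurable_subtype_coe, fun r _ => hmem r⟩
  refine ⟨?_, fun f hf t ht => ?_⟩
  · rw [← Icc_union_Icc_eq_Icc h₀₁ h₁₂]
    exact h.1.union_of_isClosed h'.1 isClosed_Icc isClosed_Icc
  · rcases le_total t t₁ with htt | htt
    · exact h.2 f hf t ⟨ht.1, htt⟩
    · have h1 : t₁ ∈ Icc t₀ t₁ := right_mem_Icc.2 h₀₁
      have h2 : t ∈ Icc t₁ t₂ := ⟨htt, ht.2⟩
      rw [h'.2 f hf t h2, h.2 f hf t₁ h1, add_assoc,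
        intervalIntegral.integral_add_adjacent_intervals
        (T₁.intervalIntegrable_pairing_const hM hf (left_mem_Icc.2 h₀₁) h1)
        (T₂.intervalIntegrable_pairing_const hM hf (left_mem_Icc.2 h₁₂) h2)]

/-- For constant controls the Fokker--Planck equation is invariant under time shifts. -/
theorem SolvesFP.shift {α : E k₁} {m : ℝ → P d} {L t₀ t₁ : ℝ}
    (h : M.SolvesFP (fun _ => α) m 0 L) (hL : t₁ - t₀ ≤ L) :
    M.SolvesFP (fun _ => α) (fun t => m (t - t₀)) t₀ t₁ := by
  have hmaps : ∀ t ∈ Icc t₀ t₁, t - t₀ ∈ Icc 0 L := fun t ht =>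
    ⟨by linarith [ht.1], by linarith [ht.2]⟩
  refine ⟨h.1.comp (by fun_prop) hmaps, fun f hf t ht => ?_⟩
  beta_reduce
  rw [h.2 f hf _ (hmaps t ht), sub_self,
    intervalIntegral.integral_comp_sub_right (fun r => M.pairing α (m r) f), sub_self]

end Model
end NoisyObs

/-! ### The flow of a constant control -/

namespace NoisyObs
namespace Model

variable {d k₁ k₂ : ℕ} {Ω S O : Type*} [MeasurableSpace Ω] [MeasurableSpace S] [MeasurableSpace O]
variable {M : Model d k₁ k₂ Ω S O}

theorem Regular.τ_mono (hM : M.Regular) {i j : ℕ} (hij : i ≤ j) (hj : j ≤ M.n + 1) :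
    M.τ i ≤ M.τ j := by
  induction j, hij using Nat.le_induction with
  | base => exact le_rfl
  | succ k _ ih => exact (ih (by omega)).trans (hM.τ_lt k (by omega)).le

theorem Regular.τ_nonneg (hM : M.Regular) {i : ℕ} (hi : i ≤ M.n + 1) : 0 ≤ M.τ i :=
  hM.τ_zero ▸ hM.τ_mono (Nat.zero_le i) hi

theorem Regular.τ_le_T (hM : M.Regular) {i : ℕ} (hi : i ≤ M.n + 1) : M.τ i ≤ M.T :=
  hM.τ_mono hi le_rfl

theorem Regular.T_nonneg (hM : M.Regular) : 0 ≤ M.T := hM.τ_nonneg le_rfl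

theorem isTrajectory_const {α : E k₁} (hα : α ∈ M.ctrl) {m : ℝ → P d} {t₀ t₁ : ℝ} (h : t₀ ≤ t₁)
    (hm : M.SolvesFP (fun _ => α) m t₀ t₁) : M.IsTrajectory (fun _ => α) m t₀ t₁ :=
  ⟨h, hm, measurable_const, fun _ _ => hα⟩

/-- Functions on `[0, T]` with a common Lipschitz constant that form a Cauchy sequence at rational
times form one at all times. -/
theorem cauchySeq_of_rat {a : ℕ → ℝ → ℝ} {T L : ℝ} (hT : 0 ≤ T) (hL : 0 ≤ L)
    (ha : ∀ n, ∀ s ∈ Icc 0 T, ∀ t ∈ Icc 0 T, |a n t - a n s| ≤ L * |t - s|)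
    (hq : ∀ q : ℚ, CauchySeq fun n => a n (projIcc 0 T hT q)) {t : ℝ} (ht : t ∈ Icc 0 T) :
    CauchySeq fun n => a n t := by
  rw [Metric.cauchySeq_iff]
  intro ε hε
  obtain ⟨q, hq1, hq2⟩ := exists_rat_btwn (show t < t + ε / (3 * (L + 1)) by
    have : 0 < ε / (3 * (L + 1)) := by positivity
    linarith)
  have hclose : ∀ n, |a n t - a n (projIcc 0 T hT q)| < ε / 3 := by
    intro n
    have h1 : |t - (projIcc 0 T hT q : ℝ)| ≤ |t - q| := by
      have := abs_projIcc_sub_projIcc (c := t) (d := (q : ℝ)) hT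
      rwa [projIcc_of_mem hT ht] at this
    have h2 : |t - q| ≤ ε / (3 * (L + 1)) := by
      rw [abs_sub_comm, abs_of_pos (by linarith)]
      linarith
    calc |a n t - a n (projIcc 0 T hT q)| ≤ L * |t - (projIcc 0 T hT q : ℝ)| :=
          ha n _ (projIcc 0 T hT q).2 _ ht
      _ ≤ L * (ε / (3 * (L + 1))) := by gcongr; exact h1.trans h2
      _ < (L + 1) * (ε / (3 * (L + 1))) := by
          have : 0 < ε / (3 * (L + 1)) := by positivity
          nlinarith
      _ = ε / 3 := by field_simp
  obtain ⟨N, hN⟩ := Metric.cauchySeq_iff.1 (hq q) (ε / 3) (by positivity)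
  refine ⟨N, fun m hm n hn => ?_⟩
  have h1 := hN m hm n hn
  have h2 := hclose m
  have h3 := hclose n
  rw [Real.dist_eq] at h1 ⊢
  rw [abs_lt] at h1 h2 h3 ⊢
  constructor <;> linarith

/-- Compactness of the solutions of the Fokker--Planck equation for a constant control: tightness
gives a limit at rational times, equicontinuity extends it to all times. -/
theorem Regular.exists_subseq_solution (hM : M.Regular) {α : E k₁} (hα : α ∈ M.ctrl)
    {m : ℕ → ℝ → P d} (hm : ∀ n, M.SolvesFP (fun _ => α) (m n) 0 M.T) {ν : P d}
    (hν : Tendsto (fun n => m n 0) atTop (𝓝 ν)) :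
    ∃ (φ : ℕ → ℕ) (m' : ℝ → P d), StrictMono φ ∧ m' 0 = ν ∧ M.SolvesFP (fun _ => α) m' 0 M.T ∧
      ∀ t ∈ Icc 0 M.T, Tendsto (fun n => m (φ n) t) atTop (𝓝 (m' t)) := by
  have hT := hM.T_nonneg
  have hT0 : (0 : ℝ) ∈ Icc 0 M.T := left_mem_Icc.2 hT
  obtain ⟨C, hC, hlip⟩ := hM.exists_lipschitz
  obtain ⟨K, hK, hKm⟩ := hM.exists_isCompact_reachable hν.isCompact_insert_range M.T
  have htraj : ∀ n, M.IsTrajectory (fun _ => α) (m n) 0 M.T := fun n =>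
    isTrajectory_const hα hT (hm n)
  have hmem : ∀ n, ∀ t ∈ Icc 0 M.T, m n t ∈ K := fun n t ht =>
    hKm _ _ _ _ (htraj n) (by simp) (mem_insert_of_mem _ ⟨n, rfl⟩) t ht
  obtain ⟨z, -, φ, hφ, hz⟩ := (isCompact_univ_pi fun _ : ℚ => hK).isSeqCompact
    (x := fun n q => m n (projIcc 0 M.T hT q))
    (fun n => fun q _ => hmem n _ (projIcc 0 M.T hT (q : ℝ)).2)
  have hz' : ∀ q : ℚ, Tendsto (fun n => m (φ n) (projIcc 0 M.T hT q)) atTop (𝓝 (z q)) :=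
    tendsto_pi_nhds.1 hz
  have hlim : ∀ t ∈ Icc 0 M.T, ∃ y, Tendsto (fun n => m (φ n) t) atTop (𝓝 y) := by
    intro t ht
    obtain ⟨y, -, ψ, hψ, hy⟩ := hK.isSeqCompact (x := fun n => m (φ n) t) (fun n => hmem _ t ht)
    refine ⟨y, tendsto_of_isCb2 fun f hf => ?_⟩
    obtain ⟨B, hB⟩ := hf.exists_derivBound
    have hB0 : 0 ≤ B := (norm_nonneg _).trans (hB 0).1
    have hcf := continuous_integral_of_isCb2 hf
    refine tendsto_nhds_of_cauchySeq_of_subseq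
      (cauchySeq_of_rat (a := fun n t => ∫ x, f x ∂(m (φ n) t : Measure (E d))) hT
        (mul_nonneg hC hB0)
        (fun n s hs t ht => hlip _ _ _ _ (htraj (φ n)) f B hf hB s hs t ht)
        (fun q => ((hcf.tendsto _).comp (hz' q)).cauchySeq) ht) hψ.tendsto_atTop
      ((hcf.tendsto _).comp hy)
  choose! m' hm' using hlim
  have hm'int : ∀ f : E d → ℝ, IsCb2 f → ∀ t ∈ Icc 0 M.T,
      Tendsto (fun n => ∫ x, f x ∂(m (φ n) t : Measure (E d))) atTop
        (𝓝 (∫ x, f x ∂(m' t : Measure (E d)))) := fun f hf t ht =>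
    ((continuous_integral_of_isCb2 hf).tendsto _).comp (hm' t ht)
  have h0 : m' 0 = ν := tendsto_nhds_unique (hm' 0 hT0) (hν.comp hφ.tendsto_atTop)
  refine ⟨φ, m', hφ, h0, ⟨?_, fun f hf t ht => ?_⟩, hm'⟩
  · rw [continuousOn_iff_continuous_domRestrict]
    apply SeqContinuous.continuous
    intro x x₀ hx
    refine tendsto_of_isCb2 fun f hf => ?_
    obtain ⟨B, hB⟩ := hf.exists_derivBound
    have hle : ∀ n, |∫ y, f y ∂(m' (x n) : Measure (E d)) - ∫ y, f y ∂(m' x₀ : Measure (E d))| ≤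
        C * B * |(x n : ℝ) - x₀| := fun n =>
      le_of_tendsto' (((hm'int f hf _ (x n).2).sub (hm'int f hf _ x₀.2)).abs) fun k =>
        hlip _ _ _ _ (htraj (φ k)) f B hf hB _ x₀.2 _ (x n).2
    have hx' : Tendsto (fun n => C * B * |(x n : ℝ) - x₀|) atTop (𝓝 0) := by
      have h1 : Tendsto (fun n => (x n : ℝ)) atTop (𝓝 (x₀ : ℝ)) :=
        (continuous_subtype_val.tendsto _).comp hx
      have h2 := ((h1.sub_const (x₀ : ℝ)).abs).const_mul (C * B)
      simpa using h2
    rw [tendsto_iff_dist_tendsto_zero]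
    exact squeeze_zero (fun _ => dist_nonneg) (fun n => by rw [Real.dist_eq]; exact hle n) hx'
  · obtain ⟨B, hB⟩ := hf.exists_derivBound
    obtain ⟨C', hC', hp⟩ := hM.exists_pairing_bound
    refine tendsto_nhds_unique (hm'int f hf t ht) ?_
    have h1 : ∀ n, ∫ x, f x ∂(m (φ n) t : Measure (E d)) = ∫ x, f x ∂(m (φ n) 0 : Measure (E d)) +
        ∫ r in (0 : ℝ)..t, M.pairing α (m (φ n) r) f := fun n => (hm (φ n)).2 f hf t ht
    simp only [h1]
    refine (hm'int f hf 0 hT0).add ?_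
    refine intervalIntegral.tendsto_integral_filter_of_dominated_convergence (fun _ => C' * B)
      (.of_forall fun n => ?_) (.of_forall fun n => .of_forall fun r _ => hp α hα _ f B hB)
      intervalIntegrable_const (.of_forall fun r hr => ?_)
    · exact ((htraj (φ n)).intervalIntegrable_pairing_const hM hf hT0 ht).def'.aestronglyMeasurable
    · rw [uIoc_of_le ht.1] at hr
      exact ((hM.continuous_pairing hα hf).tendsto _).comp (hm' r ⟨hr.1.le, hr.2.trans ht.2⟩)

/-- For a constant control the Fokker--Planck equation generates a jointly continuous flow. -/
theorem Regular.exists_flow (hM : M.Regular) {α : E k₁} (hα : α ∈ M.ctrl) :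
    ∃ F : ℝ → P d → P d, (∀ ν, F 0 ν = ν) ∧
      (∀ ν, M.SolvesFP (fun _ => α) (fun t => F t ν) 0 M.T) ∧
      Continuous fun z : ℝ × P d => F z.1 z.2 := by
  have hα' := hα
  obtain ⟨u, hu, rfl⟩ := hα'
  have hT := hM.T_nonneg
  choose m hm huniq using hM.wellPosed u hu
  -- the solution is extended to all times as a constant outside of `[0, T]`
  refine ⟨fun t ν => m ν (projIcc 0 M.T hT t), fun ν => ?_, fun ν => ?_, ?_⟩
  · beta_reduce
    rw [projIcc_left]
    exact (hm ν).1
  · exact (hm ν).2.congr (fun _ _ => rfl) fun t ht => by simp only [projIcc_of_mem hT ht]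
  apply SeqContinuous.continuous
  intro z z₀ hz
  have hνt : Tendsto (fun n => (z n).2) atTop (𝓝 z₀.2) := (continuous_snd.tendsto _).comp hz
  have htt : Tendsto (fun n => (projIcc 0 M.T hT (z n).1 : ℝ)) atTop
      (𝓝 (projIcc 0 M.T hT z₀.1 : ℝ)) :=
    ((continuous_subtype_val.comp (continuous_projIcc.comp continuous_fst)).tendsto _).comp hz
  have ht : ∀ n, (projIcc 0 M.T hT (z n).1 : ℝ) ∈ Icc 0 M.T := fun n => (projIcc 0 M.T hT _).2
  have ht₀ : (projIcc 0 M.T hT z₀.1 : ℝ) ∈ Icc 0 M.T := (projIcc 0 M.T hT _).2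
  simp only [Function.comp_def]
  generalize (projIcc 0 M.T hT z₀.1 : ℝ) = t₀ at htt ht₀ ⊢
  generalize z₀.2 = ν₀ at hνt ⊢
  have hpt : Tendsto (fun n => m (z n).2 t₀) atTop (𝓝 (m ν₀ t₀)) := by
    refine tendsto_of_subseq_tendsto fun ns hns => ?_
    obtain ⟨φ, m', -, h0, hs, hl⟩ := hM.exists_subseq_solution hα (m := fun n => m (z (ns n)).2)
      (fun n => (hm _).2) (ν := ν₀) (by simpa only [(hm _).1, Function.comp_def] using hνt.comp hns)
    refine ⟨φ, ?_⟩
    rw [← huniq ν₀ m' h0 hs ht₀]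
    exact hl t₀ ht₀
  obtain ⟨C, hC, hlip⟩ := hM.exists_lipschitz
  refine tendsto_of_isCb2 fun f hf => ?_
  obtain ⟨B, hB⟩ := hf.exists_derivBound
  have h1 := ((continuous_integral_of_isCb2 hf).tendsto _).comp hpt
  have h2 : Tendsto (fun n => ∫ x, f x ∂(m (z n).2 (projIcc 0 M.T hT (z n).1) : Measure (E d)) -
      ∫ x, f x ∂(m (z n).2 t₀ : Measure (E d))) atTop (𝓝 0) := by
    have h3 : Tendsto (fun n => C * B * |(projIcc 0 M.T hT (z n).1 : ℝ) - t₀|) atTop (𝓝 0) := by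
      simpa using ((htt.sub_const t₀).abs).const_mul (C * B)
    exact squeeze_zero_norm (fun n => hlip _ _ _ _ (isTrajectory_const hα hT (hm (z n).2).2)
      f B hf hB _ ht₀ _ (ht n)) h3
  simpa using h2.add h1

end Model
end NoisyObs

/-! ### Regularity of classical solutions -/

namespace NoisyObs

section Regular

theorem continuous_norm_sub {X F : Type*} [TopologicalSpace X] [SeminormedAddCommGroup F]
    {f g : X → F} (hf : Continuous f) (hg : Continuous g) : Continuous fun x => ‖f x - g x‖ :=
  (hf.sub hg).norm

/-- The second derivative, as a named function with values in the space of bilinear forms. -/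
noncomputable def hess {d : ℕ} (f : E d → ℝ) (x : E d) : E d →L[ℝ] E d →L[ℝ] ℝ :=
  fderiv ℝ (fderiv ℝ f) x

theorem IsCb2.continuous_hess {d : ℕ} {f : E d → ℝ} (hf : IsCb2 f) : Continuous (hess f) :=
  hf.continuous_fderiv_fderiv

variable {d : ℕ} {I : Set ℝ} {W Wt : ℝ → P d → ℝ} {D : ℝ → P d → E d → ℝ}

theorem IsRegularOn.exists_bound (h : IsRegularOn I W Wt D) {K : Set (I × P d)} (hK : IsCompact K) :
    ∃ C : ℝ, 0 ≤ C ∧ ∀ q ∈ K, ∀ x, |D q.1 q.2 x| ≤ C ∧ ‖fderiv ℝ (D q.1 q.2) x‖ ≤ C ∧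
      ‖fderiv ℝ (fderiv ℝ (D q.1 q.2)) x‖ ≤ C := by
  let j : I × P d → ℝ × P d := fun q => (q.1, q.2)
  have hj : Continuous j := by fun_prop
  obtain ⟨C, hC⟩ := h.bounded (j '' K) (hK.image hj) (by
    rintro _ ⟨q, -, rfl⟩
    exact ⟨q.1.2, mem_univ _⟩)
  refine ⟨max C 0, le_max_right _ _, fun q hq x => ?_⟩
  have := hC (j q) ⟨q, hq, rfl⟩ x
  exact ⟨this.1.trans (le_max_left _ _), this.2.1.trans (le_max_left _ _),
    this.2.2.trans (le_max_left _ _)⟩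

theorem IsRegularOn.isCb2 (h : IsRegularOn I W Wt D) {t : ℝ} (ht : t ∈ I) (μ : P d) :
    IsCb2 (D t μ) := by
  obtain ⟨C, -, hC⟩ := h.exists_bound (isCompact_singleton (x := ((⟨t, ht⟩ : I), μ)))
  exact ⟨h.contDiff t ht μ, C, fun x => hC _ rfl x⟩

theorem IsRegularOn.continuous_D (h : IsRegularOn I W Wt D) :
    Continuous fun z : (I × P d) × E d => D z.1.1 z.1.2 z.2 :=
  h.continuous_zero.comp_continuous (f := fun z : (I × P d) × E d => (((z.1.1 : ℝ), z.1.2), z.2))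
    (by fun_prop) (fun z => ⟨⟨z.1.1.2, mem_univ _⟩, mem_univ _⟩)

theorem IsRegularOn.continuous_fderiv (h : IsRegularOn I W Wt D) :
    Continuous fun z : (I × P d) × E d => fderiv ℝ (D z.1.1 z.1.2) z.2 :=
  h.continuous_one.comp_continuous (f := fun z : (I × P d) × E d => (((z.1.1 : ℝ), z.1.2), z.2))
    (by fun_prop) (fun z => ⟨⟨z.1.1.2, mem_univ _⟩, mem_univ _⟩)

theorem IsRegularOn.continuous_fderiv_fderiv (h : IsRegularOn I W Wt D) :
    Continuous fun z : (I × P d) × E d => fderiv ℝ (fderiv ℝ (D z.1.1 z.1.2)) z.2 :=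
  h.continuous_two.comp_continuous (f := fun z : (I × P d) × E d => (((z.1.1 : ℝ), z.1.2), z.2))
    (by fun_prop) (fun z => ⟨⟨z.1.1.2, mem_univ _⟩, mem_univ _⟩)

theorem IsRegularOn.continuous_Wt (h : IsRegularOn I W Wt D) :
    Continuous fun z : I × P d => Wt z.1 z.2 :=
  h.continuous_deriv.comp_continuous (f := fun z : I × P d => ((z.1 : ℝ), z.2))
    (by fun_prop) (fun z => ⟨z.1.2, mem_univ _⟩)

theorem IsRegularOn.continuous_integral (h : IsRegularOn I W Wt D) :
    Continuous fun z : (I × P d) × P d => ∫ x, D z.1.1 z.1.2 x ∂(z.2 : Measure (E d)) := by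
  refine continuous_integral_joint (H := fun z : (I × P d) × E d => D z.1.1 z.1.2 z.2)
    h.continuous_D fun K hK => ?_
  obtain ⟨C, -, hC⟩ := h.exists_bound hK
  exact ⟨C, fun q hq x => (hC q hq x).1⟩

theorem IsRegularOn.continuous_flat_integrand (h : IsRegularOn I W Wt D) {t : ℝ} (ht : t ∈ I) :
    Continuous fun z : (P d × P d) × ℝ =>
      (∫ x, D t (mix z.2 z.1.1 z.1.2) x ∂(z.1.1 : Measure (E d))) -
        ∫ x, D t (mix z.2 z.1.1 z.1.2) x ∂(z.1.2 : Measure (E d)) := by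
  have hm : Continuous fun z : (P d × P d) × ℝ => ((⟨t, ht⟩ : I), mix z.2 z.1.1 z.1.2) :=
    continuous_const.prodMk (continuous_mix.comp
      (f := fun z : (P d × P d) × ℝ => (z.2, z.1.1, z.1.2))
      (by fun_prop))
  exact (h.continuous_integral.comp (hm.prodMk (continuous_fst.comp continuous_fst))).sub
    (h.continuous_integral.comp (hm.prodMk (continuous_snd.comp continuous_fst)))

/-- Continuity in the measure follows from the existence of a continuous flat derivative. -/
theorem IsRegularOn.continuous_space (h : IsRegularOn I W Wt D) {t : ℝ} (ht : t ∈ I) :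
    Continuous (W t) := by
  obtain ⟨ν₀⟩ : Nonempty (P d) := inferInstance
  have e : W t = fun μ : P d => W t ν₀ + ∫ r in (0 : ℝ)..1,
      ((∫ x, D t (mix r μ ν₀) x ∂(μ : Measure (E d))) -
        ∫ x, D t (mix r μ ν₀) x ∂(ν₀ : Measure (E d))) := by
    funext μ
    rw [← h.flat t ht μ ν₀]
    ring
  rw [e]
  refine continuous_const.add ?_
  exact intervalIntegral.continuous_parametric_intervalIntegral_of_continuous
    (f := fun (μ : P d) r => (∫ x, D t (mix r μ ν₀) x ∂(μ : Measure (E d))) -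
        ∫ x, D t (mix r μ ν₀) x ∂(ν₀ : Measure (E d)))
    ((h.continuous_flat_integrand ht).comp
      (f := fun z : P d × ℝ => ((z.1, ν₀), z.2)) (by fun_prop)) continuous_const

theorem IsRegularOn.continuous_hess (h : IsRegularOn I W Wt D) :
    Continuous fun z : (I × P d) × E d => hess (D z.1.1 z.1.2) z.2 :=
  h.continuous_fderiv_fderiv

/-- The distance between the first two derivatives in `x` of the flat derivative at `q` and at `q'`,
averaged with respect to a measure. -/
noncomputable def derivGap (D : ℝ → P d → E d → ℝ) (q q' : ℝ × P d) (ν : P d) : ℝ :=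
  ∫ x, (‖fderiv ℝ (D q.1 q.2) x - fderiv ℝ (D q'.1 q'.2) x‖ +
    ‖hess (D q.1 q.2) x - hess (D q'.1 q'.2) x‖) ∂(ν : Measure (E d))

theorem derivGap_self (D : ℝ → P d → E d → ℝ) (q : ℝ × P d) (ν : P d) : derivGap D q q ν = 0 := by
  have h : ∀ x, ‖hess (D q.1 q.2) x - hess (D q.1 q.2) x‖ = 0 := fun x => by
    rw [sub_self (hess (D q.1 q.2) x)]
    exact norm_zero (E := E d →L[ℝ] E d →L[ℝ] ℝ)
  simp [derivGap, h]

theorem IsRegularOn.continuous_derivGap (h : IsRegularOn I W Wt D) :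
    Continuous fun z : ((I × P d) × (I × P d)) × P d =>
      derivGap D (z.1.1.1, z.1.1.2) (z.1.2.1, z.1.2.2) z.2 := by
  refine continuous_integral_joint (Q := (I × P d) × (I × P d))
    (H := fun z => ‖fderiv ℝ (D z.1.1.1 z.1.1.2) z.2 - fderiv ℝ (D z.1.2.1 z.1.2.2) z.2‖ +
      ‖hess (D z.1.1.1 z.1.1.2) z.2 - hess (D z.1.2.1 z.1.2.2) z.2‖)
    ?_ fun K hK => ?_
  · have h1 : Continuous fun z : ((I × P d) × (I × P d)) × E d => (z.1.1, z.2) := by fun_prop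
    have h2 : Continuous fun z : ((I × P d) × (I × P d)) × E d => (z.1.2, z.2) := by fun_prop
    exact (continuous_norm_sub (h.continuous_fderiv.comp h1) (h.continuous_fderiv.comp h2)).add
      (continuous_norm_sub (F := E d →L[ℝ] E d →L[ℝ] ℝ) (h.continuous_hess.comp h1)
        (h.continuous_hess.comp h2))
  · obtain ⟨C, -, hC⟩ := h.exists_bound (hK.image continuous_fst)
    obtain ⟨C', -, hC'⟩ := h.exists_bound (hK.image continuous_snd)
    refine ⟨(C + C') + (C + C'), fun q hq x => ?_⟩
    have h1 := hC q.1 ⟨q, hq, rfl⟩ x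
    have h2 := hC' q.2 ⟨q, hq, rfl⟩ x
    rw [abs_of_nonneg (by positivity)]
    exact add_le_add ((norm_sub_le _ _).trans (add_le_add h1.2.1 h2.2.1))
      ((norm_sub_le (hess (D q.1.1 q.1.2) x) (hess (D q.2.1 q.2.2) x)).trans
        (add_le_add h1.2.2 h2.2.2))

end Regular

namespace Model

variable {d k₁ k₂ : ℕ} {Ω S O : Type*} [MeasurableSpace Ω] [MeasurableSpace S] [MeasurableSpace O]
variable {M : Model d k₁ k₂ Ω S O}

theorem Regular.exists_pairing_sub_bound (hM : M.Regular) : ∃ C : ℝ, 0 ≤ C ∧ ∀ α ∈ M.ctrl,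
    ∀ (ν : P d) (f g : E d → ℝ), IsCb2 f → IsCb2 g →
      |M.pairing α ν f - M.pairing α ν g| ≤ C * ∫ x, (‖fderiv ℝ f x - fderiv ℝ g x‖ +
        ‖hess f x - hess g x‖) ∂(ν : Measure (E d)) := by
  obtain ⟨C, hC, h⟩ := hM.exists_symbol_bound
  refine ⟨C, hC, fun α hα ν f g hf hg => ?_⟩
  have hint : ∀ f : E d → ℝ, IsCb2 f → Integrable (M.gen α f) (ν : Measure (E d)) := by
    intro f hf
    obtain ⟨B, hB⟩ := hf.exists_derivBound
    refine Integrable.of_bound (C := C * (B + B))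
      (hM.continuous_symbol hα continuous_id hf.continuous_fderiv
        hf.continuous_fderiv_fderiv).aestronglyMeasurable (.of_forall fun x => ?_)
    refine (h α hα x _ _).trans ?_
    have := hB x
    gcongr
    exacts [this.1, this.2]
  have hint2 : Integrable (fun x => ‖fderiv ℝ f x - fderiv ℝ g x‖ +
        ‖hess f x - hess g x‖) (ν : Measure (E d)) := by
    obtain ⟨B, hB⟩ := hf.exists_derivBound
    obtain ⟨B', hB'⟩ := hg.exists_derivBound
    refine Integrable.of_bound (C := (B + B') + (B + B'))
      ((continuous_norm_sub hf.continuous_fderiv hg.continuous_fderiv).add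
        (continuous_norm_sub (F := E d →L[ℝ] E d →L[ℝ] ℝ) hf.continuous_hess
          hg.continuous_hess)).aestronglyMeasurable (.of_forall fun x => ?_)
    rw [Real.norm_of_nonneg (by positivity)]
    exact add_le_add ((norm_sub_le _ _).trans (add_le_add (hB x).1 (hB' x).1))
      ((norm_sub_le (hess f x) (hess g x)).trans (add_le_add (hB x).2 (hB' x).2))
  rw [pairing, pairing, ← integral_sub (hint f hf) (hint g hg), ← integral_const_mul]
  rw [← Real.norm_eq_abs]
  refine norm_integral_le_of_norm_le (hint2.const_mul C) (.of_forall fun x => ?_)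
  rw [gen_eq_symbol, gen_eq_symbol, ← symbol_sub]
  exact h α hα x _ _

end Model
end NoisyObs

/-! ### The chain rule along trajectories -/

namespace NoisyObs
namespace Model

variable {d k₁ k₂ : ℕ} {Ω S O : Type*} [MeasurableSpace Ω] [MeasurableSpace S] [MeasurableSpace O]
variable {M : Model d k₁ k₂ Ω S O}

section ChainRule

variable {I : Set ℝ} {W Wt : ℝ → P d → ℝ} {D : ℝ → P d → E d → ℝ} {α : ℝ → E k₁} {m : ℝ → P d}
  {t₀ t₁ : ℝ}

theorem IsTrajectory.continuous_graph (h : M.IsTrajectory α m t₀ t₁) (hI : Icc t₀ t₁ ⊆ I) :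
    Continuous fun r : Icc t₀ t₁ => ((⟨r, hI r.2⟩ : I), m r) :=
  (continuous_subtype_val.subtype_mk _).prodMk
    (continuousOn_iff_continuous_domRestrict.1 h.solves.1)

theorem IsTrajectory.integrableOn_Wt (h : M.IsTrajectory α m t₀ t₁)
    (hW : IsRegularOn I W Wt D) (hI : Icc t₀ t₁ ⊆ I) :
    IntegrableOn (fun r => Wt r (m r)) (Icc t₀ t₁) := by
  refine ContinuousOn.integrableOn_Icc ?_
  rw [continuousOn_iff_continuous_domRestrict]
  exact hW.continuous_Wt.comp (h.continuous_graph hI)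

theorem IsTrajectory.integrableOn_pairing_D (h : M.IsTrajectory α m t₀ t₁) (hM : M.Regular)
    (hW : IsRegularOn I W Wt D) (hI : Icc t₀ t₁ ⊆ I) :
    IntegrableOn (fun r => M.pairing (α r) (m r) (D r (m r))) (Icc t₀ t₁) := by
  have hg := h.continuous_graph hI
  have hg' : Continuous fun z : Icc t₀ t₁ × E d => (((⟨z.1, hI z.1.2⟩ : I), m z.1), z.2) :=
    (hg.comp continuous_fst).prodMk continuous_snd
  obtain ⟨B, -, hB⟩ := hW.exists_bound (isCompact_range hg)
  refine h.integrableOn_pairing hM (B := B) (hW.continuous_fderiv.comp hg').measurable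
    (hW.continuous_fderiv_fderiv.comp hg').measurable fun r hr x => ?_
  exact (hB _ ⟨⟨r, hr⟩, rfl⟩ x).2

theorem IsTrajectory.continuous_derivGap_graph (h : M.IsTrajectory α m t₀ t₁)
    (hW : IsRegularOn I W Wt D) (hI : Icc t₀ t₁ ⊆ I) {t : ℝ} (ht : t ∈ Icc t₀ t₁) :
    Continuous fun z : (Icc t₀ t₁ × Icc t₀ t₁) × ℝ =>
      derivGap D (t, mix z.2 (m z.1.1) (m t)) (z.1.2, m z.1.2) (m z.1.2) := by
  have hmc : Continuous fun r : Icc t₀ t₁ => m r :=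
    continuousOn_iff_continuous_domRestrict.1 h.solves.1
  have hg := h.continuous_graph hI
  have hπ : Continuous fun z : (Icc t₀ t₁ × Icc t₀ t₁) × ℝ => z.1.2 := by fun_prop
  have hπ' : Continuous fun z : (Icc t₀ t₁ × Icc t₀ t₁) × ℝ => z.1.1 := by fun_prop
  have h1 : Continuous fun z : (Icc t₀ t₁ × Icc t₀ t₁) × ℝ => m z.1.2 := hmc.comp hπ
  have h1' : Continuous fun z : (Icc t₀ t₁ × Icc t₀ t₁) × ℝ => m z.1.1 := hmc.comp hπ'
  have h2 : Continuous fun z : (Icc t₀ t₁ × Icc t₀ t₁) × ℝ =>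
      ((⟨z.1.2, hI z.1.2.2⟩ : I), m z.1.2) := hg.comp hπ
  have h3 : Continuous fun z : (Icc t₀ t₁ × Icc t₀ t₁) × ℝ => mix z.2 (m z.1.1) (m t) :=
    continuous_snd.mix h1' continuous_const
  have h4 : Continuous fun z : (Icc t₀ t₁ × Icc t₀ t₁) × ℝ =>
      ((⟨t, hI ht⟩ : I), mix z.2 (m z.1.1) (m t)) := continuous_const.prodMk h3
  exact hW.continuous_derivGap.comp ((h4.prodMk h2).prodMk h1)

theorem IsTrajectory.continuous_Wt_graph (h : M.IsTrajectory α m t₀ t₁)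
    (hW : IsRegularOn I W Wt D) (hI : Icc t₀ t₁ ⊆ I) :
    Continuous fun z : Icc t₀ t₁ × Icc t₀ t₁ => Wt z.2 (m z.1) := by
  have hmc : Continuous fun r : Icc t₀ t₁ => m r :=
    continuousOn_iff_continuous_domRestrict.1 h.solves.1
  have hg := h.continuous_graph hI
  exact hW.continuous_Wt.comp (((continuous_fst.comp hg).comp continuous_snd).prodMk
      (hmc.comp continuous_fst))

/-- Continuity of the coefficients along a trajectory, in the form used by the chain rule. -/
theorem IsTrajectory.exists_modulus (h : M.IsTrajectory α m t₀ t₁)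
    (hW : IsRegularOn I W Wt D) (hI : Icc t₀ t₁ ⊆ I) {t : ℝ} (ht : t ∈ Icc t₀ t₁) {ε : ℝ}
    (hε : 0 < ε) : ∃ δ > 0, ∀ t' ∈ Icc t₀ t₁, ∀ r ∈ Icc t₀ t₁, |t' - t| < δ → |r - t| < δ →
      |Wt r (m t') - Wt t (m t)| ≤ ε ∧
        ∀ l ∈ Icc (0 : ℝ) 1, derivGap D (t, mix l (m t') (m t)) (r, m r) (m r) ≤ ε := by
  have hc1 := h.continuous_Wt_graph hW hI
  have hc2 := h.continuous_derivGap_graph hW hI ht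
  have h1 : ∀ᶠ z : Icc t₀ t₁ × Icc t₀ t₁ in 𝓝 (⟨t, ht⟩, ⟨t, ht⟩),
      |Wt z.2 (m z.1) - Wt t (m t)| < ε := by
    refine (hc1.sub continuous_const).abs.continuousAt.eventually_lt continuousAt_const ?_
    simp only [Pi.sub_apply, sub_self, abs_zero]
    exact hε
  have h2 : ∀ᶠ z : Icc t₀ t₁ × Icc t₀ t₁ in 𝓝 (⟨t, ht⟩, ⟨t, ht⟩), ∀ l ∈ Icc (0 : ℝ) 1,
      derivGap D (t, mix l (m z.1) (m t)) (z.2, m z.2) (m z.2) < ε := by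
    refine isCompact_Icc.eventually_forall_of_forall_eventually fun l _ => ?_
    refine hc2.continuousAt.eventually_lt continuousAt_const ?_
    simp only [mix_self, derivGap_self]
    exact hε
  obtain ⟨δ, hδ, hball⟩ := Metric.eventually_nhds_iff.1 (h1.and h2)
  refine ⟨δ, hδ, fun t' ht' r hr h1 h2 => ?_⟩
  have hd : dist ((⟨t', ht'⟩, ⟨r, hr⟩) : Icc t₀ t₁ × Icc t₀ t₁) (⟨t, ht⟩, ⟨t, ht⟩) < δ := by
    rw [Prod.dist_eq]
    exact max_lt h1 h2
  have := hball hd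
  exact ⟨this.1.le, fun l hl => (this.2 l hl).le⟩

/-- The increments of `W` along a trajectory, to first order. The increment is split into one in
time, at the final state, and one in the measure, at the initial time. The latter is given by the
flat derivative, and the Fokker--Planck equation with the flat derivative as a test function turns
it into an integral over `[t, t']`. -/
theorem IsTrajectory.exists_increment_bound (hM : M.Regular) : ∃ C : ℝ, 0 ≤ C ∧
    ∀ {I : Set ℝ} {W Wt : ℝ → P d → ℝ} {D : ℝ → P d → E d → ℝ} {α : ℝ → E k₁} {m : ℝ → P d}
      {t₀ t₁ : ℝ} (_ : M.IsTrajectory α m t₀ t₁) (_ : IsRegularOn I W Wt D) (_ : Icc t₀ t₁ ⊆ I)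
      {t t' ε : ℝ} (_ : t ∈ Icc t₀ t₁) (_ : t' ∈ Icc t₀ t₁) (_ : 0 ≤ ε)
      (_ : ∀ r ∈ uIcc t t', |Wt r (m t') - Wt t (m t)| ≤ ε ∧ |Wt r (m r) - Wt t (m t)| ≤ ε ∧
        ∀ l ∈ Icc (0 : ℝ) 1, derivGap D (t, mix l (m t') (m t)) (r, m r) (m r) ≤ ε),
      |W t' (m t') - W t (m t) -
        ∫ r in t..t', (Wt r (m r) + M.pairing (α r) (m r) (D r (m r)))| ≤ C * ε * |t' - t| := by
  obtain ⟨C, hC, hpair⟩ := hM.exists_pairing_sub_bound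
  refine ⟨2 + C, by positivity, ?_⟩
  intro I W Wt D α m t₀ t₁ h hW hI t t' ε ht ht' hε hmod
  have hsub : uIcc t t' ⊆ Icc t₀ t₁ := uIcc_subset_Icc ht ht'
  have hiW : IntervalIntegrable (fun r => Wt r (m r)) volume t t' :=
    ((h.integrableOn_Wt hW hI).mono_set hsub).intervalIntegrable
  have hiP : IntervalIntegrable (fun r => M.pairing (α r) (m r) (D r (m r))) volume t t' :=
    ((h.integrableOn_pairing_D hM hW hI).mono_set hsub).intervalIntegrable
  -- the increment in time
  have e1 : |W t' (m t') - W t (m t') - (t' - t) * Wt t (m t)| ≤ ε * |t' - t| := by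
    have hd : ∀ r ∈ uIcc t t', HasDerivWithinAt (fun r => W r (m t') - r * Wt t (m t))
        (Wt r (m t') - Wt t (m t)) (uIcc t t') r := fun r hr => by
      have h1 := (hW.hasDeriv r (hI (hsub hr)) (m t')).mono (hsub.trans hI)
      have h2 := (hasDerivWithinAt_id r (uIcc t t')).mul_const (Wt t (m t))
      rw [one_mul] at h2
      exact h1.fun_sub h2
    have := (convex_uIcc t t').norm_image_sub_le_of_norm_hasDerivWithin_le hd
      (fun r hr => (hmod r hr).1) left_mem_uIcc right_mem_uIcc
    simp only [Real.norm_eq_abs] at this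
    convert this using 2
    ring
  have e2 : |(∫ r in t..t', Wt r (m r)) - (t' - t) * Wt t (m t)| ≤ ε * |t' - t| := by
    have h1 : (∫ r in t..t', Wt r (m r)) - (t' - t) * Wt t (m t) =
        ∫ r in t..t', (Wt r (m r) - Wt t (m t)) := by
      rw [intervalIntegral.integral_sub hiW intervalIntegrable_const,
        intervalIntegral.integral_const, smul_eq_mul]
    rw [h1]
    rw [← Real.norm_eq_abs]
    exact intervalIntegral.norm_integral_le_of_norm_le_const fun r hr =>
      (hmod r (uIoc_subset_uIcc hr)).2.1
  -- the increment in the measure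
  have e3 : |W t (m t') - W t (m t) - ∫ r in t..t', M.pairing (α r) (m r) (D r (m r))| ≤
      C * ε * |t' - t| := by
    have hkc : Continuous fun l : ℝ =>
        (∫ x, D t (mix l (m t') (m t)) x ∂(m t' : Measure (E d))) -
          ∫ x, D t (mix l (m t') (m t)) x ∂(m t : Measure (E d)) :=
      (hW.continuous_flat_integrand (hI ht)).comp (f := fun l : ℝ => ((m t', m t), l)) (by fun_prop)
    have hk : ∀ l ∈ Icc (0 : ℝ) 1, |((∫ x, D t (mix l (m t') (m t)) x ∂(m t' : Measure (E d))) -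
          ∫ x, D t (mix l (m t') (m t)) x ∂(m t : Measure (E d))) -
          ∫ r in t..t', M.pairing (α r) (m r) (D r (m r))| ≤ C * ε * |t' - t| := by
      intro l hl
      have hcb := hW.isCb2 (hI ht) (mix l (m t') (m t))
      rw [h.integral_sub hM hcb ht ht', ← intervalIntegral.integral_sub
        (h.intervalIntegrable_pairing_const hM hcb ht ht') hiP]
      rw [← Real.norm_eq_abs]
      refine intervalIntegral.norm_integral_le_of_norm_le_const fun r hr => ?_
      have hr' := uIoc_subset_uIcc hr
      refine (hpair _ (h.mem r (hsub hr')) _ _ _ hcb (hW.isCb2 (hI (hsub hr')) (m r))).trans ?_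
      exact mul_le_mul_of_nonneg_left ((hmod r hr').2.2 l hl) hC
    rw [hW.flat t (hI ht)]
    have h1 := intervalIntegral.norm_integral_le_of_norm_le_const (a := (0 : ℝ)) (b := 1)
      (C := C * ε * |t' - t|) (f := fun l =>
        ((∫ x, D t (mix l (m t') (m t)) x ∂(m t' : Measure (E d))) -
          ∫ x, D t (mix l (m t') (m t)) x ∂(m t : Measure (E d))) -
          ∫ r in t..t', M.pairing (α r) (m r) (D r (m r))) (fun l hl => by
        rw [uIoc_of_le zero_le_one] at hl
        exact hk l ⟨hl.1.le, hl.2⟩)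
    rw [intervalIntegral.integral_sub (hkc.intervalIntegrable _ _) intervalIntegrable_const,
      intervalIntegral.integral_const] at h1
    simpa using h1
  rw [intervalIntegral.integral_add hiW hiP]
  rw [abs_le] at e1 e2 e3 ⊢
  constructor <;> nlinarith [abs_nonneg (t' - t)]

/-- The chain rule: along a trajectory, `W` is absolutely continuous in time, and its derivative is
`∂ₜW + ⟨𝒢*(α) m, D⟩`. The control is only measurable, so that the fundamental theorem of calculus is
not available: instead, the difference of the two sides has derivative zero everywhere. -/
theorem IsTrajectory.chain_rule (h : M.IsTrajectory α m t₀ t₁) (hM : M.Regular)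
    (hW : IsRegularOn I W Wt D) (hI : Icc t₀ t₁ ⊆ I) :
    W t₁ (m t₁) - W t₀ (m t₀) =
      ∫ r in t₀..t₁, (Wt r (m r) + M.pairing (α r) (m r) (D r (m r))) := by
  rcases h.le.eq_or_lt with rfl | hlt
  · simp
  obtain ⟨C, hC, hinc⟩ := IsTrajectory.exists_increment_bound hM
  set G : ℝ → ℝ := fun r => Wt r (m r) + M.pairing (α r) (m r) (D r (m r)) with hG
  have hint : IntegrableOn G (Icc t₀ t₁) :=
    (h.integrableOn_Wt hW hI).add (h.integrableOn_pairing_D hM hW hI)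
  have hii : ∀ s ∈ Icc t₀ t₁, ∀ t ∈ Icc t₀ t₁, IntervalIntegrable G volume s t := fun s hs t ht =>
    (hint.mono_set (uIcc_subset_Icc hs ht)).intervalIntegrable
  have hl := left_mem_Icc.2 h.le
  set F : ℝ → ℝ := fun t => W t (m t) - ∫ r in t₀..t, G r with hF
  have hder : ∀ t ∈ Icc t₀ t₁, HasDerivWithinAt F 0 (Icc t₀ t₁) t := by
    intro t ht
    rw [hasDerivWithinAt_iff_isLittleO, Asymptotics.isLittleO_iff]
    intro ε hε
    have hε' : 0 < ε / (C + 1) := by positivity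
    obtain ⟨δ, hδ, hmod⟩ := h.exists_modulus hW hI ht hε'
    have hnear : ∀ᶠ t' in 𝓝[Icc t₀ t₁] t, |t' - t| < δ :=
      nhdsWithin_le_nhds (Metric.ball_mem_nhds t hδ)
    filter_upwards [hnear, self_mem_nhdsWithin] with t' h1 ht'
    have h2 := hinc h hW hI ht ht' hε'.le (fun r hr => by
      have hrJ := uIcc_subset_Icc ht ht' hr
      have hrt : |r - t| < δ := by
        have := abs_sub_left_of_mem_uIcc hr
        linarith
      exact ⟨(hmod t' ht' r hrJ h1 hrt).1, (hmod r hrJ r hrJ hrt hrt).1,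
        (hmod t' ht' r hrJ h1 hrt).2⟩)
    have h3 : F t' - F t = W t' (m t') - W t (m t) - ∫ r in t..t', G r := by
      simp only [hF]
      rw [← intervalIntegral.integral_interval_sub_left (hii _ hl _ ht') (hii _ hl _ ht)]
      ring
    rw [smul_zero, sub_zero, h3]
    refine h2.trans ?_
    rw [Real.norm_eq_abs]
    gcongr
    calc C * (ε / (C + 1)) ≤ (C + 1) * (ε / (C + 1)) := by gcongr; linarith
      _ = ε := by field_simp
  have hconst := constant_of_derivWithin_zero (f := F) (a := t₀) (b := t₁)
    (fun t ht => (hder t ht).differentiableWithinAt)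
    (fun t ht => (hder t (Ico_subset_Icc_self ht)).derivWithin
      (uniqueDiffOn_Icc hlt t (Ico_subset_Icc_self ht))) t₁ (right_mem_Icc.2 h.le)
  simp only [hF, intervalIntegral.integral_same, sub_zero] at hconst
  linarith

end ChainRule

end Model
end NoisyObs

/-! ### Verification between two observations -/

namespace NoisyObs
namespace Model

variable {d k₁ k₂ : ℕ} {Ω S O : Type*} [MeasurableSpace Ω] [MeasurableSpace S] [MeasurableSpace O]
variable {M : Model d k₁ k₂ Ω S O}

theorem Regular.exists_ctrl (hM : M.Regular) : ∃ α, α ∈ M.ctrl := by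
  obtain ⟨u, hu⟩ := hM.U_nonempty
  exact ⟨u.1, u, hu, rfl⟩

theorem Regular.exists_running_lower (hM : M.Regular) : ∃ C : ℝ, 0 ≤ C ∧ ∀ α ∈ M.ctrl,
    ∀ t ∈ Icc 0 M.T, ∀ μ, -C ≤ M.ℓ t μ α := by
  obtain ⟨C, hC⟩ := hM.ℓ_bddBelow
  refine ⟨|C|, abs_nonneg _, ?_⟩
  rintro _ ⟨u, hu, rfl⟩ t ht μ
  exact (neg_abs_le C).trans (hC u hu t ht μ)

theorem Regular.bddBelow_hamFun (hM : M.Regular) {t : ℝ} (ht : t ∈ Icc 0 M.T) (μ : P d)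
    {f : E d → ℝ} (hf : IsCb2 f) : BddBelow (M.hamFun t μ f '' M.U) := by
  obtain ⟨C, hC, hp⟩ := hM.exists_pairing_bound
  obtain ⟨B, hB⟩ := hf.exists_derivBound
  obtain ⟨C', hC', hl⟩ := hM.exists_running_lower
  refine ⟨-(C * B) - C', ?_⟩
  rintro _ ⟨u, hu, rfl⟩
  have h1 := (abs_le.1 (hp u.1 ⟨u, hu, rfl⟩ μ f B hB)).1
  have h2 := hl u.1 ⟨u, hu, rfl⟩ t ht μ
  unfold hamFun
  linarith

theorem IsTrajectory.measurable_running (hM : M.Regular) {α : ℝ → E k₁} {m : ℝ → P d} {t₀ t₁ : ℝ}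
    (h : M.IsTrajectory α m t₀ t₁) :
    AEStronglyMeasurable (fun t => M.ℓ t (m t) (α t)) (volume.restrict (Icc t₀ t₁)) := by
  have : Measurable fun t : Icc t₀ t₁ => M.ℓ t (m t) (α t) :=
    hM.ℓ_measurable.comp (measurable_subtype_coe.prodMk (h.measurable_state.prodMk h.measurable))
  exact (aemeasurable_restrict_of_measurable_subtype measurableSet_Icc this).aestronglyMeasurable

/-- On the time interval `[a, c)` the function `W` is a classical solution of the Hamilton--Jacobi--
Bellman equation, with terminal values `V` at `c` attained as joint limits. -/
structure SolvesHJB (M : Model d k₁ k₂ Ω S O) (a c : ℝ) (W Wt : ℝ → P d → ℝ)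
    (D : ℝ → P d → E d → ℝ) (V : P d → ℝ) : Prop where
  lt : a < c
  nonneg : 0 ≤ a
  le_T : c ≤ M.T
  regular : IsRegularOn (Ico a c) W Wt D
  pde : ∀ t ∈ Ico a c, ∀ μ, Wt t μ + M.hamiltonian t μ (D t μ) = 0
  limit : ∀ μ, Tendsto (fun q : ℝ × P d => W q.1 q.2) (𝓝[<] c ×ˢ 𝓝 μ) (𝓝 (V μ))

namespace SolvesHJB

variable {a c : ℝ} {W Wt : ℝ → P d → ℝ} {D : ℝ → P d → E d → ℝ} {V : P d → ℝ}

theorem subset_Icc (h : M.SolvesHJB a c W Wt D V) : Icc a c ⊆ Icc 0 M.T :=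
  Icc_subset_Icc h.nonneg h.le_T

theorem nonneg_of_mem_ctrl (h : M.SolvesHJB a c W Wt D V) (hM : M.Regular) {t : ℝ}
    (ht : t ∈ Ico a c) (μ : P d) {α : E k₁} (hα : α ∈ M.ctrl) :
    0 ≤ Wt t μ + M.pairing α μ (D t μ) + M.ℓ t μ α := by
  obtain ⟨u, hu, rfl⟩ := hα
  have h1 := csInf_le (hM.bddBelow_hamFun (h.subset_Icc (Ico_subset_Icc_self ht)) μ
    (h.regular.isCb2 ht μ)) ⟨u, hu, rfl⟩
  have h2 := h.pde t ht μ
  unfold hamiltonian at h2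
  unfold hamFun at h1 h2
  linarith

theorem eq_zero_of_minimizer (h : M.SolvesHJB a c W Wt D V) {t : ℝ}
    (ht : t ∈ Ico a c) (μ : P d) {u : E k₁ × E k₂} (hu : u ∈ M.U)
    (hmin : ∀ v ∈ M.U, M.hamFun t μ (D t μ) u ≤ M.hamFun t μ (D t μ) v) :
    Wt t μ + M.pairing u.1 μ (D t μ) + M.ℓ t μ u.1 = 0 := by
  have h1 : M.hamiltonian t μ (D t μ) = M.hamFun t μ (D t μ) u :=
    IsLeast.csInf_eq ⟨⟨u, hu, rfl⟩, by rintro _ ⟨v, hv, rfl⟩; exact hmin v hv⟩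
  have h2 := h.pde t ht μ
  rw [h1] at h2
  unfold hamFun at h2
  linarith

/-- A joint limit is continuous in the remaining variable. -/
theorem continuous_limit (h : M.SolvesHJB a c W Wt D V) : Continuous V := by
  rw [continuous_iff_continuousAt]
  intro μ
  rw [Metric.continuousAt_iff']
  intro ε hε
  have h1 := (h.limit μ).eventually (Metric.closedBall_mem_nhds (V μ) (half_pos hε))
  obtain ⟨p, hp, q, hq, hpq⟩ := eventually_prod_iff.1 h1
  filter_upwards [hq.eventually_nhds] with ν hν
  have h2 : ∀ᶠ z : ℝ × P d in 𝓝[<] c ×ˢ 𝓝 ν, W z.1 z.2 ∈ Metric.closedBall (V μ) (ε / 2) :=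
    eventually_prod_iff.2 ⟨p, hp, q, hν, hpq⟩
  have h3 := Metric.isClosed_closedBall.mem_of_tendsto (h.limit ν) h2
  exact (Metric.mem_closedBall.1 h3).trans_lt (by linarith)

theorem tendsto_along (h : M.SolvesHJB a c W Wt D V) {t₀ : ℝ} (ht₀ : t₀ < c) {m : ℝ → P d}
    (hm : ContinuousOn m (Icc t₀ c)) : Tendsto (fun t => W t (m t)) (𝓝[<] c) (𝓝 (V (m c))) := by
  have h1 : Tendsto m (𝓝[<] c) (𝓝 (m c)) := by
    rw [← nhdsWithin_Ico_eq_nhdsLT ht₀]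
    exact (hm c (right_mem_Icc.2 ht₀.le)).mono Ico_subset_Icc_self
  exact (h.limit (m c)).comp (tendsto_id.prodMk h1)

/-- Verification on one interval between observations: the chain rule gives one inequality for every
control. -/
theorem le_cost (h : M.SolvesHJB a c W Wt D V) (hM : M.Regular) {α : ℝ → E k₁} {m : ℝ → P d}
    {t₀ : ℝ} (ha : a ≤ t₀) (hc : t₀ < c) (T : M.IsTrajectory α m t₀ c)
    (hint : IntervalIntegrable (fun t => M.ℓ t (m t) (α t)) volume t₀ c) :
    W t₀ (m t₀) ≤ (∫ t in t₀..c, M.ℓ t (m t) (α t)) + V (m c) := by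
  have hlim := h.tendsto_along hc T.solves.1
  have hprim : Tendsto (fun t => ∫ r in t₀..t, M.ℓ r (m r) (α r)) (𝓝[<] c)
      (𝓝 (∫ r in t₀..c, M.ℓ r (m r) (α r))) := by
    have h1 := intervalIntegral.continuousOn_primitive_interval'
      (by simpa using hint) (left_mem_uIcc (a := t₀) (b := c))
    rw [uIcc_of_le hc.le] at h1
    rw [← nhdsWithin_Ico_eq_nhdsLT hc]
    exact (h1 c (right_mem_Icc.2 hc.le)).mono Ico_subset_Icc_self
  refine ge_of_tendsto (hprim.add hlim) ?_
  rw [← nhdsWithin_Ico_eq_nhdsLT hc]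
  filter_upwards [self_mem_nhdsWithin] with t ht
  have T' := T.mono hM le_rfl ht.1 ht.2.le
  have hI : Icc t₀ t ⊆ Ico a c := fun r hr => ⟨ha.trans hr.1, hr.2.trans_lt ht.2⟩
  have hch := T'.chain_rule hM h.regular hI
  have hi1 : IntervalIntegrable (fun r => Wt r (m r) + M.pairing (α r) (m r) (D r (m r)))
      volume t₀ t := by
    refine IntegrableOn.intervalIntegrable ?_
    rw [uIcc_of_le ht.1]
    exact (T'.integrableOn_Wt h.regular hI).add (T'.integrableOn_pairing_D hM h.regular hI)
  have hi2 : IntervalIntegrable (fun t => M.ℓ t (m t) (α t)) volume t₀ t :=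
    hint.mono_set (by rw [uIcc_of_le ht.1, uIcc_of_le hc.le]; exact Icc_subset_Icc_right ht.2.le)
  have h0 : 0 ≤ ∫ r in t₀..t, (Wt r (m r) + M.pairing (α r) (m r) (D r (m r)) +
      M.ℓ r (m r) (α r)) := intervalIntegral.integral_nonneg ht.1 fun r hr =>
    h.nonneg_of_mem_ctrl hM (hI hr) _ (T'.mem r hr)
  rw [intervalIntegral.integral_add hi1 hi2, ← hch] at h0
  linarith

/-- Verification on one interval between observations: equality for minimizing controls. The
running cost is then minus the time derivative of `W` along the trajectory. Since it is bounded
below, the convergence of its integrals implies that it is integrable up to the time `c`. -/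
theorem eq_cost (h : M.SolvesHJB a c W Wt D V) (hM : M.Regular) {α : ℝ → E k₁} {m : ℝ → P d}
    {t₀ : ℝ} (ha : a ≤ t₀) (hc : t₀ < c) (T : M.IsTrajectory α m t₀ c)
    (hmin : ∀ t ∈ Ioo t₀ c, Wt t (m t) + M.pairing (α t) (m t) (D t (m t)) +
      M.ℓ t (m t) (α t) = 0) :
    IntervalIntegrable (fun t => M.ℓ t (m t) (α t)) volume t₀ c ∧
      W t₀ (m t₀) = (∫ t in t₀..c, M.ℓ t (m t) (α t)) + V (m c) := by
  have hlim := h.tendsto_along hc T.solves.1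
  obtain ⟨C, hC, hl⟩ := hM.exists_running_lower
  have hpart : ∀ t ∈ Ico t₀ c, IntervalIntegrable (fun t => M.ℓ t (m t) (α t)) volume t₀ t ∧
      W t₀ (m t₀) = (∫ r in t₀..t, M.ℓ r (m r) (α r)) + W t (m t) := by
    intro t ht
    have T' := T.mono hM le_rfl ht.1 ht.2.le
    have hI : Icc t₀ t ⊆ Ico a c := fun r hr => ⟨ha.trans hr.1, hr.2.trans_lt ht.2⟩
    have hch := T'.chain_rule hM h.regular hI
    have hi1 : IntervalIntegrable (fun r => Wt r (m r) + M.pairing (α r) (m r) (D r (m r)))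
        volume t₀ t := by
      refine IntegrableOn.intervalIntegrable ?_
      rw [uIcc_of_le ht.1]
      exact (T'.integrableOn_Wt h.regular hI).add (T'.integrableOn_pairing_D hM h.regular hI)
    have heq : ∀ r ∈ Ioc t₀ t, -(Wt r (m r) + M.pairing (α r) (m r) (D r (m r))) =
        M.ℓ r (m r) (α r) := fun r hr => by
      have := hmin r ⟨hr.1, hr.2.trans_lt ht.2⟩
      linarith
    refine ⟨hi1.neg.congr (fun r hr => heq r (by rwa [uIoc_of_le ht.1] at hr)), ?_⟩
    have h2 : ∫ r in t₀..t, M.ℓ r (m r) (α r) =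
        -∫ r in t₀..t, (Wt r (m r) + M.pairing (α r) (m r) (D r (m r))) := by
      rw [← intervalIntegral.integral_neg]
      refine intervalIntegral.integral_congr_ae (.of_forall fun r hr => ?_)
      rw [uIoc_of_le ht.1] at hr
      exact (heq r hr).symm
    rw [h2, ← hch]
    ring
  have hint : IntegrableOn (fun t => M.ℓ t (m t) (α t)) (Ioc t₀ c) := by
    obtain ⟨u, -, hu, hut⟩ := exists_seq_strictMono_tendsto' hc
    have hu' : ∀ n, u n ∈ Ico t₀ c := fun n => Ioo_subset_Ico_self (hu n)
    have hWu : Tendsto (fun n => W (u n) (m (u n))) atTop (𝓝 (V (m c))) :=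
      hlim.comp (tendsto_nhdsWithin_iff.2 ⟨hut, .of_forall fun n => (hu n).2⟩)
    refine integrableOn_Ioc_of_intervalIntegral_norm_bounded_right (l := atTop) (b := u)
      (I := W t₀ (m t₀) - (V (m c) - 1) + 2 * C * (c - t₀)) (fun n => ?_) hut ?_
    · exact (intervalIntegrable_iff_integrableOn_Ioc_of_le (hu' n).1).1 (hpart _ (hu' n)).1
    filter_upwards [hWu.eventually_const_le (sub_one_lt (V (m c)))] with n hn
    obtain ⟨hi, he⟩ := hpart _ (hu' n)
    have hi' := (intervalIntegrable_iff_integrableOn_Ioc_of_le (hu' n).1).1 hi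
    rw [intervalIntegral.integral_of_le (hu' n).1] at he
    have hle : ∫ x in Ioc t₀ (u n), ‖M.ℓ x (m x) (α x)‖ ≤
        ∫ x in Ioc t₀ (u n), (M.ℓ x (m x) (α x) + 2 * C) := by
      refine setIntegral_mono_on hi'.norm (hi'.add (integrable_const _)) measurableSet_Ioc
        fun r hr => ?_
      have hrc : r ∈ Icc t₀ c := ⟨hr.1.le, hr.2.trans (hu' n).2.le⟩
      have := hl _ (T.mem r hrc) r (h.subset_Icc ⟨ha.trans hrc.1, hrc.2⟩) (m r)
      rw [Real.norm_eq_abs, abs_le]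
      constructor <;> linarith
    refine hle.trans ?_
    rw [integral_add hi' (integrable_const _), setIntegral_const]
    simp only [measureReal_def, Real.volume_Ioc, smul_eq_mul]
    rw [ENNReal.toReal_ofReal (by linarith [(hu' n).1])]
    nlinarith [(hu' n).2]
  have hii : IntervalIntegrable (fun t => M.ℓ t (m t) (α t)) volume t₀ c :=
    (intervalIntegrable_iff_integrableOn_Ioc_of_le hc.le).2 hint
  refine ⟨hii, ?_⟩
  have hprim : Tendsto (fun t => ∫ r in t₀..t, M.ℓ r (m r) (α r)) (𝓝[<] c)
      (𝓝 (∫ r in t₀..c, M.ℓ r (m r) (α r))) := by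
    have h1 := intervalIntegral.continuousOn_primitive_interval'
      (by simpa using hii) (left_mem_uIcc (a := t₀) (b := c))
    rw [uIcc_of_le hc.le] at h1
    rw [← nhdsWithin_Ico_eq_nhdsLT hc]
    exact (h1 c (right_mem_Icc.2 hc.le)).mono Ico_subset_Icc_self
  refine tendsto_nhds_unique (tendsto_const_nhds.congr' ?_) (hprim.add hlim)
  rw [← nhdsWithin_Ico_eq_nhdsLT hc]
  filter_upwards [self_mem_nhdsWithin] with t ht using (hpart t ht).2

end SolvesHJB

end Model
end NoisyObs

/-! ### Open-loop controls -/

namespace NoisyObs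
namespace Model

variable {d k₁ k₂ : ℕ} {Ω S O : Type*} [MeasurableSpace Ω] [MeasurableSpace S] [MeasurableSpace O]
variable {M : Model d k₁ k₂ Ω S O}

/-- An open-loop control `A` on `[t₀, t₁]` together with the flow `Φ t ν` of the Fokker--Planck
equation that it drives, `ν` being the law at time `t₀`. The flow is continuous in `ν`, and the
running cost is bounded above. -/
structure IsOpenLoop (M : Model d k₁ k₂ Ω S O) (A : ℝ → E k₁) (Φ : ℝ → P d → P d) (t₀ t₁ : ℝ) :
    Prop where
  measurable : Measurable A
  mem : ∀ r, A r ∈ M.ctrl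
  init : ∀ ν, Φ t₀ ν = ν
  solves : ∀ ν, M.SolvesFP A (fun t => Φ t ν) t₀ t₁
  continuous : ∀ t ∈ Icc t₀ t₁, Continuous (Φ t)
  bddAbove : ∃ C, ∀ t ∈ Icc 0 M.T, ∀ μ, M.ℓ t μ (A t) ≤ C

/-- The running cost of an open-loop control as a function of the initial law. -/
noncomputable def runCost (M : Model d k₁ k₂ Ω S O) (A : ℝ → E k₁) (Φ : ℝ → P d → P d)
    (t₀ t₁ : ℝ) (ν : P d) : ℝ :=
  ∫ t in t₀..t₁, M.ℓ t (Φ t ν) (A t)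

namespace IsOpenLoop

variable {A : ℝ → E k₁} {Φ : ℝ → P d → P d} {t₀ t₁ : ℝ}

theorem isTrajectory (h : M.IsOpenLoop A Φ t₀ t₁) (hle : t₀ ≤ t₁) (ν : P d) :
    M.IsTrajectory A (fun t => Φ t ν) t₀ t₁ :=
  ⟨hle, h.solves ν, h.measurable.comp measurable_subtype_coe, fun r _ => h.mem r⟩

theorem exists_bound (h : M.IsOpenLoop A Φ t₀ t₁) (hM : M.Regular) :
    ∃ C, ∀ t ∈ Icc 0 M.T, ∀ μ, |M.ℓ t μ (A t)| ≤ C := by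
  obtain ⟨C, hC⟩ := h.bddAbove
  obtain ⟨C', hC', hl⟩ := hM.exists_running_lower
  refine ⟨max C C', fun t ht μ => abs_le.2 ⟨?_, (hC t ht μ).trans (le_max_left _ _)⟩⟩
  have := hl _ (h.mem t) t ht μ
  linarith [le_max_right C C']

theorem integrableOn_running (h : M.IsOpenLoop A Φ t₀ t₁) (hM : M.Regular) (hle : t₀ ≤ t₁)
    (h0 : 0 ≤ t₀) (hT : t₁ ≤ M.T) (ν : P d) :
    IntegrableOn (fun t => M.ℓ t (Φ t ν) (A t)) (Icc t₀ t₁) := by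
  obtain ⟨C, hC⟩ := h.exists_bound hM
  refine IntegrableOn.of_bound (C := C) (by simp) ((h.isTrajectory hle ν).measurable_running hM) ?_
  exact (ae_restrict_iff' measurableSet_Icc).2
    (.of_forall fun t ht => hC t ⟨h0.trans ht.1, ht.2.trans hT⟩ _)

theorem intervalIntegrable_running (h : M.IsOpenLoop A Φ t₀ t₁) (hM : M.Regular) (hle : t₀ ≤ t₁)
    (h0 : 0 ≤ t₀) (hT : t₁ ≤ M.T) (ν : P d) :
    IntervalIntegrable (fun t => M.ℓ t (Φ t ν) (A t)) volume t₀ t₁ := by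
  refine IntegrableOn.intervalIntegrable ?_
  rw [uIcc_of_le hle]
  exact h.integrableOn_running hM hle h0 hT ν

theorem continuous_runCost (h : M.IsOpenLoop A Φ t₀ t₁) (hM : M.Regular) (hle : t₀ ≤ t₁)
    (h0 : 0 ≤ t₀) (hT : t₁ ≤ M.T) : Continuous (M.runCost A Φ t₀ t₁) := by
  obtain ⟨C, hC⟩ := h.exists_bound hM
  have hsub : uIoc t₀ t₁ ⊆ Icc t₀ t₁ := by
    rw [uIoc_of_le hle]
    exact Ioc_subset_Icc_self
  have hsub' : Icc t₀ t₁ ⊆ Icc 0 M.T := Icc_subset_Icc h0 hT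
  refine intervalIntegral.continuous_of_dominated_interval (bound := fun _ => C)
    (fun ν => ((h.isTrajectory hle ν).measurable_running hM).mono_set hsub)
    (fun ν => .of_forall fun t ht => hC t (hsub' (hsub ht)) _) intervalIntegrable_const
    (.of_forall fun t ht => ?_)
  obtain ⟨u, hu, hut⟩ := h.mem t
  have h1 : Continuous fun ν : P d => M.ℓ t ν u.1 :=
    (hM.ℓ_continuous u hu).comp_continuous (f := fun ν : P d => (t, ν)) (by fun_prop)
      (fun ν => ⟨hsub' (hsub ht), mem_univ _⟩)
  rw [← hut]
  exact h1.comp (h.continuous t (hsub ht))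

end IsOpenLoop

theorem isOpenLoop_const (hM : M.Regular) {α : E k₁} (hα : α ∈ M.ctrl) {F : ℝ → P d → P d}
    (h0 : ∀ ν, F 0 ν = ν) (hF : ∀ ν, M.SolvesFP (fun _ => α) (fun t => F t ν) 0 M.T)
    (hc : Continuous fun z : ℝ × P d => F z.1 z.2) {t₀ t₁ : ℝ} (ht₀ : 0 ≤ t₀)
    (ht₁ : t₁ ≤ M.T) : M.IsOpenLoop (fun _ => α) (fun t ν => F (t - t₀) ν) t₀ t₁ where
  measurable := measurable_const
  mem _ := hα
  init ν := by rw [sub_self, h0]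
  solves ν := (hF ν).shift (by linarith)
  continuous t _ := hc.comp (f := fun ν : P d => (t - t₀, ν)) (by fun_prop)
  bddAbove := by
    obtain ⟨u, hu, rfl⟩ := hα
    exact hM.ℓ_bddAbove u hu

/-- Concatenation of open-loop controls. -/
theorem IsOpenLoop.concat (hM : M.Regular) {A A' : ℝ → E k₁} {Φ Φ' : ℝ → P d → P d} {t₀ t₁ t₂ : ℝ}
    (h₀₁ : t₀ ≤ t₁) (h₁₂ : t₁ ≤ t₂) (h : M.IsOpenLoop A Φ t₀ t₁) (h' : M.IsOpenLoop A' Φ' t₁ t₂) :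
    M.IsOpenLoop (fun r => if r < t₁ then A r else A' r)
      (fun t ν => if t ≤ t₁ then Φ t ν else Φ' t (Φ t₁ ν)) t₀ t₂ := by
  have hmeas : Measurable fun r => if r < t₁ then A r else A' r :=
    Measurable.ite measurableSet_Iio h.measurable h'.measurable
  have hmem : ∀ r, (if r < t₁ then A r else A' r) ∈ M.ctrl := fun r => by
    split_ifs
    exacts [h.mem r, h'.mem r]
  have hlate : ∀ t ∈ Icc t₁ t₂, ∀ ν, (if t ≤ t₁ then Φ t ν else Φ' t (Φ t₁ ν)) = Φ' t (Φ t₁ ν) := by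
    intro t ht ν
    split_ifs with htt
    · obtain rfl : t = t₁ := le_antisymm htt ht.1
      rw [h'.init]
    · rfl
  refine ⟨hmeas, hmem, fun ν => by rw [if_pos h₀₁, h.init], fun ν => ?_, fun t ht => ?_, ?_⟩
  · refine SolvesFP.concat hM h₀₁ h₁₂ ((h.solves ν).congr (fun r hr => if_pos hr.2)
      fun t ht => if_pos ht.2) ((h'.solves (Φ t₁ ν)).congr (fun r hr => if_neg hr.1.not_gt)
      fun t ht => hlate t ht ν) hmeas hmem
  · by_cases htt : t ≤ t₁
    · simp only [htt, if_true]
      exact h.continuous t ⟨ht.1, htt⟩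
    · simp only [htt, if_false]
      exact (h'.continuous t ⟨(not_le.1 htt).le, ht.2⟩).comp
        (h.continuous t₁ (right_mem_Icc.2 h₀₁))
  · obtain ⟨C, hC⟩ := h.bddAbove
    obtain ⟨C', hC'⟩ := h'.bddAbove
    refine ⟨max C C', fun t ht μ => ?_⟩
    split_ifs
    exacts [(hC t ht μ).trans (le_max_left _ _), (hC' t ht μ).trans (le_max_right _ _)]

theorem IsOpenLoop.runCost_concat (hM : M.Regular) {A A' : ℝ → E k₁} {Φ Φ' : ℝ → P d → P d}
    {t₀ t₁ t₂ : ℝ} (h₀₁ : t₀ ≤ t₁) (h₁₂ : t₁ ≤ t₂) (h0 : 0 ≤ t₀) (hT : t₂ ≤ M.T)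
    (h : M.IsOpenLoop A Φ t₀ t₁) (h' : M.IsOpenLoop A' Φ' t₁ t₂) (ν : P d) :
    M.runCost (fun r => if r < t₁ then A r else A' r)
      (fun t ν => if t ≤ t₁ then Φ t ν else Φ' t (Φ t₁ ν)) t₀ t₂ ν =
        M.runCost A Φ t₀ t₁ ν + M.runCost A' Φ' t₁ t₂ (Φ t₁ ν) := by
  have hc := h.concat hM h₀₁ h₁₂ h'
  have hi := hc.integrableOn_running hM (h₀₁.trans h₁₂) h0 hT ν
  have hi1 : IntervalIntegrable _ volume t₀ t₁ :=
    (hi.mono_set (by rw [uIcc_of_le h₀₁]; exact Icc_subset_Icc_right h₁₂)).intervalIntegrable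
  have hi2 : IntervalIntegrable _ volume t₁ t₂ :=
    (hi.mono_set (by rw [uIcc_of_le h₁₂]; exact Icc_subset_Icc_left h₀₁)).intervalIntegrable
  unfold runCost
  rw [← intervalIntegral.integral_add_adjacent_intervals hi1 hi2]
  congr 1
  · rw [intervalIntegral.integral_of_le h₀₁, intervalIntegral.integral_of_le h₀₁,
      integral_Ioc_eq_integral_Ioo, integral_Ioc_eq_integral_Ioo]
    refine setIntegral_congr_fun measurableSet_Ioo fun r hr => ?_
    simp only [if_pos hr.2, if_pos hr.2.le]
  · refine intervalIntegral.integral_congr_ae (.of_forall fun r hr => ?_)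
    rw [uIoc_of_le h₁₂] at hr
    simp only [if_neg hr.1.not_gt, if_neg hr.1.not_ge]

namespace SolvesHJB

variable {a c : ℝ} {W Wt : ℝ → P d → ℝ} {D : ℝ → P d → E d → ℝ} {V : P d → ℝ}

theorem continuous_defect (h : M.SolvesHJB a c W Wt D V) (hM : M.Regular) {α : E k₁}
    (hα : α ∈ M.ctrl) : Continuous fun z : Ico a c × P d =>
      Wt z.1 z.2 + M.pairing α z.2 (D z.1 z.2) + M.ℓ z.1 z.2 α := by
  have h1 : Continuous fun z : (Ico a c × P d) × P d => M.pairing α z.2 (D z.1.1 z.1.2) := by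
    refine continuous_integral_joint
      (H := fun z : (Ico a c × P d) × E d => M.gen α (D z.1.1 z.1.2) z.2)
      (hM.continuous_symbol hα continuous_snd h.regular.continuous_fderiv
        h.regular.continuous_fderiv_fderiv) fun K hK => ?_
    obtain ⟨C, hC, hs⟩ := hM.exists_symbol_bound
    obtain ⟨B, hB, hb⟩ := h.regular.exists_bound hK
    refine ⟨C * (B + B), fun q hq x => (hs α hα x _ _).trans ?_⟩
    have := hb q hq x
    gcongr
    exacts [this.2.1, this.2.2]
  have h2 : Continuous fun z : Ico a c × P d => M.pairing α z.2 (D z.1 z.2) :=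
    h1.comp (continuous_id.prodMk continuous_snd)
  have h3 : Continuous fun z : Ico a c × P d => M.ℓ z.1 z.2 α := by
    obtain ⟨u, hu, rfl⟩ := hα
    exact (hM.ℓ_continuous u hu).comp_continuous (f := fun z : Ico a c × P d => ((z.1 : ℝ), z.2))
      (by fun_prop) fun z => ⟨h.subset_Icc (Ico_subset_Icc_self z.1.2), mem_univ _⟩
  exact (h.regular.continuous_Wt.add h2).add h3

/-- Near every point some constant control is almost optimal for a uniform time. -/
theorem exists_local_control (h : M.SolvesHJB a c W Wt D V) (hM : M.Regular) {σ : ℝ}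
    (hσ : σ ∈ Ico a c) (ν₀ : P d) {ε : ℝ} (hε : 0 < ε) :
    ∃ α ∈ M.ctrl, ∃ δ > 0, ∀ᶠ z : ℝ × P d in 𝓝 (σ, ν₀), a ≤ z.1 →
      ∃ Φ, M.IsOpenLoop (fun _ => α) Φ z.1 (z.1 + δ) ∧ z.1 + δ < c ∧
        M.runCost (fun _ => α) Φ z.1 (z.1 + δ) z.2 + W (z.1 + δ) (Φ (z.1 + δ) z.2) ≤
          W z.1 z.2 + ε * δ := by
  obtain ⟨u, hu, hlt⟩ : ∃ u ∈ M.U, Wt σ ν₀ + M.hamFun σ ν₀ (D σ ν₀) u < ε := by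
    have h1 := h.pde σ hσ ν₀
    have h2 : sInf (M.hamFun σ ν₀ (D σ ν₀) '' M.U) < ε - Wt σ ν₀ := by
      unfold hamiltonian at h1
      linarith
    obtain ⟨_, ⟨u, hu, rfl⟩, hlt⟩ := exists_lt_of_csInf_lt (hM.U_nonempty.image _) h2
    exact ⟨u, hu, by linarith⟩
  have hα : u.1 ∈ M.ctrl := ⟨u, hu, rfl⟩
  obtain ⟨F, hF0, hF, hFc⟩ := hM.exists_flow hα
  have hq := h.continuous_defect hM hα
  set q : ℝ → P d → ℝ := fun t ν => Wt t ν + M.pairing u.1 ν (D t ν) + M.ℓ t ν u.1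
  have hq1 : ∀ᶠ z : Ico a c × P d in 𝓝 (⟨σ, hσ⟩, ν₀), q z.1 z.2 < ε := by
    refine hq.continuousAt.eventually_lt continuousAt_const ?_
    simp only [hamFun] at hlt
    linarith
  -- the same neighbourhood in `ℝ × P d`
  have hq2 : ∀ᶠ z : ℝ × P d in 𝓝 (σ, ν₀), z.1 < c ∧ ∀ hz : a ≤ z.1, z.1 < c → q z.1 z.2 < ε := by
    rw [nhds_prod_eq, eventually_prod_iff] at hq1 ⊢
    obtain ⟨p, hp, p', hp', hpp⟩ := hq1
    rw [nhds_subtype, eventually_comap] at hp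
    refine ⟨_, hp.and (eventually_lt_nhds hσ.2), p', hp',
      fun {r} hr {ν} hν => ⟨hr.2, fun h1 h2 => ?_⟩⟩
    exact hpp (hr.1 ⟨r, h1, h2⟩ rfl) hν
  have hmap : Tendsto (fun y : ℝ × (ℝ × P d) => (y.2.1 + y.1, F y.1 y.2.2))
      (𝓝 (0, (σ, ν₀))) (𝓝 (σ, ν₀)) := by
    have hcont : Continuous fun y : ℝ × (ℝ × P d) => (y.2.1 + y.1, F y.1 y.2.2) :=
      Continuous.prodMk (by fun_prop) (hFc.comp (f := fun y : ℝ × (ℝ × P d) => (y.1, y.2.2))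
        (by fun_prop))
    have := hcont.tendsto (0, (σ, ν₀))
    simpa only [add_zero, hF0] using this
  have hev := hmap.eventually hq2
  rw [nhds_prod_eq, eventually_prod_iff] at hev
  obtain ⟨p, hp, p', hp', hpp⟩ := hev
  obtain ⟨δ, hδ, hball⟩ := Metric.eventually_nhds_iff.1 hp
  refine ⟨u.1, hα, δ / 2, half_pos hδ, hp'.mono fun z hz haz => ?_⟩
  have hin : ∀ r ∈ Icc 0 (δ / 2), p r := fun r hr => hball (by
    rw [Real.dist_eq, sub_zero, abs_of_nonneg hr.1]
    linarith [hr.2])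
  have hzc : z.1 + δ / 2 < c := (hpp (hin _ (right_mem_Icc.2 (by positivity))) hz).1
  have hle : z.1 ≤ z.1 + δ / 2 := by linarith
  have h0z : 0 ≤ z.1 := h.nonneg.trans haz
  have hzT : z.1 + δ / 2 ≤ M.T := hzc.le.trans h.le_T
  have hol := isOpenLoop_const hM hα hF0 hF hFc h0z hzT
  refine ⟨_, hol, hzc, ?_⟩
  have htr := hol.isTrajectory hle z.2
  have hI : Icc z.1 (z.1 + δ / 2) ⊆ Ico a c := fun r hr => ⟨haz.trans hr.1, hr.2.trans_lt hzc⟩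
  have hch := htr.chain_rule hM h.regular hI
  have hi1 : IntervalIntegrable (fun r => Wt r (F (r - z.1) z.2) +
      M.pairing u.1 (F (r - z.1) z.2) (D r (F (r - z.1) z.2))) volume z.1 (z.1 + δ / 2) := by
    refine IntegrableOn.intervalIntegrable ?_
    rw [uIcc_of_le hle]
    exact (htr.integrableOn_Wt h.regular hI).add (htr.integrableOn_pairing_D hM h.regular hI)
  have hi2 := hol.intervalIntegrable_running hM hle h0z hzT z.2
  have hbound : ∫ r in z.1..(z.1 + δ / 2), ((Wt r (F (r - z.1) z.2) +
      M.pairing u.1 (F (r - z.1) z.2) (D r (F (r - z.1) z.2))) + M.ℓ r (F (r - z.1) z.2) u.1) ≤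
      ∫ _ in z.1..(z.1 + δ / 2), ε := by
    refine intervalIntegral.integral_mono_on hle (hi1.add hi2) intervalIntegrable_const
      fun r hr => ?_
    have h1 := hpp (hin (r - z.1) ⟨by linarith [hr.1], by linarith [hr.2]⟩) hz
    simp only [add_sub_cancel] at h1
    exact (h1.2 (haz.trans hr.1) h1.1).le
  rw [intervalIntegral.integral_add hi1 hi2, ← hch, intervalIntegral.integral_const] at hbound
  simp only [sub_self, hF0, smul_eq_mul] at hbound
  unfold runCost
  have e1 : z.1 + δ / 2 - z.1 = δ / 2 := by ring
  rw [e1] at hbound ⊢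
  linarith

end SolvesHJB

end Model
end NoisyObs

/-! ### Almost optimal controls between two observations -/

namespace NoisyObs
namespace Model

variable {d k₁ k₂ : ℕ} {Ω S O : Type*} [MeasurableSpace Ω] [MeasurableSpace S] [MeasurableSpace O]
variable {M : Model d k₁ k₂ Ω S O}

namespace SolvesHJB

variable {a c : ℝ} {W Wt : ℝ → P d → ℝ} {D : ℝ → P d → E d → ℝ} {V : P d → ℝ}

/-- Existence of almost optimal open-loop controls. Let `R` be the set of times up to which an
open-loop control with small excess cost exists. The states reached stay in a compact set, so at
`σ = sSup R` a limit state exists; the almost optimal constant controls near it extend beyond `σ`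
unless `σ = c`. -/
theorem exists_openLoop (h : M.SolvesHJB a c W Wt D V) (hM : M.Regular) {t₀ : ℝ}
    (ht₀ : t₀ ∈ Ico a c) (μ : P d) {ε : ℝ} (hε : 0 < ε) :
    ∃ A Φ, M.IsOpenLoop A Φ t₀ c ∧ M.runCost A Φ t₀ c μ + V (Φ c μ) < W t₀ μ + ε := by
  obtain ⟨α, hα⟩ := hM.exists_ctrl
  obtain ⟨F, hF0, hF, hFc⟩ := hM.exists_flow hα
  have h0t : 0 ≤ t₀ := h.nonneg.trans ht₀.1
  have hpos : 0 < c - t₀ := sub_pos.2 ht₀.2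
  set κ : ℝ := ε / (2 * (c - t₀)) with hκ
  have hκ0 : 0 < κ := by positivity
  set R : Set ℝ := {t | t ∈ Ico t₀ c ∧ ∃ A Φ, M.IsOpenLoop A Φ t₀ t ∧
    M.runCost A Φ t₀ t μ + W t (Φ t μ) ≤ W t₀ μ + κ * (t - t₀)} with hR
  have hR0 : t₀ ∈ R := by
    refine ⟨⟨le_rfl, ht₀.2⟩, _, _,
      isOpenLoop_const hM hα hF0 hF hFc h0t (ht₀.2.le.trans h.le_T), ?_⟩
    simp [runCost, hF0]
  have hbdd : BddAbove R := ⟨c, fun t ht => ht.1.2.le⟩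
  obtain ⟨u, -, hu, huR⟩ := exists_seq_tendsto_sSup ⟨t₀, hR0⟩ hbdd
  set σ := sSup R with hσ
  have hσ0 : t₀ ≤ σ := le_csSup hbdd hR0
  have hσc : σ ≤ c := csSup_le ⟨t₀, hR0⟩ fun t ht => ht.1.2.le
  choose hut A Φ hol hcost using huR
  obtain ⟨K, hK, hreach⟩ := hM.exists_isCompact_reachable (isCompact_singleton (x := μ)) (c - t₀)
  have hmem : ∀ k, Φ k (u k) μ ∈ K := fun k =>
    hreach _ _ _ _ ((hol k).isTrajectory (hut k).1 μ) (by linarith [(hut k).2])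
      (by rw [(hol k).init]; rfl) _ (right_mem_Icc.2 (hut k).1)
  obtain ⟨ν, -, φ, hφ, hν⟩ := hK.tendsto_subseq hmem
  have hu' : Tendsto (fun k => u (φ k)) atTop (𝓝 σ) := hu.comp hφ.tendsto_atTop
  rcases hσc.lt_or_eq with hlt | heq
  -- if `σ < c`, a control up to a time close to `σ` is extended beyond `σ`
  · exfalso
    obtain ⟨α', hα', δ, hδ, hloc⟩ := h.exists_local_control hM ⟨ht₀.1.trans hσ0, hlt⟩ ν hκ0
    have hev := (hu'.prodMk_nhds hν).eventually hloc
    have hev2 : ∀ᶠ k in atTop, σ - δ < u (φ k) := hu'.eventually_const_lt (by linarith)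
    obtain ⟨k, hk1, hk2⟩ := (hev.and hev2).exists
    obtain ⟨Ψ, hΨ, hΨc, hΨcost⟩ := hk1 (ht₀.1.trans (hut _).1)
    have hle : u (φ k) ≤ u (φ k) + δ := by linarith
    have hin : u (φ k) + δ ∈ R := by
      refine ⟨⟨(hut _).1.trans hle, hΨc⟩, _, _, (hol (φ k)).concat hM (hut _).1 hle hΨ, ?_⟩
      rw [(hol (φ k)).runCost_concat hM (hut _).1 hle h0t (hΨc.le.trans h.le_T) hΨ,
        if_neg (by linarith)]
      have := hcost (φ k)
      simp only [Function.comp_apply] at hΨcost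
      have e : κ * (u (φ k) + δ - t₀) = κ * (u (φ k) - t₀) + κ * δ := by ring
      rw [e]
      linarith
    have := le_csSup hbdd hin
    linarith
  -- if `σ = c`, any constant control is used on the short remaining interval
  · obtain ⟨C, hC⟩ : ∃ C, ∀ t ∈ Icc 0 M.T, ∀ μ, M.ℓ t μ α ≤ C := by
      obtain ⟨v, hv, rfl⟩ := hα
      exact hM.ℓ_bddAbove v hv
    rw [heq] at hu'
    have hx : Tendsto (fun k => (c - u (φ k), Φ (φ k) (u (φ k)) μ)) atTop (𝓝 (0, ν)) := by
      have := (tendsto_const_nhds (x := c)).sub hu'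
      rw [sub_self] at this
      exact this.prodMk_nhds hν
    have hend : Tendsto (fun k => F (c - u (φ k)) (Φ (φ k) (u (φ k)) μ)) atTop (𝓝 ν) := by
      have := (hFc.tendsto (0, ν)).comp hx
      simpa only [hF0, Function.comp_def] using this
    have hlim1 : Tendsto (fun k => C * (c - u (φ k)) + V (F (c - u (φ k)) (Φ (φ k) (u (φ k)) μ)))
        atTop (𝓝 (V ν)) := by
      have h1 := ((tendsto_const_nhds (x := c)).sub hu').const_mul C
      have h2 := h1.add ((h.continuous_limit.tendsto ν).comp hend)
      simpa using h2
    have hlim2 : Tendsto (fun k => W (u (φ k)) (Φ (φ k) (u (φ k)) μ) + ε / 2) atTop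
        (𝓝 (V ν + ε / 2)) := by
      refine Tendsto.add_const _ ((h.limit ν).comp (Tendsto.prodMk ?_ hν))
      exact tendsto_nhdsWithin_iff.2 ⟨hu', .of_forall fun k => (hut _).2⟩
    obtain ⟨k, hk⟩ := (hlim1.eventually_lt hlim2 (by linarith)).exists
    have hle := (hut (φ k)).2.le
    have h0u : 0 ≤ u (φ k) := h0t.trans (hut _).1
    have hcon := isOpenLoop_const hM hα hF0 hF hFc h0u h.le_T (t₁ := c)
    refine ⟨_, _, (hol (φ k)).concat hM (hut _).1 hle hcon, ?_⟩
    rw [(hol (φ k)).runCost_concat hM (hut _).1 hle h0t h.le_T hcon, if_neg (hut _).2.not_ge]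
    have hrun : M.runCost (fun _ => α) (fun t ν => F (t - u (φ k)) ν) (u (φ k)) c
        (Φ (φ k) (u (φ k)) μ) ≤ C * (c - u (φ k)) := by
      unfold runCost
      refine (intervalIntegral.integral_mono_on hle
        (hcon.intervalIntegrable_running hM hle h0u h.le_T _) intervalIntegrable_const
        fun r hr => hC r ⟨h0u.trans hr.1, hr.2.trans h.le_T⟩ _).trans_eq ?_
      rw [intervalIntegral.integral_const, smul_eq_mul, mul_comm]
    have h3 := hcost (φ k)
    have h4 : κ * (u (φ k) - t₀) ≤ ε / 2 := by
      have : κ * (c - t₀) = ε / 2 := by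
        rw [hκ]
        field_simp
      rw [← this]
      gcongr
    linarith

/-- An almost optimal control on `[t₀, c]` that is chosen measurably from the state at time `t₀`: an
open-loop control that is almost optimal for one state is so for all nearby states, so that
countably many of them suffice. -/
theorem exists_policy (h : M.SolvesHJB a c W Wt D V) (hM : M.Regular) {t₀ : ℝ}
    (ht₀ : t₀ ∈ Ico a c) (hW : Continuous (W t₀)) {ε : ℝ} (hε : 0 < ε) :
    ∃ (A : ℝ → P d → E k₁) (Φ : ℝ → P d → P d), (Measurable fun q : ℝ × P d => A q.1 q.2) ∧
      (∀ t ∈ Icc t₀ c, Measurable (Φ t)) ∧ (∀ t ν, A t ν ∈ M.ctrl) ∧ ∀ ν, Φ t₀ ν = ν ∧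
        M.SolvesFP (fun t => A t ν) (fun t => Φ t ν) t₀ c ∧
          IntervalIntegrable (fun t => M.ℓ t (Φ t ν) (A t ν)) volume t₀ c ∧
            (∫ t in t₀..c, M.ℓ t (Φ t ν) (A t ν)) + V (Φ c ν) ≤ W t₀ ν + ε := by
  have h0t : 0 ≤ t₀ := h.nonneg.trans ht₀.1
  have hcover : ∀ ν, ∃ p : {p : (ℝ → E k₁) × (ℝ → P d → P d) // M.IsOpenLoop p.1 p.2 t₀ c},
      ν ∈ {ν | M.runCost p.1.1 p.1.2 t₀ c ν + V (p.1.2 c ν) < W t₀ ν + ε} := fun ν => by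
    obtain ⟨A, Φ, hol, hlt⟩ := h.exists_openLoop hM ht₀ ν hε
    exact ⟨⟨(A, Φ), hol⟩, hlt⟩
  have hopen : ∀ p : {p : (ℝ → E k₁) × (ℝ → P d → P d) // M.IsOpenLoop p.1 p.2 t₀ c},
      IsOpen {ν | M.runCost p.1.1 p.1.2 t₀ c ν + V (p.1.2 c ν) < W t₀ ν + ε} := fun p =>
    isOpen_lt ((p.2.continuous_runCost hM ht₀.2.le h0t h.le_T).add
      (h.continuous_limit.comp (p.2.continuous c (right_mem_Icc.2 ht₀.2.le))))
      (hW.add continuous_const)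
  obtain ⟨e, n, hn, hsel⟩ := exists_measurable_selection hopen hcover
  refine ⟨fun t ν => (e (n ν)).1.1 t, fun t ν => (e (n ν)).1.2 t ν, ?_, fun t ht => ?_,
    fun t ν => (e (n ν)).2.mem t, fun ν => ⟨(e (n ν)).2.init ν, (e (n ν)).2.solves ν,
      (e (n ν)).2.intervalIntegrable_running hM ht₀.2.le h0t h.le_T ν, (hsel ν).le⟩⟩
  · have h1 : Measurable fun z : ℕ × ℝ => (e z.1).1.1 z.2 :=
      measurable_from_prod_countable_right fun k => (e k).2.measurable
    exact h1.comp (f := fun q : ℝ × P d => (n q.2, q.1)) (by fun_prop)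
  · have h1 : Measurable fun z : ℕ × P d => (e z.1).1.2 t z.2 :=
      measurable_from_prod_countable_right fun k => ((e k).2.continuous t ht).measurable
    exact h1.comp (f := fun ν : P d => (n ν, ν)) (by fun_prop)

theorem exists_bound (h : M.SolvesHJB a c W Wt D V) (hM : M.Regular)
    (hV : ∃ C, ∀ μ, |V μ| ≤ C) : ∃ C, ∀ t ∈ Ico a c, ∀ μ, |W t μ| ≤ C := by
  obtain ⟨C, hC⟩ := hV
  obtain ⟨L, hL0, hL⟩ := hM.exists_running_lower
  obtain ⟨α, hα⟩ := hM.exists_ctrl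
  obtain ⟨F, hF0, hF, hFc⟩ := hM.exists_flow hα
  obtain ⟨C', hC'⟩ : ∃ C, ∀ t ∈ Icc 0 M.T, ∀ μ, M.ℓ t μ α ≤ C := by
    obtain ⟨v, hv, rfl⟩ := hα
    exact hM.ℓ_bddAbove v hv
  refine ⟨C + |C'| * (c - a) + L * (c - a) + 1, fun t ht μ => ?_⟩
  have h0t : 0 ≤ t := h.nonneg.trans ht.1
  have hL1 : L * (c - t) ≤ L * (c - a) := by
    gcongr
    exact ht.1
  have hac : 0 ≤ c - a := sub_nonneg.2 h.lt.le
  have hL2 : 0 ≤ |C'| * (c - a) := by positivity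
  have hL3 : 0 ≤ L * (c - a) := by positivity
  rw [abs_le]
  constructor
  · obtain ⟨A, Φ, hol, hlt⟩ := h.exists_openLoop hM ht μ one_pos
    have h1 : (c - t) * (-L) ≤ M.runCost A Φ t c μ := by
      unfold runCost
      rw [← smul_eq_mul, ← intervalIntegral.integral_const]
      exact intervalIntegral.integral_mono_on ht.2.le intervalIntegrable_const
        (hol.intervalIntegrable_running hM ht.2.le h0t h.le_T μ) fun r hr =>
          hL _ (hol.mem r) r ⟨h0t.trans hr.1, hr.2.trans h.le_T⟩ _
    have := (abs_le.1 (hC (Φ c μ))).1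
    nlinarith
  · have hcon := isOpenLoop_const hM hα hF0 hF hFc h0t h.le_T (t₁ := c)
    have hint := hcon.intervalIntegrable_running hM ht.2.le h0t h.le_T μ
    have h1 := h.le_cost hM ht.1 ht.2 (hcon.isTrajectory ht.2.le μ) hint
    have h2 : (∫ r in t..c, M.ℓ r (F (r - t) μ) α) ≤ (c - t) * |C'| := by
      rw [← smul_eq_mul, ← intervalIntegral.integral_const]
      exact intervalIntegral.integral_mono_on ht.2.le hint intervalIntegrable_const fun r hr =>
          (hC' r ⟨h0t.trans hr.1, hr.2.trans h.le_T⟩ _).trans (le_abs_self _)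
    simp only [sub_self, hF0] at h1
    have h3 := (abs_le.1 (hC (F (c - t) μ))).2
    have h4 : (c - t) * |C'| ≤ |C'| * (c - a) := by
      rw [mul_comm]
      gcongr
      exact ht.1
    linarith

end SolvesHJB

theorem Regular.abs_integral_posterior_le (hM : M.Regular) {i : ℕ} {w : P d → ℝ} {C : ℝ}
    (hC : ∀ μ, |w μ| ≤ C) (β : E k₂) (μ : P d) :
    |∫ ω, w (M.posterior i β μ ω) ∂M.prob| ≤ C := by
  have hp := hM.isProbabilityMeasure
  have := norm_integral_le_of_norm_le_const (μ := M.prob)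
    (f := fun ω => w (M.posterior i β μ ω)) (.of_forall fun ω => hC (M.posterior i β μ ω))
  simpa using this

/-! ### Values at the observation times -/

/-- The value just before the `i`-th observation, or just before the horizon if `i = n + 1`. -/
noncomputable def valueBefore (M : Model d k₁ k₂ Ω S O) (W : ℝ → P d → ℝ) (i : ℕ) (μ : P d) : ℝ :=
  if i = M.n + 1 then M.g μ else sInf (M.impFun W i μ '' M.U)

/-- The expected cost of the measurement control `β` at the `i`-th observation. -/
noncomputable def impCost (M : Model d k₁ k₂ Ω S O) (W : ℝ → P d → ℝ) (i : ℕ) (μ : P d)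
    (β : E k₂) : ℝ :=
  M.h (M.τ i) μ β + ∫ ω, W (M.τ i) (M.posterior i β μ ω) ∂M.prob

namespace IsHJBSolution

variable {W Wt : ℝ → P d → ℝ} {D : ℝ → P d → E d → ℝ}

theorem solvesHJB (hW : M.IsHJBSolution W Wt D) (hM : M.Regular) {i : ℕ} (hi : i ≤ M.n) :
    M.SolvesHJB (M.τ i) (M.τ (i + 1)) W Wt D (M.valueBefore W (i + 1)) where
  lt := hM.τ_lt i hi
  nonneg := hM.τ_nonneg (by omega)
  le_T := hM.τ_le_T (by omega)
  regular := hW.regular i hi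
  pde := hW.pde i hi
  limit μ := by
    unfold valueBefore
    split_ifs with h
    · rw [h]
      exact hW.terminal_limit μ
    · exact hW.impulse (i + 1) ⟨by omega, by omega⟩ μ

theorem continuous_valueBefore (hW : M.IsHJBSolution W Wt D) (hM : M.Regular) {i : ℕ}
    (hi : i ∈ Icc 1 (M.n + 1)) : Continuous (M.valueBefore W i) := by
  obtain ⟨j, rfl⟩ : ∃ j, i = j + 1 := ⟨i - 1, by have := hi.1; omega⟩
  exact (hW.solvesHJB hM (by have := hi.2; omega)).continuous_limit

theorem continuous_space (hW : M.IsHJBSolution W Wt D) {i : ℕ} (hi : i ≤ M.n)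
    {t : ℝ} (ht : t ∈ Ico (M.τ i) (M.τ (i + 1))) : Continuous (W t) :=
  (hW.regular i hi).continuous_space ht

/-- Backward induction over the observation times: all values are bounded. -/
theorem exists_bound_valueBefore (hW : M.IsHJBSolution W Wt D) (hM : M.Regular) {i : ℕ}
    (hi : i ∈ Icc 1 (M.n + 1)) : ∃ C, ∀ μ, |M.valueBefore W i μ| ≤ C := by
  obtain ⟨h1, h2⟩ := hi
  induction h2 using Nat.decreasingInduction with
  | self =>
    simp only [valueBefore, if_true]
    exact hM.g_bounded
  | of_succ i hi ih =>
    have hn : i ≤ M.n := by omega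
    obtain ⟨C, hC⟩ := (hW.solvesHJB hM hn).exists_bound hM (ih (by omega))
    have hC' := hC (M.τ i) ⟨le_rfl, hM.τ_lt i hn⟩
    obtain ⟨Ch, hCh⟩ := hM.h_bddBelow
    obtain ⟨u, hu⟩ := hM.U_nonempty
    obtain ⟨Cu, hCu⟩ := hM.h_bddAbove u hu
    have hint := fun β μ => hM.abs_integral_posterior_le (i := i) hC' β μ
    have hlow : ∀ μ, ∀ y ∈ M.impFun W i μ '' M.U, Ch - C ≤ y := by
      rintro μ _ ⟨v, hv, rfl⟩
      unfold impFun
      linarith [hCh v hv i ⟨h1, hn⟩ μ, (abs_le.1 (hint v.2 μ)).1]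
    refine ⟨|Ch| + |Cu| + C, fun μ => ?_⟩
    have e : M.valueBefore W i μ = sInf (M.impFun W i μ '' M.U) := if_neg (by omega)
    rw [e, abs_le]
    constructor
    · refine le_trans ?_ (le_csInf (hM.U_nonempty.image _) (hlow μ))
      linarith [neg_abs_le Ch, abs_nonneg Cu]
    · refine (csInf_le ⟨_, hlow μ⟩ ⟨u, hu, rfl⟩).trans ?_
      unfold impFun
      linarith [hCu i ⟨h1, hn⟩ μ, (abs_le.1 (hint u.2 μ)).2, le_abs_self Cu, abs_nonneg Ch]

theorem exists_bound (hW : M.IsHJBSolution W Wt D) (hM : M.Regular) {i : ℕ} (hi : i ≤ M.n) :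
    ∃ C, ∀ t ∈ Ico (M.τ i) (M.τ (i + 1)), ∀ μ, |W t μ| ≤ C :=
  (hW.solvesHJB hM hi).exists_bound hM (hW.exists_bound_valueBefore hM ⟨by omega, by omega⟩)

/-- Every measurement control costs at least the value before the observation. -/
theorem valueBefore_le (hW : M.IsHJBSolution W Wt D) (hM : M.Regular) {i : ℕ} (hi : i ∈ Icc 1 M.n)
    {u : E k₁ × E k₂} (hu : u ∈ M.U) (μ : P d) : M.valueBefore W i μ ≤ M.impCost W i μ u.2 := by
  have hi2 := hi.2
  obtain ⟨C, hC⟩ := hW.exists_bound hM hi2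
  obtain ⟨Ch, hCh⟩ := hM.h_bddBelow
  have e : M.valueBefore W i μ = sInf (M.impFun W i μ '' M.U) := if_neg (by omega)
  rw [e]
  refine csInf_le ⟨Ch - C, ?_⟩ ⟨u, hu, rfl⟩
  rintro _ ⟨v, hv, rfl⟩
  unfold impFun
  have := hM.abs_integral_posterior_le (i := i) (hC (M.τ i) ⟨le_rfl, hM.τ_lt i hi2⟩) v.2 μ
  linarith [hCh v hv i hi μ, (abs_le.1 this).1]

theorem continuous_impCost (hW : M.IsHJBSolution W Wt D) (hM : M.Regular) {i : ℕ}
    (hi : i ∈ Icc 1 M.n) {u : E k₁ × E k₂} (hu : u ∈ M.U) :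
    Continuous fun μ => M.impCost W i μ u.2 := by
  have hin : M.τ i ∈ Ico (M.τ i) (M.τ (i + 1)) := ⟨le_rfl, hM.τ_lt i hi.2⟩
  obtain ⟨C, hC⟩ := hW.exists_bound hM hi.2
  have hc := hW.continuous_space hi.2 hin
  exact (hM.h_continuous u hu i hi).add (hM.posterior_continuous u hu i hi
    (BoundedContinuousFunction.ofNormedAddCommGroup (W (M.τ i)) hc C (hC _ hin)))

/-- An almost optimal measurement control chosen measurably from the law before the observation. -/
theorem exists_measurement (hW : M.IsHJBSolution W Wt D) (hM : M.Regular) {i : ℕ}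
    (hi : i ∈ Icc 1 M.n) {ε : ℝ} (hε : 0 < ε) :
    ∃ B : P d → E k₂, Measurable B ∧ (∀ μ, ∃ u ∈ M.U, u.2 = B μ) ∧
      ∀ μ, M.impCost W i μ (B μ) ≤ M.valueBefore W i μ + ε := by
  have hi2 := hi.2
  have hcover : ∀ μ, ∃ u : M.U, μ ∈ {μ | M.impCost W i μ u.1.2 < M.valueBefore W i μ + ε} := by
    intro μ
    have e : M.valueBefore W i μ = sInf (M.impFun W i μ '' M.U) := if_neg (by omega)
    obtain ⟨_, ⟨u, hu, rfl⟩, hlt⟩ := exists_lt_of_csInf_lt (hM.U_nonempty.image (M.impFun W i μ))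
      (lt_add_of_pos_right (sInf (M.impFun W i μ '' M.U)) hε)
    refine ⟨⟨u, hu⟩, ?_⟩
    rw [mem_ofPred_eq, e]
    exact hlt
  have hopen : ∀ u : M.U, IsOpen {μ | M.impCost W i μ u.1.2 < M.valueBefore W i μ + ε} := fun u =>
    isOpen_lt (hW.continuous_impCost hM hi u.2)
      ((hW.continuous_valueBefore hM ⟨hi.1, by omega⟩).add continuous_const)
  obtain ⟨e, n, hn, hsel⟩ := exists_measurable_selection hopen hcover
  refine ⟨fun μ => (e (n μ)).1.2, ?_, fun μ => ⟨_, (e (n μ)).2, rfl⟩, fun μ => (hsel μ).le⟩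
  exact (measurable_of_countable fun k => (e k).1.2).comp hn

end IsHJBSolution

end Model
end NoisyObs

/-! ### Bayes updates and the observation filtration -/

namespace NoisyObs
namespace Model

variable {d k₁ k₂ : ℕ} {Ω S O : Type*} [MeasurableSpace Ω] [MeasurableSpace S] [MeasurableSpace O]
variable {M : Model d k₁ k₂ Ω S O}

theorem Regular.measurable_bayes (hM : M.Regular) :
    Measurable fun z : E k₂ × P d × O => M.bayes z.1 z.2.1 z.2.2 := by
  let κ : Kernel (E k₂ × P d × O) (E d) :=
    ⟨fun z => (z.2.1 : Measure (E d)), measurable_subtype_coe.comp (by fun_prop)⟩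
  have hκ : IsMarkovKernel κ := ⟨fun z => z.2.1.2⟩
  have hK : Measurable (Function.uncurry fun (z : E k₂ × P d × O) (x : E d) =>
      M.K z.1 z.2.1 z.2.2 x) :=
    hM.K_measurable.comp (f := fun q : (E k₂ × P d × O) × E d => (q.1.1, q.1.2.1, q.1.2.2, q.2))
      (by fun_prop)
  have hset : ∀ s, MeasurableSet s → Measurable fun z : E k₂ × P d × O =>
      ∫⁻ x in s, M.K z.1 z.2.1 z.2.2 x ∂(z.2.1 : Measure (E d)) := fun s hs =>
    hK.setLIntegral_kernel_prod_right (κ := κ) hs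
  have h1 : MeasurableSet {z : E k₂ × P d × O |
      ∫⁻ x, M.K z.1 z.2.1 z.2.2 x ∂(z.2.1 : Measure (E d)) = 1} := by
    have := hset univ .univ
    simp only [Measure.restrict_univ] at this
    exact this (measurableSet_singleton 1)
  have hcoe : Measurable fun z : E k₂ × P d × O =>
      (M.bayes z.1 z.2.1 z.2.2 : Measure (E d)) := by
    classical
    have e : (fun z : E k₂ × P d × O => (M.bayes z.1 z.2.1 z.2.2 : Measure (E d))) = fun z =>
        if ∫⁻ x, M.K z.1 z.2.1 z.2.2 x ∂(z.2.1 : Measure (E d)) = 1 then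
          (z.2.1 : Measure (E d)).withDensity (M.K z.1 z.2.1 z.2.2)
        else (z.2.1 : Measure (E d)) := by
      funext z
      have hiff : IsProbabilityMeasure ((z.2.1 : Measure (E d)).withDensity (M.K z.1 z.2.1 z.2.2)) ↔
          ∫⁻ x, M.K z.1 z.2.1 z.2.2 x ∂(z.2.1 : Measure (E d)) = 1 := by
        rw [isProbabilityMeasure_iff, withDensity_apply _ .univ, Measure.restrict_univ]
      by_cases h : IsProbabilityMeasure
        ((z.2.1 : Measure (E d)).withDensity (M.K z.1 z.2.1 z.2.2))
      · have hb : M.bayes z.1 z.2.1 z.2.2 = ⟨_, h⟩ := dif_pos h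
        rw [if_pos (hiff.1 h), hb]
        rfl
      · have hb : M.bayes z.1 z.2.1 z.2.2 = z.2.1 := dif_neg h
        rw [if_neg (fun h' => h (hiff.2 h')), hb]
    rw [e]
    refine Measurable.ite h1 (Measure.measurable_of_measurable_coe _ fun s hs => ?_)
      (measurable_subtype_coe.comp (by fun_prop))
    simp only [withDensity_apply _ hs]
    exact hset s hs
  exact fun s ⟨t, ht, hs⟩ => hs ▸ hcoe ht

theorem Regular.measurable_update (hM : M.Regular) (i : ℕ) :
    Measurable fun z : (E k₂ × P d) × S => M.bayes z.1.1 z.1.2 (M.obs i z.1.1 z.1.2 z.2) :=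
  hM.measurable_bayes.comp (f := fun z : (E k₂ × P d) × S =>
      (z.1.1, z.1.2, M.obs i z.1.1 z.1.2 z.2))
    (.prodMk (by fun_prop) (.prodMk (by fun_prop) ((hM.obs_measurable i).comp
      (f := fun z : (E k₂ × P d) × S => (z.1.1, z.1.2, z.2)) (by fun_prop))))

theorem Regular.lt_of_τ_lt (hM : M.Regular) {i j : ℕ} (hi : i ≤ M.n + 1) (h : M.τ i < M.τ j) :
    i < j := by
  by_contra! hji
  exact (hM.τ_mono hji hi).not_gt h

theorem Regular.τ_strictMono (hM : M.Regular) {i j : ℕ} (hij : i < j) (hj : j ≤ M.n + 1) :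
    M.τ i < M.τ j :=
  (hM.τ_lt i (by omega)).trans_le (hM.τ_mono hij hj)

/-- The σ-algebra generated by the noises before the `i`-th one. -/
@[reducible] def noise (M : Model d k₁ k₂ Ω S O) (i : ℕ) : MeasurableSpace Ω :=
  ⨆ j ∈ Iio i, MeasurableSpace.comap (M.Γ j) inferInstance

theorem noise_mono {i j : ℕ} (hij : i ≤ j) : M.noise i ≤ M.noise j :=
  biSup_mono fun _ hk => lt_of_lt_of_le hk hij

theorem Regular.noise_le (hM : M.Regular) (i : ℕ) : M.noise i ≤ ‹MeasurableSpace Ω› :=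
  iSup₂_le fun j _ => (hM.Γ_measurable j).comap_le

theorem integral_comp_indep {Z R : Type*} [MeasurableSpace Z] [MeasurableSpace R] {μ : Measure Ω}
    [IsProbabilityMeasure μ] {f : Ω → Z} {g : Ω → R} (hf : Measurable f) (hg : Measurable g)
    (hind : IndepFun f g μ) {F : Z × R → ℝ} (hF : Measurable F) {C : ℝ} (hC : ∀ z, |F z| ≤ C) :
    Measurable (fun ω => ∫ ω', F (f ω, g ω') ∂μ) ∧
      ∫ ω, F (f ω, g ω) ∂μ = ∫ ω, ∫ ω', F (f ω, g ω') ∂μ ∂μ := by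
  have h1 : IsProbabilityMeasure (μ.map f) := Measure.isProbabilityMeasure_map hf.aemeasurable
  have h2 : IsProbabilityMeasure (μ.map g) := Measure.isProbabilityMeasure_map hg.aemeasurable
  have hinner : ∀ z, ∫ ω', F (z, g ω') ∂μ = ∫ r, F (z, r) ∂(μ.map g) := fun z =>
    (integral_map hg.aemeasurable
      (hF.comp (measurable_prodMk_left (x := z))).aestronglyMeasurable).symm
  have hmeas : Measurable fun z => ∫ r, F (z, r) ∂(μ.map g) :=
    hF.stronglyMeasurable.integral_prod_right'.measurable
  simp only [hinner]
  refine ⟨hmeas.comp hf, ?_⟩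
  rw [← integral_map (φ := fun ω => (f ω, g ω)) (hf.prodMk hg).aemeasurable hF.aestronglyMeasurable,
    (indepFun_iff_map_prod_eq_prod_map_map hf.aemeasurable hg.aemeasurable).1 hind,
    integral_prod _ (.of_bound hF.aestronglyMeasurable C (.of_forall fun z => hC z)),
    integral_map hf.aemeasurable hmeas.aestronglyMeasurable]

namespace IsAdmissible

variable {s : ℝ} {μ₀ : P d} {X : Path d k₁ k₂ Ω}

theorem max_lt (hM : M.Regular) {i : ℕ} (hi : i ≤ M.n) (hs : s < M.τ (i + 1)) :
    max s (M.τ i) < M.τ (i + 1) :=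
  _root_.max_lt hs (hM.τ_lt i hi)

theorem tendsto_pre (hX : M.IsAdmissible s μ₀ X) (hM : M.Regular) {i : ℕ} (hi : i ≤ M.n)
    (hs : s < M.τ (i + 1)) (ω : Ω) :
    Tendsto (fun t => X.μ t ω) (𝓝[<] (M.τ (i + 1))) (𝓝 (X.pre (i + 1) ω)) := by
  have hlt := max_lt hM hi hs
  have h1 := (hX.fokkerPlanck ω i hi hs).1 _ (right_mem_Icc.2 hlt.le)
  have h2 := h1.mono Ico_subset_Icc_self
  rw [ContinuousWithinAt, nhdsWithin_Ico_eq_nhdsLT hlt, Function.update_self] at h2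
  refine h2.congr' ?_
  filter_upwards [self_mem_nhdsWithin] with t ht
  rw [Function.update_of_ne (ne_of_lt ht)]

theorem measurable_pre (hX : M.IsAdmissible s μ₀ X) (hM : M.Regular) {i : ℕ} (hi : i ≤ M.n)
    (hs : s < M.τ (i + 1)) : Measurable[M.sigmaPre X s (M.τ (i + 1))] (X.pre (i + 1)) := by
  have hlt := max_lt hM hi hs
  obtain ⟨u, -, hu, hut⟩ := exists_seq_strictMono_tendsto' hlt
  refine @measurable_of_tendsto_metrizable Ω (P d) (M.sigmaPre X s (M.τ (i + 1))) _ _ _ _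
    (fun k => X.μ (u k)) _ (fun k => ?_) ?_
  · have h1 := hX.μ_adapted (u k) ⟨(le_max_left _ _).trans (hu k).1.le,
      (hu k).2.le.trans (hM.τ_le_T (by omega))⟩
    refine h1.mono (biSup_mono ?_) le_rfl
    exact fun j hj => ⟨hj.1, hj.2.1, hj.2.2.trans_lt (hu k).2⟩
  · rw [tendsto_pi_nhds]
    intro ω
    exact (hX.tendsto_pre hM hi hs ω).comp
      (tendsto_nhdsWithin_iff.2 ⟨hut, .of_forall fun k => (hu k).2⟩)

/-- The observations before `τ i` are functions of the noises before the `i`-th one. -/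
theorem sigmaPre_le (hX : M.IsAdmissible s μ₀ X) (hM : M.Regular) {i : ℕ} (hi : i ≤ M.n + 1) :
    M.sigmaPre X s (M.τ i) ≤ M.noise i := by
  induction i using Nat.strong_induction_on with
  | _ i ih =>
    refine iSup₂_le fun j hj => ?_
    obtain ⟨hj1, hjs, hji⟩ := hj
    have hlt := hM.lt_of_τ_lt (hj1.2.trans (Nat.le_succ _)) hji
    have ih' := (ih j hlt (by omega)).trans (noise_mono hlt.le)
    obtain ⟨k, rfl⟩ : ∃ k, j = k + 1 := ⟨j - 1, by have := hj1.1; omega⟩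
    have hk : k + 1 ≤ M.n := hj1.2
    have hβ : Measurable[M.noise i] (X.β (k + 1)) :=
      (hX.β_pred _ ⟨hj1.1, by omega⟩).mono ih' le_rfl
    have hp : Measurable[M.noise i] (X.pre (k + 1)) :=
      (hX.measurable_pre hM (by omega) hjs).mono ih' le_rfl
    have hΓ : Measurable[M.noise i] (M.Γ (k + 1)) := by
      have : MeasurableSpace.comap (M.Γ (k + 1)) inferInstance ≤ M.noise i :=
        le_iSup₂_of_le (k + 1) hlt le_rfl
      exact Measurable.mono (comap_measurable _) this le_rfl
    have hY : Measurable[M.noise i] (M.Y X (k + 1)) := by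
      have h1 := hM.obs_measurable (k + 1)
      exact h1.comp (hβ.prodMk (hp.prodMk hΓ))
    exact hY.comap_le

theorem measurable_β (hX : M.IsAdmissible s μ₀ X) (hM : M.Regular) {i : ℕ} (hi : i ≤ M.n) :
    Measurable[M.noise (i + 1)] (X.β (i + 1)) :=
  (hX.β_pred _ ⟨by omega, by omega⟩).mono (hX.sigmaPre_le hM (by omega)) le_rfl

theorem sigma_le (hX : M.IsAdmissible s μ₀ X) (hM : M.Regular) (t : ℝ) :
    M.sigma X s t ≤ ‹MeasurableSpace Ω› := by
  refine le_trans ?_ ((hX.sigmaPre_le hM le_rfl).trans (hM.noise_le _))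
  refine biSup_mono fun j hj => ⟨hj.1, hj.2.1, ?_⟩
  exact hM.τ_strictMono (by have := hj.1.2; omega) le_rfl

theorem measurable_μ (hX : M.IsAdmissible s μ₀ X) (hM : M.Regular) {t : ℝ} (ht : t ∈ Icc s M.T) :
    Measurable (X.μ t) :=
  (hX.μ_adapted t ht).mono (hX.sigma_le hM _) le_rfl

/-- The state before an observation is a function of the earlier noises. -/
theorem measurable_pre_noise (hX : M.IsAdmissible s μ₀ X) (hM : M.Regular) {i : ℕ} (hi : i ≤ M.n)
    (hs : s < M.τ (i + 1)) : Measurable[M.noise (i + 1)] (X.pre (i + 1)) :=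
  (hX.measurable_pre hM hi hs).mono (hX.sigmaPre_le hM (by omega)) le_rfl

theorem measurable_α (hX : M.IsAdmissible s μ₀ X) (hM : M.Regular) (hs : s ≤ M.T) :
    Measurable fun q : Icc s M.T × Ω => X.α q.1 q.2 := by
  refine (hX.α_prog M.T ⟨hs, le_rfl⟩).mono ?_ le_rfl
  exact sup_le_sup le_rfl (MeasurableSpace.comap_mono (hX.sigma_le hM _))

/-- Just before an observation the measurement control is the one with the index of that
observation. -/
theorem lastBefore_eq (hM : M.Regular) {i : ℕ} (hi : i ≤ M.n) {t : ℝ} (h1 : M.τ i < t)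
    (h2 : t ≤ M.τ (i + 1)) : M.lastBefore t = i := by
  classical
  unfold lastBefore
  refine le_antisymm ?_ (Nat.le_findGreatest hi h1)
  by_contra! hlt
  have h3 := Nat.findGreatest_of_ne_zero (m := Nat.findGreatest (fun i => M.τ i < t) M.n) rfl
    (by omega)
  have h4 : Nat.findGreatest (fun i => M.τ i < t) M.n ≤ M.n := Nat.findGreatest_le _
  have := hM.lt_of_τ_lt (by omega) (h3.trans_le h2)
  omega

theorem exists_mem_β (hX : M.IsAdmissible s μ₀ X) (hM : M.Regular) {i : ℕ} (hi : i ≤ M.n)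
    (hs : s < M.τ (i + 1)) (ω : Ω) : ∃ u ∈ M.U, u.2 = X.β (i + 1) ω := by
  have h := hX.mem_U ω (M.τ (i + 1)) ⟨hs.le, hM.τ_le_T (by omega)⟩
  rw [lastBefore_eq hM hi (hM.τ_lt i hi) le_rfl] at h
  exact ⟨_, h, rfl⟩

/-- The `i`-th noise is independent of the measurement control and the state before the `i`-th
observation, so the mean of a function of the updated state is obtained by averaging over
the noise first. -/
theorem integral_update (hX : M.IsAdmissible s μ₀ X) (hM : M.Regular) {i : ℕ} (hi : i + 1 ≤ M.n)
    (hs : s < M.τ (i + 1)) {w : P d → ℝ} (hw : Measurable w) {C : ℝ} (hC : ∀ μ, |w μ| ≤ C) :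
    Measurable (fun ω =>
      ∫ ω', w (M.posterior (i + 1) (X.β (i + 1) ω) (X.pre (i + 1) ω) ω') ∂M.prob) ∧
    ∫ ω, w (X.μ (M.τ (i + 1)) ω) ∂M.prob =
      ∫ ω, ∫ ω', w (M.posterior (i + 1) (X.β (i + 1) ω) (X.pre (i + 1) ω) ω') ∂M.prob ∂M.prob := by
  have hp := hM.isProbabilityMeasure
  have hβ := hX.measurable_β hM (i := i) (by omega)
  have hpre := hX.measurable_pre_noise hM (by omega) hs
  have hZ : Measurable[M.noise (i + 1)] fun ω => (X.β (i + 1) ω, X.pre (i + 1) ω) := hβ.prodMk hpre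
  have hF : Measurable fun z : (E k₂ × P d) × S =>
      w (M.bayes z.1.1 z.1.2 (M.obs (i + 1) z.1.1 z.1.2 z.2)) :=
    hw.comp (hM.measurable_update (i + 1))
  have hind : IndepFun (fun ω => (X.β (i + 1) ω, X.pre (i + 1) ω)) (M.Γ (i + 1)) M.prob := by
    have h1 := indep_iSup_of_disjoint (S := Iio (i + 1)) (T := {i + 1})
      (fun j => (hM.Γ_measurable j).comap_le) hM.Γ_indep.iIndep (by simp)
    rw [IndepFun_iff_Indep]
    refine indep_of_indep_of_le_right (indep_of_indep_of_le_left h1 hZ.comap_le) ?_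
    exact le_iSup₂_of_le (i + 1) rfl le_rfl
  have hup : ∀ ω, X.μ (M.τ (i + 1)) ω = M.bayes (X.β (i + 1) ω) (X.pre (i + 1) ω)
      (M.obs (i + 1) (X.β (i + 1) ω) (X.pre (i + 1) ω) (M.Γ (i + 1) ω)) := fun ω =>
    hX.update ω (i + 1) ⟨by omega, hi⟩ hs
  simp only [hup]
  exact integral_comp_indep (hZ.mono (hM.noise_le _) le_rfl) (hM.Γ_measurable (i + 1)) hind hF
    fun z => hC _

end IsAdmissible

end Model
end NoisyObs

/-! ### Costs of admissible controls -/

namespace NoisyObs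
namespace Model

variable {d k₁ k₂ : ℕ} {Ω S O : Type*} [MeasurableSpace Ω] [MeasurableSpace S] [MeasurableSpace O]
variable {M : Model d k₁ k₂ Ω S O}

/-- The intervals between observations cover `[0, T)`. -/
theorem Regular.exists_index (hM : M.Regular) {t : ℝ} (ht : t ∈ Ico 0 M.T) :
    ∃ i ≤ M.n, t ∈ Ico (M.τ i) (M.τ (i + 1)) := by
  classical
  have hex : ∃ j, t < M.τ j := ⟨M.n + 1, ht.2⟩
  have h1 := Nat.find_spec hex
  have h2 : Nat.find hex ≤ M.n + 1 := Nat.find_min' hex ht.2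
  have h3 : Nat.find hex ≠ 0 := fun h0 => by
    rw [h0, hM.τ_zero] at h1
    exact h1.not_ge ht.1
  obtain ⟨i, hi⟩ := Nat.exists_eq_succ_of_ne_zero h3
  rw [hi] at h1 h2
  exact ⟨i, by omega, not_lt.1 (Nat.find_min hex (by omega)), h1⟩

theorem IsHJBSolution.continuous_and_bounded {W Wt : ℝ → P d → ℝ} {D : ℝ → P d → E d → ℝ}
    (hW : M.IsHJBSolution W Wt D) (hM : M.Regular) {t : ℝ} (ht : t ∈ Ico 0 M.T) :
    Continuous (W t) ∧ ∃ C, ∀ μ, |W t μ| ≤ C := by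
  obtain ⟨i, hi, hti⟩ := hM.exists_index ht
  obtain ⟨C, hC⟩ := hW.exists_bound hM hi
  exact ⟨hW.continuous_space hi hti, C, hC t hti⟩

/-- The running cost along a path. -/
def running (M : Model d k₁ k₂ Ω S O) (X : Path d k₁ k₂ Ω) (t : ℝ) (ω : Ω) : ℝ :=
  M.ℓ t (X.μ t ω) (X.α t ω)

/-- The value at the beginning of the part in `[s, T]` of the `i`-th interval. -/
def valueAtStart (M : Model d k₁ k₂ Ω S O) (W : ℝ → P d → ℝ) (s : ℝ) (X : Path d k₁ k₂ Ω) (i : ℕ)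
    (ω : Ω) : ℝ :=
  W (max s (M.τ i)) (X.μ (max s (M.τ i)) ω)

/-- The value at the end of the part in `[s, T]` of the `(i - 1)`-st interval, before the
observation. If this part is empty, the value is the initial one. -/
noncomputable def valueAtEnd (M : Model d k₁ k₂ Ω S O) (W : ℝ → P d → ℝ) (s : ℝ) (μ₀ : P d)
    (X : Path d k₁ k₂ Ω) (i : ℕ) (ω : Ω) : ℝ :=
  if s < M.τ i then M.valueBefore W i (X.pre i ω) else W s μ₀

/-- The cost of the `i`-th measurement. -/
noncomputable def measurementCost (M : Model d k₁ k₂ Ω S O) (s : ℝ) (X : Path d k₁ k₂ Ω) (i : ℕ)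
    (ω : Ω) : ℝ :=
  if s < M.τ i then M.h (M.τ i) (X.pre i ω) (X.β i ω) else 0

namespace IsAdmissible

variable {s : ℝ} {μ₀ : P d} {X : Path d k₁ k₂ Ω}

/-- The state on the part in `[s, T]` of an interval between observations, closed up by its left
limit. -/
theorem isTrajectory (hX : M.IsAdmissible s μ₀ X) (hM : M.Regular) {i : ℕ} (hi : i ≤ M.n)
    (hs : s < M.τ (i + 1)) (ω : Ω) : M.IsTrajectory (fun t => X.α t ω)
      (Function.update (fun t => X.μ t ω) (M.τ (i + 1)) (X.pre (i + 1) ω))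
      (max s (M.τ i)) (M.τ (i + 1)) := by
  have hT : M.τ (i + 1) ≤ M.T := hM.τ_le_T (by omega)
  have hsub : Icc (max s (M.τ i)) (M.τ (i + 1)) ⊆ Icc s M.T :=
    Icc_subset_Icc (le_max_left _ _) hT
  refine ⟨(max_lt hM hi hs).le, hX.fokkerPlanck ω i hi hs, ?_, fun r hr =>
    ⟨_, hX.mem_U ω r (hsub hr), rfl⟩⟩
  exact (hX.measurable_α hM (hs.le.trans hT)).comp
    ((measurable_inclusion hsub).prodMk measurable_const)

theorem continuousOn_μ (hX : M.IsAdmissible s μ₀ X) {i : ℕ} (hi : i ≤ M.n)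
    (hs : s < M.τ (i + 1)) (ω : Ω) :
    ContinuousOn (fun t => X.μ t ω) (Ico (max s (M.τ i)) (M.τ (i + 1))) := by
  refine ((hX.fokkerPlanck ω i hi hs).1.mono Ico_subset_Icc_self).congr fun t ht => ?_
  rw [Function.update_of_ne ht.2.ne]

/-- Between observations the state is continuous in time and measurable in `ω`, hence jointly
measurable. -/
theorem aestronglyMeasurable_running (hX : M.IsAdmissible s μ₀ X) (hM : M.Regular) (hs0 : 0 ≤ s) :
    AEStronglyMeasurable (fun q : ℝ × Ω => M.running X q.1 q.2)
      ((volume.restrict (Icc s M.T)).prod M.prob) := by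
  have hp := hM.isProbabilityMeasure
  rw [← restrict_Ico_eq_restrict_Icc, Measure.restrict_prod_eq_prod_univ]
  have hcover : Ico s M.T ×ˢ univ ⊆
      ⋃ i : {i : ℕ // i ≤ M.n ∧ s < M.τ (i + 1)},
        (Ico (max s (M.τ i)) (M.τ (i + 1)) ×ˢ univ : Set (ℝ × Ω)) := by
    rintro ⟨t, ω⟩ ⟨ht, -⟩
    obtain ⟨i, hi, hti⟩ := hM.exists_index ⟨hs0.trans ht.1, ht.2⟩
    exact mem_iUnion.2 ⟨⟨i, hi, ht.1.trans_lt hti.2⟩, ⟨max_le ht.1 hti.1, hti.2⟩, mem_univ _⟩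
  refine AEStronglyMeasurable.mono_set hcover ?_
  rw [aestronglyMeasurable_iUnion_iff]
  rintro ⟨i, hi, hs⟩
  have hT : M.τ (i + 1) ≤ M.T := hM.τ_le_T (by omega)
  have hsub : Ico (max s (M.τ i)) (M.τ (i + 1)) ⊆ Icc s M.T := fun r hr =>
    ⟨(le_max_left _ _).trans hr.1, hr.2.le.trans hT⟩
  have h1 : Measurable (Function.uncurry
      fun (r : Ico (max s (M.τ i)) (M.τ (i + 1))) ω => X.μ r ω) :=
    measurable_uncurry_of_continuous_of_measurable
      (fun ω => continuousOn_iff_continuous_domRestrict.1 (hX.continuousOn_μ hi hs ω))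
      fun r => hX.measurable_μ hM (hsub r.2)
  have h2 : Measurable fun q : Ico (max s (M.τ i)) (M.τ (i + 1)) × Ω => X.α q.1 q.2 :=
    (hX.measurable_α hM (hs.le.trans hT)).comp
      (((measurable_inclusion hsub).comp measurable_fst).prodMk measurable_snd)
  have h3 : Measurable fun q : Ico (max s (M.τ i)) (M.τ (i + 1)) × Ω => M.running X q.1 q.2 :=
    hM.ℓ_measurable.comp
      ((measurable_subtype_coe.comp measurable_fst).prodMk (h1.prodMk h2))
  refine (aemeasurable_restrict_of_measurable_subtype (measurableSet_Ico.prod .univ)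
    ?_).aestronglyMeasurable
  exact h3.comp (f := fun z : (Ico (max s (M.τ i)) (M.τ (i + 1)) ×ˢ univ : Set (ℝ × Ω)) =>
    ((⟨z.1.1, z.2.1⟩ : Ico (max s (M.τ i)) (M.τ (i + 1))), z.1.2))
    ((measurable_fst.comp measurable_subtype_coe).subtype_mk.prodMk
      (measurable_snd.comp measurable_subtype_coe))

variable {W Wt : ℝ → P d → ℝ} {D : ℝ → P d → E d → ℝ}

theorem update_apply_start (hM : M.Regular) {i : ℕ} (hi : i ≤ M.n)
    (hs : s < M.τ (i + 1)) (ω : Ω) :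
    Function.update (fun t => X.μ t ω) (M.τ (i + 1)) (X.pre (i + 1) ω) (max s (M.τ i)) =
      X.μ (max s (M.τ i)) ω :=
  Function.update_of_ne (max_lt hM hi hs).ne _ _

theorem running_update (hM : M.Regular) {i : ℕ} (hi : i ≤ M.n)
    (hs : s < M.τ (i + 1)) (ω : Ω) :
    (fun t => M.ℓ t (Function.update (fun t => X.μ t ω) (M.τ (i + 1)) (X.pre (i + 1) ω) t)
      (X.α t ω)) =ᵐ[volume.restrict (uIoc (max s (M.τ i)) (M.τ (i + 1)))]
        fun t => M.running X t ω := by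
  rw [uIoc_of_le (max_lt hM hi hs).le, ← restrict_Ioo_eq_restrict_Ioc]
  refine (ae_restrict_iff' measurableSet_Ioo).2 (.of_forall fun t ht => ?_)
  beta_reduce
  rw [Function.update_of_ne ht.2.ne]
  rfl

/-- The pathwise form of verification between two observations. -/
theorem valueAtStart_le (hX : M.IsAdmissible s μ₀ X) (hM : M.Regular) (hW : M.IsHJBSolution W Wt D)
    {i : ℕ} (hi : i ≤ M.n) {ω : Ω}
    (hint : IntegrableOn (fun t => M.running X t ω) (Icc s M.T)) :
    M.valueAtStart W s X i ω ≤
      (∫ t in max s (M.τ i)..max s (M.τ (i + 1)), M.running X t ω) +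
        M.valueAtEnd W s μ₀ X (i + 1) ω := by
  unfold valueAtEnd
  split_ifs with hs
  · have hlt := max_lt hM hi hs
    have hint' : IntervalIntegrable (fun t => M.running X t ω) volume
        (max s (M.τ i)) (M.τ (i + 1)) := by
      refine (hint.mono_set ?_).intervalIntegrable
      rw [uIcc_of_le hlt.le]
      exact Icc_subset_Icc (le_max_left _ _) (hM.τ_le_T (by omega))
    have hae := running_update (X := X) hM hi hs ω
    have h1 := (hW.solvesHJB hM hi).le_cost hM (le_max_right _ _) hlt (hX.isTrajectory hM hi hs ω)
      (hint'.congr_ae hae.symm)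
    rw [update_apply_start hM hi hs, Function.update_self,
      intervalIntegral.integral_congr_ae_restrict hae] at h1
    rw [max_eq_right hs.le]
    exact h1
  · have hs' := not_lt.1 hs
    have hs'' : M.τ i ≤ s := (hM.τ_lt i hi).le.trans hs'
    unfold valueAtStart
    rw [max_eq_left hs', max_eq_left hs'', intervalIntegral.integral_same, hX.init ω, zero_add]

/-- The pathwise form of verification between two observations, for feedback controls. -/
theorem eq_running_of_feedback (hX : M.IsAdmissible s μ₀ X) (hM : M.Regular) (hs0 : 0 ≤ s)
    (hW : M.IsHJBSolution W Wt D) {v : ℝ → P d → E k₁ × E k₂} (hv : M.IsSelector W D v)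
    (hF : M.IsFeedback s v X) {i : ℕ} (hi : i ≤ M.n) (hs : s < M.τ (i + 1)) (ω : Ω) :
    IntervalIntegrable (fun t => M.running X t ω) volume (max s (M.τ i)) (M.τ (i + 1)) ∧
      (∫ t in max s (M.τ i)..M.τ (i + 1), M.running X t ω) +
        M.valueBefore W (i + 1) (X.pre (i + 1) ω) = M.valueAtStart W s X i ω := by
  have hlt := max_lt hM hi hs
  have hT : M.τ (i + 1) ≤ M.T := hM.τ_le_T (by omega)
  have h1 := (hW.solvesHJB hM hi).eq_cost hM (le_max_right _ _) hlt (hX.isTrajectory hM hi hs ω)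
    fun t ht => by
      have hti : t ∈ Ico (M.τ i) (M.τ (i + 1)) := ⟨(le_max_right _ _).trans ht.1.le, ht.2⟩
      have hst : s ≤ t := (le_max_left _ _).trans ht.1.le
      have hobs : t ∉ M.τ '' Icc 1 M.n := by
        rintro ⟨j, hj, rfl⟩
        have h2 := hM.lt_of_τ_lt (by omega) ((le_max_right _ _).trans_lt ht.1)
        have h3 := hM.lt_of_τ_lt (by have := hj.2; omega) ht.2
        omega
      have h0 : t ∈ Ico 0 M.T := ⟨hs0.trans hst, ht.2.trans_le hT⟩
      rw [Function.update_of_ne ht.2.ne, hF.1 ω t ⟨hst, h0.2⟩ hobs]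
      exact (hW.solvesHJB hM hi).eq_zero_of_minimizer hti _ (hv.mem t h0 _) (hv.ham t h0 hobs _)
  have hae := running_update (X := X) hM hi hs ω
  rw [update_apply_start hM hi hs, Function.update_self,
    intervalIntegral.integral_congr_ae_restrict hae] at h1
  exact ⟨h1.1.congr_ae hae, h1.2.symm⟩

theorem measurable_valueAtStart (hX : M.IsAdmissible s μ₀ X) (hM : M.Regular)
    (hs : s ∈ Ico 0 M.T) (hW : M.IsHJBSolution W Wt D) {i : ℕ} (hi : i ≤ M.n) :
    Measurable (M.valueAtStart W s X i) ∧ ∃ C, ∀ ω, |M.valueAtStart W s X i ω| ≤ C := by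
  have hmem : max s (M.τ i) ∈ Ico 0 M.T := ⟨hs.1.trans (le_max_left _ _),
    _root_.max_lt hs.2 (hM.τ_strictMono (by omega) le_rfl)⟩
  obtain ⟨hc, C, hC⟩ := hW.continuous_and_bounded hM hmem
  exact ⟨hc.measurable.comp (hX.measurable_μ hM ⟨le_max_left _ _, hmem.2.le⟩), C, fun ω => hC _⟩

theorem integrable_valueAtStart (hX : M.IsAdmissible s μ₀ X) (hM : M.Regular)
    (hs : s ∈ Ico 0 M.T) (hW : M.IsHJBSolution W Wt D) {i : ℕ} (hi : i ≤ M.n) :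
    Integrable (M.valueAtStart W s X i) M.prob := by
  have hp := hM.isProbabilityMeasure
  obtain ⟨hm, C, hC⟩ := hX.measurable_valueAtStart hM hs hW hi
  exact .of_bound hm.aestronglyMeasurable C (.of_forall hC)

theorem measurable_pre_ambient (hX : M.IsAdmissible s μ₀ X) (hM : M.Regular) {i : ℕ}
    (hi : i ∈ Icc 1 (M.n + 1)) (hs : s < M.τ i) : Measurable (X.pre i) := by
  obtain ⟨j, rfl⟩ : ∃ j, i = j + 1 := ⟨i - 1, by have := hi.1; omega⟩
  exact (hX.measurable_pre_noise hM (by have := hi.2; omega) hs).mono (hM.noise_le _) le_rfl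

theorem integrable_valueAtEnd (hX : M.IsAdmissible s μ₀ X) (hM : M.Regular)
    (hW : M.IsHJBSolution W Wt D) {i : ℕ} (hi : i ∈ Icc 1 (M.n + 1)) :
    Integrable (M.valueAtEnd W s μ₀ X i) M.prob := by
  have hp := hM.isProbabilityMeasure
  unfold valueAtEnd
  split_ifs with hs
  · obtain ⟨C, hC⟩ := hW.exists_bound_valueBefore hM hi
    exact .of_bound ((hW.continuous_valueBefore hM hi).measurable.comp
      (hX.measurable_pre_ambient hM hi hs)).aestronglyMeasurable C (.of_forall fun ω => hC _)
  · exact integrable_const _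

theorem measurable_h (hX : M.IsAdmissible s μ₀ X) (hM : M.Regular) {i : ℕ}
    (hi : i ∈ Icc 1 M.n) (hs : s < M.τ i) :
    Measurable fun ω => M.h (M.τ i) (X.pre i ω) (X.β i ω) := by
  obtain ⟨j, rfl⟩ : ∃ j, i = j + 1 := ⟨i - 1, by have := hi.1; omega⟩
  have hj : j + 1 ≤ M.n := hi.2
  exact (hM.h_measurable _ hi).comp
    ((hX.measurable_pre_ambient hM ⟨hi.1, by omega⟩ hs).prodMk
      ((hX.measurable_β hM (by omega)).mono (hM.noise_le _) le_rfl))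

/-- The mean of the value after the observation, as a mean over the state before it. -/
theorem integral_valueAtStart (hX : M.IsAdmissible s μ₀ X) (hM : M.Regular)
    (hW : M.IsHJBSolution W Wt D) {i : ℕ} (hi : i ∈ Icc 1 M.n) (hs : s < M.τ i) :
    Integrable (fun ω => ∫ ω', W (M.τ i) (M.posterior i (X.β i ω) (X.pre i ω) ω') ∂M.prob) M.prob ∧
      ∫ ω, M.valueAtStart W s X i ω ∂M.prob =
        ∫ ω, ∫ ω', W (M.τ i) (M.posterior i (X.β i ω) (X.pre i ω) ω') ∂M.prob ∂M.prob := by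
  have hp := hM.isProbabilityMeasure
  obtain ⟨j, rfl⟩ : ∃ j, i = j + 1 := ⟨i - 1, by have := hi.1; omega⟩
  have hj : j + 1 ≤ M.n := hi.2
  obtain ⟨hc, C, hC⟩ := hW.continuous_and_bounded hM (t := M.τ (j + 1))
    ⟨hM.τ_nonneg (by omega), hM.τ_strictMono (by omega) le_rfl⟩
  have h1 := hX.integral_update hM hj hs hc.measurable hC
  refine ⟨.of_bound h1.1.aestronglyMeasurable C
    (.of_forall fun ω => hM.abs_integral_posterior_le hC _ _), ?_⟩
  unfold valueAtStart
  rw [max_eq_right hs.le]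
  exact h1.2

/-- The mean cost of a measurement together with the value after it. -/
theorem integrable_impCost (hX : M.IsAdmissible s μ₀ X) (hM : M.Regular)
    (hW : M.IsHJBSolution W Wt D) {i : ℕ} (hi : i ∈ Icc 1 M.n) (hs : s < M.τ i)
    (hh : Integrable (fun ω => M.h (M.τ i) (X.pre i ω) (X.β i ω)) M.prob) :
    Integrable (fun ω => M.impCost W i (X.pre i ω) (X.β i ω)) M.prob ∧
      ∫ ω, M.impCost W i (X.pre i ω) (X.β i ω) ∂M.prob =
        ∫ ω, M.measurementCost s X i ω ∂M.prob + ∫ ω, M.valueAtStart W s X i ω ∂M.prob := by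
  have h1 := hX.integral_valueAtStart hM hW hi hs
  refine ⟨hh.add h1.1, ?_⟩
  simp only [measurementCost, if_pos hs]
  rw [h1.2, ← integral_add hh h1.1]
  rfl

theorem valueAtStart_eq_valueAtEnd (hX : M.IsAdmissible s μ₀ X) {i : ℕ} (hs : ¬ s < M.τ i) :
    M.valueAtStart W s X i = M.valueAtEnd W s μ₀ X i := by
  funext ω
  unfold valueAtStart valueAtEnd
  rw [if_neg hs, max_eq_left (not_lt.1 hs), hX.init]

end IsAdmissible

namespace FiniteCost

variable {s : ℝ} {μ₀ : P d} {X : Path d k₁ k₂ Ω}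

theorem integrable_running_piece (hfin : M.FiniteCost s X) (hM : M.Regular) {i : ℕ} (hi : i ≤ M.n)
    (hsT : s ≤ M.T) :
    Integrable (fun ω => ∫ t in max s (M.τ i)..max s (M.τ (i + 1)), M.running X t ω) M.prob := by
  have hp := hM.isProbabilityMeasure
  have hle : max s (M.τ i) ≤ max s (M.τ (i + 1)) := max_le_max_left _ (hM.τ_lt i hi).le
  have hsub : Ioc (max s (M.τ i)) (max s (M.τ (i + 1))) ⊆ Icc s M.T := fun t ht =>
    ⟨(le_max_left _ _).trans ht.1.le, ht.2.trans (max_le hsT (hM.τ_le_T (by omega)))⟩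
  have h1 := hfin.1
  rw [Measure.restrict_prod_eq_prod_univ] at h1
  have h2 : IntegrableOn _ _ _ := IntegrableOn.mono_set h1 (prod_mono_left hsub)
  rw [IntegrableOn, ← Measure.restrict_prod_eq_prod_univ] at h2
  simp only [intervalIntegral.integral_of_le hle]
  exact h2.integral_prod_right

theorem ae_integrableOn (hfin : M.FiniteCost s X) (hM : M.Regular) :
    ∀ᵐ ω ∂M.prob, IntegrableOn (fun t => M.running X t ω) (Icc s M.T) := by
  have hp := hM.isProbabilityMeasure
  exact hfin.1.prod_left_ae

theorem integrable_measurementCost (hfin : M.FiniteCost s X) (hM : M.Regular) {i : ℕ}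
    (hi : i ∈ Icc 1 M.n) : Integrable (M.measurementCost s X i) M.prob := by
  have hp := hM.isProbabilityMeasure
  unfold measurementCost
  split_ifs with hs
  · exact hfin.2 i hi hs
  · exact integrable_const _

variable {W Wt : ℝ → P d → ℝ} {D : ℝ → P d → E d → ℝ}

/-- The cost as a sum over the intervals between observations. -/
theorem J_eq (hfin : M.FiniteCost s X) (hM : M.Regular) (hX : M.IsAdmissible s μ₀ X)
    (hs : s ∈ Ico 0 M.T) (hW : M.IsHJBSolution W Wt D) : M.J s X =
      (∑ i ∈ Finset.range (M.n + 1),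
        ∫ ω, (∫ t in max s (M.τ i)..max s (M.τ (i + 1)), M.running X t ω) ∂M.prob) +
      (∑ i ∈ Finset.Icc 1 M.n, ∫ ω, M.measurementCost s X i ω ∂M.prob) +
      ∫ ω, M.valueAtEnd W s μ₀ X (M.n + 1) ω ∂M.prob := by
  have hp := hM.isProbabilityMeasure
  have hi1 : ∀ i ∈ Finset.range (M.n + 1), Integrable
      (fun ω => ∫ t in max s (M.τ i)..max s (M.τ (i + 1)), M.running X t ω) M.prob := fun i hi =>
    hfin.integrable_running_piece hM (by simpa [Nat.lt_succ_iff] using hi) hs.2.le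
  have hi2 : ∀ i ∈ Finset.Icc 1 M.n, Integrable (M.measurementCost s X i) M.prob := fun i hi =>
    hfin.integrable_measurementCost hM (by simpa using hi)
  have hi3 : Integrable (M.valueAtEnd W s μ₀ X (M.n + 1)) M.prob :=
    hX.integrable_valueAtEnd hM hW ⟨by omega, le_rfl⟩
  have hi12 : Integrable (fun ω => (∑ i ∈ Finset.range (M.n + 1),
      ∫ t in max s (M.τ i)..max s (M.τ (i + 1)), M.running X t ω) +
        ∑ i ∈ Finset.Icc 1 M.n, M.measurementCost s X i ω) M.prob :=
    (integrable_finsetSum _ hi1).add (integrable_finsetSum _ hi2)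
  rw [← integral_finsetSum _ hi1, ← integral_finsetSum _ hi2,
    ← integral_add (integrable_finsetSum _ hi1) (integrable_finsetSum _ hi2),
    ← integral_add hi12 hi3]
  unfold J
  refine integral_congr_ae ?_
  filter_upwards [hfin.ae_integrableOn hM] with ω hω
  congr 1
  · congr 1
    rw [intervalIntegral.sum_integral_adjacent_intervals (a := fun i => max s (M.τ i))
      (n := M.n + 1)]
    · have e0 : max s (M.τ 0) = s := by rw [hM.τ_zero, max_eq_left hs.1]
      have e1 : max s (M.τ (M.n + 1)) = M.T := max_eq_right hs.2.le
      rw [e0, e1]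
      rfl
    · intro k hk
      refine (hω.mono_set ?_).intervalIntegrable
      rw [uIcc_of_le (max_le_max_left _ (hM.τ_lt k (by omega)).le)]
      exact Icc_subset_Icc (le_max_left _ _) (max_le hs.2.le (hM.τ_le_T (by omega)))
  · have hT : s < M.τ (M.n + 1) := hs.2
    simp only [valueAtEnd, if_pos hT, valueBefore, if_true]
    rw [hX.no_update]

/-- The lower bound for the cost. -/
theorem le_J (hfin : M.FiniteCost s X) (hM : M.Regular) (hX : M.IsAdmissible s μ₀ X)
    (hs : s ∈ Ico 0 M.T) (hW : M.IsHJBSolution W Wt D) : W s μ₀ ≤ M.J s X := by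
  have hp := hM.isProbabilityMeasure
  rw [hfin.J_eq hM hX hs hW]
  have hG : ∀ i ≤ M.n, ∫ ω, M.valueAtStart W s X i ω ∂M.prob ≤
      ∫ ω, (∫ t in max s (M.τ i)..max s (M.τ (i + 1)), M.running X t ω) ∂M.prob +
        ∫ ω, M.valueAtEnd W s μ₀ X (i + 1) ω ∂M.prob := by
    intro i hi
    have h1 := hfin.integrable_running_piece hM hi hs.2.le
    have h2 := hX.integrable_valueAtEnd hM hW (i := i + 1) ⟨by omega, by omega⟩
    rw [← integral_add h1 h2]
    refine integral_mono_ae (hX.integrable_valueAtStart hM hs hW hi) (h1.add h2) ?_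
    filter_upwards [hfin.ae_integrableOn hM] with ω hω
    exact hX.valueAtStart_le hM hW hi hω
  have hK : ∀ i ∈ Icc 1 M.n, ∫ ω, M.valueAtEnd W s μ₀ X i ω ∂M.prob ≤
      ∫ ω, M.measurementCost s X i ω ∂M.prob + ∫ ω, M.valueAtStart W s X i ω ∂M.prob := by
    intro i hi
    by_cases hsi : s < M.τ i
    · have h1 := hX.integrable_impCost hM hW hi hsi (hfin.2 i hi hsi)
      rw [← h1.2]
      refine integral_mono (hX.integrable_valueAtEnd hM hW ⟨hi.1, hi.2.trans (Nat.le_succ _)⟩) h1.1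
        fun ω => ?_
      simp only [valueAtEnd, if_pos hsi]
      obtain ⟨j, rfl⟩ : ∃ j, i = j + 1 := ⟨i - 1, by have := hi.1; omega⟩
      obtain ⟨u, hu, hue⟩ := hX.exists_mem_β hM (by have := hi.2; omega) hsi ω
      rw [← hue]
      exact hW.valueBefore_le hM hi hu _
    · rw [hX.valueAtStart_eq_valueAtEnd hsi]
      simp [measurementCost, if_neg hsi]
  -- summation over the intervals and the observations
  have key : ∀ k ≤ M.n, W s μ₀ ≤ (∑ i ∈ Finset.range (k + 1),
        ∫ ω, (∫ t in max s (M.τ i)..max s (M.τ (i + 1)), M.running X t ω) ∂M.prob) +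
      (∑ i ∈ Finset.Icc 1 k, ∫ ω, M.measurementCost s X i ω ∂M.prob) +
      ∫ ω, M.valueAtEnd W s μ₀ X (k + 1) ω ∂M.prob := by
    intro k hk
    induction k with
    | zero =>
      have h1 := hG 0 hk
      have h2 : ∫ ω, M.valueAtStart W s X 0 ω ∂M.prob = W s μ₀ := by
        simp [valueAtStart, hM.τ_zero, max_eq_left hs.1, hX.init]
      simpa [h2] using h1
    | succ k ih =>
      rw [Finset.sum_range_succ, Finset.sum_Icc_succ_top (by omega)]
      linarith [ih (by omega), hG (k + 1) hk, hK (k + 1) ⟨by omega, hk⟩]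
  exact key M.n le_rfl

end FiniteCost

namespace IsAdmissible

variable {s : ℝ} {μ₀ : P d} {X : Path d k₁ k₂ Ω} {W Wt : ℝ → P d → ℝ} {D : ℝ → P d → E d → ℝ}

/-- If every step of a control is optimal up to `ε`, then the cost is finite: it is bounded
below, and the optimality gaps bound it from above. -/
theorem finiteCost (hX : M.IsAdmissible s μ₀ X) (hM : M.Regular) (hs : s ∈ Ico 0 M.T)
    (hW : M.IsHJBSolution W Wt D) {ε : ℝ}
    (hrun : ∀ ω, ∀ i ≤ M.n, s < M.τ (i + 1) →
      IntervalIntegrable (fun t => M.running X t ω) volume (max s (M.τ i)) (M.τ (i + 1)) ∧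
        (∫ t in max s (M.τ i)..M.τ (i + 1), M.running X t ω) +
          M.valueBefore W (i + 1) (X.pre (i + 1) ω) ≤ M.valueAtStart W s X i ω + ε)
    (himp : ∀ ω, ∀ i ∈ Icc 1 M.n, s < M.τ i →
      M.impCost W i (X.pre i ω) (X.β i ω) ≤ M.valueBefore W i (X.pre i ω) + ε) :
    M.FiniteCost s X := by
  have hp := hM.isProbabilityMeasure
  refine ⟨?_, fun i hi hsi => ?_⟩
  · obtain ⟨L, hL0, hL⟩ := hM.exists_running_lower
    have hpiece : ∀ i ≤ M.n, ∃ C, ∀ ω,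
        IntervalIntegrable (fun t => M.running X t ω) volume (max s (M.τ i)) (max s (M.τ (i + 1))) ∧
        (∫ t in max s (M.τ i)..max s (M.τ (i + 1)), M.running X t ω) ≤ C := by
      intro i hi
      by_cases hsi : s < M.τ (i + 1)
      · obtain ⟨-, C, hC⟩ := hX.measurable_valueAtStart hM hs hW hi
        obtain ⟨C', hC'⟩ := hW.exists_bound_valueBefore hM (i := i + 1) ⟨by omega, by omega⟩
        refine ⟨C + ε + C', fun ω => ?_⟩
        rw [max_eq_right hsi.le]
        obtain ⟨h1, h2⟩ := hrun ω i hi hsi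
        exact ⟨h1, by linarith [(abs_le.1 (hC ω)).2, (abs_le.1 (hC' (X.pre (i + 1) ω))).1]⟩
      · have hs' := not_lt.1 hsi
        refine ⟨0, fun ω => ?_⟩
        rw [max_eq_left hs', max_eq_left ((hM.τ_lt i hi).le.trans hs')]
        exact ⟨.refl, by rw [intervalIntegral.integral_same]⟩
    choose! C hC using hpiece
    have e0 : max s (M.τ 0) = s := by rw [hM.τ_zero, max_eq_left hs.1]
    have e1 : max s (M.τ (M.n + 1)) = M.T := max_eq_right hs.2.le
    have htot : ∀ ω, IntervalIntegrable (fun t => M.running X t ω) volume s M.T ∧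
        (∫ t in s..M.T, M.running X t ω) ≤ ∑ i ∈ Finset.range (M.n + 1), C i := by
      intro ω
      have h1 : ∀ k < M.n + 1, IntervalIntegrable (fun t => M.running X t ω) volume
          (max s (M.τ k)) (max s (M.τ (k + 1))) := fun k hk => (hC k (by omega) ω).1
      have h2 := IntervalIntegrable.trans_iterate (a := fun i => max s (M.τ i)) h1
      have h3 := intervalIntegral.sum_integral_adjacent_intervals (a := fun i => max s (M.τ i)) h1
      rw [e0, e1] at h2 h3
      refine ⟨h2, ?_⟩
      rw [← h3]
      exact Finset.sum_le_sum fun i hi => (hC i (by simpa [Nat.lt_succ_iff] using hi) ω).2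
    have hmeas := hX.aestronglyMeasurable_running hM hs.1
    have hIcc : ∀ ω, IntegrableOn (fun t => M.running X t ω) (Icc s M.T) := fun ω =>
      (intervalIntegrable_iff_integrableOn_Icc_of_le hs.2.le).1 (htot ω).1
    refine (integrable_prod_iff' hmeas).2 ⟨.of_forall hIcc, ?_⟩
    refine .of_bound hmeas.norm.prod_swap.integral_prod_right'
      ((∑ i ∈ Finset.range (M.n + 1), C i) + 2 * L * (M.T - s)) (.of_forall fun ω => ?_)
    rw [Real.norm_eq_abs, abs_of_nonneg (integral_nonneg fun _ => norm_nonneg _)]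
    have hle : ∫ t in Icc s M.T, ‖M.running X t ω‖ ≤
        ∫ t in Icc s M.T, (M.running X t ω + 2 * L) := by
      refine setIntegral_mono_on (hIcc ω).norm ((hIcc ω).add (integrable_const _))
        measurableSet_Icc fun t ht => ?_
      have := hL _ ⟨_, hX.mem_U ω t ht, rfl⟩ t ⟨hs.1.trans ht.1, ht.2⟩ (X.μ t ω)
      simp only [running] at this ⊢
      rw [Real.norm_eq_abs, abs_le]
      constructor <;> linarith
    refine hle.trans ?_
    rw [integral_add (hIcc ω) (integrable_const _), setIntegral_const, integral_Icc_eq_integral_Ioc,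
      ← intervalIntegral.integral_of_le hs.2.le]
    simp only [measureReal_def, Real.volume_Icc, smul_eq_mul]
    rw [ENNReal.toReal_ofReal (by linarith [hs.2])]
    linarith [(htot ω).2]
  · obtain ⟨Ch, hCh⟩ := hM.h_bddBelow
    obtain ⟨C, hC⟩ := hW.exists_bound_valueBefore hM (i := i) ⟨hi.1, hi.2.trans (Nat.le_succ _)⟩
    obtain ⟨-, C', hC'⟩ := hW.continuous_and_bounded hM (t := M.τ i)
      ⟨hM.τ_nonneg (hi.2.trans (Nat.le_succ _)), hM.τ_strictMono (Nat.lt_succ_of_le hi.2) le_rfl⟩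
    refine .of_bound (hX.measurable_h hM hi hsi).aestronglyMeasurable (|Ch| + |C + ε + C'|)
      (.of_forall fun ω => ?_)
    have h1 := himp ω i hi hsi
    unfold impCost at h1
    have h2 := (abs_le.1 (hM.abs_integral_posterior_le (i := i) hC' (X.β i ω) (X.pre i ω))).1
    have h3 := (abs_le.1 (hC (X.pre i ω))).2
    have h4 : Ch ≤ M.h (M.τ i) (X.pre i ω) (X.β i ω) := by
      obtain ⟨j, rfl⟩ : ∃ j, i = j + 1 := ⟨i - 1, by have := hi.1; omega⟩
      obtain ⟨u, hu, hue⟩ := hX.exists_mem_β hM (by have := hi.2; omega) hsi ω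
      rw [← hue]
      exact hCh u hu _ hi _
    rw [Real.norm_eq_abs, abs_le]
    constructor
    · linarith [neg_abs_le Ch, abs_nonneg (C + ε + C')]
    · linarith [le_abs_self (C + ε + C'), abs_nonneg Ch]

/-- The upper bound for the cost of a control all of whose steps are optimal up to `ε`. There are at
most `n + 1` intervals between observations and `n` measurements. -/
theorem J_le (hX : M.IsAdmissible s μ₀ X) (hM : M.Regular) (hs : s ∈ Ico 0 M.T)
    (hW : M.IsHJBSolution W Wt D) {ε : ℝ} (hε : 0 ≤ ε)
    (hrun : ∀ ω, ∀ i ≤ M.n, s < M.τ (i + 1) →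
      IntervalIntegrable (fun t => M.running X t ω) volume (max s (M.τ i)) (M.τ (i + 1)) ∧
        (∫ t in max s (M.τ i)..M.τ (i + 1), M.running X t ω) +
          M.valueBefore W (i + 1) (X.pre (i + 1) ω) ≤ M.valueAtStart W s X i ω + ε)
    (himp : ∀ ω, ∀ i ∈ Icc 1 M.n, s < M.τ i →
      M.impCost W i (X.pre i ω) (X.β i ω) ≤ M.valueBefore W i (X.pre i ω) + ε) :
    M.J s X ≤ W s μ₀ + (2 * M.n + 1) * ε := by
  have hp := hM.isProbabilityMeasure
  have hfin := hX.finiteCost hM hs hW hrun himp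
  rw [hfin.J_eq hM hX hs hW]
  have hG : ∀ i ≤ M.n, ∫ ω, (∫ t in max s (M.τ i)..max s (M.τ (i + 1)), M.running X t ω) ∂M.prob +
        ∫ ω, M.valueAtEnd W s μ₀ X (i + 1) ω ∂M.prob ≤
      ∫ ω, M.valueAtStart W s X i ω ∂M.prob + ε := by
    intro i hi
    by_cases hsi : s < M.τ (i + 1)
    · have h1 := hfin.integrable_running_piece hM hi hs.2.le
      have h2 := hX.integrable_valueAtEnd hM hW (i := i + 1) ⟨by omega, by omega⟩
      have h3 := hX.integrable_valueAtStart hM hs hW hi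
      have h4 : ∫ ω, (M.valueAtStart W s X i ω + ε) ∂M.prob =
          ∫ ω, M.valueAtStart W s X i ω ∂M.prob + ε := by
        rw [integral_add h3 (integrable_const _)]
        simp
      rw [← integral_add h1 h2, ← h4]
      refine integral_mono (h1.add h2) (h3.add (integrable_const _)) fun ω => ?_
      simp only [valueAtEnd, if_pos hsi, max_eq_right hsi.le]
      exact (hrun ω i hi hsi).2
    · have hs' := not_lt.1 hsi
      have hs'' := (hM.τ_lt i hi).le.trans hs'
      rw [hX.valueAtStart_eq_valueAtEnd hs''.not_gt, max_eq_left hs', max_eq_left hs'']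
      simp only [valueAtEnd, if_neg hsi, if_neg hs''.not_gt, intervalIntegral.integral_same]
      simpa using hε
  have hK : ∀ i ∈ Icc 1 M.n, ∫ ω, M.measurementCost s X i ω ∂M.prob +
      ∫ ω, M.valueAtStart W s X i ω ∂M.prob ≤ ∫ ω, M.valueAtEnd W s μ₀ X i ω ∂M.prob + ε := by
    intro i hi
    by_cases hsi : s < M.τ i
    · have h1 := hX.integrable_impCost hM hW hi hsi (hfin.2 i hi hsi)
      have h2 := hX.integrable_valueAtEnd hM hW (i := i) ⟨hi.1, hi.2.trans (Nat.le_succ _)⟩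
      have h4 : ∫ ω, (M.valueAtEnd W s μ₀ X i ω + ε) ∂M.prob =
          ∫ ω, M.valueAtEnd W s μ₀ X i ω ∂M.prob + ε := by
        rw [integral_add h2 (integrable_const _)]
        simp
      rw [← h1.2, ← h4]
      refine integral_mono h1.1 (h2.add (integrable_const _)) fun ω => ?_
      simp only [valueAtEnd, if_pos hsi]
      exact himp ω i hi hsi
    · rw [hX.valueAtStart_eq_valueAtEnd hsi]
      simp only [measurementCost, if_neg hsi]
      simpa using hε
  have key : ∀ k ≤ M.n, (∑ i ∈ Finset.range (k + 1),
        ∫ ω, (∫ t in max s (M.τ i)..max s (M.τ (i + 1)), M.running X t ω) ∂M.prob) +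
      (∑ i ∈ Finset.Icc 1 k, ∫ ω, M.measurementCost s X i ω ∂M.prob) +
      ∫ ω, M.valueAtEnd W s μ₀ X (k + 1) ω ∂M.prob ≤ W s μ₀ + (2 * k + 1) * ε := by
    intro k hk
    induction k with
    | zero =>
      have h1 := hG 0 hk
      have h2 : ∫ ω, M.valueAtStart W s X 0 ω ∂M.prob = W s μ₀ := by
        simp [valueAtStart, hM.τ_zero, max_eq_left hs.1, hX.init]
      simpa [h2] using h1
    | succ k ih =>
      rw [Finset.sum_range_succ, Finset.sum_Icc_succ_top (by omega)]
      push_cast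
      linarith [ih (by omega), hG (k + 1) hk, hK (k + 1) ⟨by omega, hk⟩]
  exact key M.n le_rfl

/-- Feedback controls of pointwise minimizers are optimal. -/
theorem finiteCost_and_J_eq_of_feedback (hX : M.IsAdmissible s μ₀ X) (hM : M.Regular)
    (hs : s ∈ Ico 0 M.T) (hW : M.IsHJBSolution W Wt D) {v : ℝ → P d → E k₁ × E k₂}
    (hv : M.IsSelector W D v) (hF : M.IsFeedback s v X) :
    M.FiniteCost s X ∧ M.J s X = W s μ₀ := by
  have hrun : ∀ ω, ∀ i ≤ M.n, s < M.τ (i + 1) →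
      IntervalIntegrable (fun t => M.running X t ω) volume (max s (M.τ i)) (M.τ (i + 1)) ∧
        (∫ t in max s (M.τ i)..M.τ (i + 1), M.running X t ω) +
          M.valueBefore W (i + 1) (X.pre (i + 1) ω) ≤ M.valueAtStart W s X i ω + 0 := by
    intro ω i hi hsi
    have h1 := hX.eq_running_of_feedback hM hs.1 hW hv hF hi hsi ω
    exact ⟨h1.1, by rw [add_zero, h1.2]⟩
  have himp : ∀ ω, ∀ i ∈ Icc 1 M.n, s < M.τ i →
      M.impCost W i (X.pre i ω) (X.β i ω) ≤ M.valueBefore W i (X.pre i ω) + 0 := by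
    intro ω i hi hsi
    have e : M.valueBefore W i (X.pre i ω) = sInf (M.impFun W i (X.pre i ω) '' M.U) :=
      if_neg (by have := hi.2; omega)
    rw [add_zero, e, hF.2 ω i hi hsi]
    refine le_csInf (hM.U_nonempty.image _) ?_
    rintro _ ⟨u, hu, rfl⟩
    exact hv.imp i hi _ u hu
  have hfin := hX.finiteCost hM hs hW hrun himp
  refine ⟨hfin, le_antisymm ?_ (hfin.le_J hM hX hs hW)⟩
  simpa using hX.J_le hM hs hW le_rfl hrun himp

end IsAdmissible

end Model
end NoisyObs

/-! ### Controls produced by policies -/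

namespace NoisyObs
namespace Model

variable {d k₁ k₂ : ℕ} {Ω S O : Type*} [MeasurableSpace Ω] [MeasurableSpace S] [MeasurableSpace O]
variable {M : Model d k₁ k₂ Ω S O}

/-- A function given by measurable pieces, which are needed only for the indices that occur. -/
theorem measurable_of_index {Q R : Type*} [MeasurableSpace Q] [MeasurableSpace R] {N : Q → ℕ}
    (hN : Measurable N) {g : ℕ → Q → R} (hg : ∀ i ∈ range N, Measurable (g i)) :
    Measurable fun q => g (N q) q := by
  intro A hA
  have e : (fun q => g (N q) q) ⁻¹' A = ⋃ i ∈ range N, N ⁻¹' {i} ∩ g i ⁻¹' A := by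
    ext q
    refine ⟨fun h => mem_iUnion₂.2 ⟨N q, mem_range_self q, rfl, h⟩, fun h => ?_⟩
    obtain ⟨i, -, hi, h⟩ := mem_iUnion₂.1 h
    rw [mem_preimage, mem_singleton_iff] at hi
    subst hi
    exact h
  rw [e]
  exact .biUnion (to_countable _) fun i hi => (hN (measurableSet_singleton i)).inter (hg i hi hA)

open Classical in
/-- The index of the interval `[τ i, τ (i + 1))` containing `t`; the last interval also contains
the horizon. -/
noncomputable def index (M : Model d k₁ k₂ Ω S O) (t : ℝ) : ℕ :=
  Nat.findGreatest (fun i => M.τ i ≤ t) M.n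

theorem index_eq (hM : M.Regular) {i : ℕ} (hi : i ≤ M.n) {t : ℝ}
    (ht : t ∈ Ico (M.τ i) (M.τ (i + 1))) : M.index t = i := by
  classical
  unfold index
  refine le_antisymm ?_ (Nat.le_findGreatest hi ht.1)
  by_contra! hlt
  have h3 := Nat.findGreatest_of_ne_zero (m := Nat.findGreatest (fun i => M.τ i ≤ t) M.n) rfl
    (by omega)
  have h4 : Nat.findGreatest (fun i => M.τ i ≤ t) M.n ≤ M.n := Nat.findGreatest_le _
  have := hM.lt_of_τ_lt (by omega) (h3.trans_lt ht.2)
  omega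

theorem index_T (hM : M.Regular) : M.index M.T = M.n := by
  classical
  exact le_antisymm (Nat.findGreatest_le _) (Nat.le_findGreatest le_rfl (hM.τ_le_T (by omega)))

theorem index_spec (hM : M.Regular) {s : ℝ} (hs : s ∈ Ico 0 M.T) {t : ℝ} (ht : t ∈ Icc s M.T) :
    M.index t ≤ M.n ∧ s < M.τ (M.index t + 1) ∧
      t ∈ Icc (max s (M.τ (M.index t))) (M.τ (M.index t + 1)) := by
  rcases ht.2.lt_or_eq with hlt | rfl
  · obtain ⟨i, hi, hti⟩ := hM.exists_index ⟨hs.1.trans ht.1, hlt⟩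
    rw [index_eq hM hi hti]
    exact ⟨hi, ht.1.trans_lt hti.2, max_le ht.1 hti.1, hti.2.le⟩
  · rw [index_T hM]
    exact ⟨le_rfl, hs.2, max_le hs.2.le (hM.τ_le_T (by omega)), le_rfl⟩

theorem measurable_index : Measurable M.index := by
  classical
  exact measurable_findGreatest fun k _ => measurableSet_Ici

theorem Regular.measurable_bayes_comp (hM : M.Regular) {Q : Type*} {m : MeasurableSpace Q}
    {f : Q → E k₂} {p : Q → P d} {y : Q → O}
    (hf : Measurable f) (hp : Measurable p) (hy : Measurable y) :
    Measurable fun q => M.bayes (f q) (p q) (y q) :=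
  Measurable.comp (g := fun z : E k₂ × P d × O => M.bayes z.1 z.2.1 z.2.2)
    (f := fun q => (f q, p q, y q)) hM.measurable_bayes (hf.prodMk (hp.prodMk hy))

/-- A feedback policy on `[s, T]`: on the `i`-th interval between observations the control `A i` and
the state `Φ i` depend on the state at the beginning of the interval, and the measurement
control `B i` depends on the state before the `i`-th observation. -/
structure IsPolicy (M : Model d k₁ k₂ Ω S O) (s : ℝ) (A : ℕ → ℝ → P d → E k₁)
    (Φ : ℕ → ℝ → P d → P d) (B : ℕ → P d → E k₂) : Prop where
  measurable_control : ∀ i ≤ M.n, s < M.τ (i + 1) → Measurable fun q : ℝ × P d => A i q.1 q.2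
  measurable_state : ∀ i ≤ M.n, s < M.τ (i + 1) →
    ∀ t ∈ Icc (max s (M.τ i)) (M.τ (i + 1)), Measurable (Φ i t)
  mem_ctrl : ∀ i ≤ M.n, s < M.τ (i + 1) → ∀ t ν, A i t ν ∈ M.ctrl
  init : ∀ i ≤ M.n, s < M.τ (i + 1) → ∀ ν, Φ i (max s (M.τ i)) ν = ν
  solves : ∀ i ≤ M.n, s < M.τ (i + 1) → ∀ ν,
    M.SolvesFP (fun t => A i t ν) (fun t => Φ i t ν) (max s (M.τ i)) (M.τ (i + 1))
  measurable_measurement : ∀ i ∈ Icc 1 M.n, Measurable (B i)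
  mem_measurement : ∀ i ∈ Icc 1 M.n, ∀ μ, ∃ u ∈ M.U, u.2 = B i μ

open Classical in
/-- The states produced by a policy at the beginnings of the intervals. -/
noncomputable def policyState (M : Model d k₁ k₂ Ω S O) (s : ℝ) (μ₀ : P d)
    (Φ : ℕ → ℝ → P d → P d) (B : ℕ → P d → E k₂) : ℕ → Ω → P d
  | 0, _ => μ₀
  | i + 1, ω =>
    if s < M.τ (i + 1) then
      M.posterior (i + 1) (B (i + 1) (Φ i (M.τ (i + 1)) (policyState M s μ₀ Φ B i ω)))
        (Φ i (M.τ (i + 1)) (policyState M s μ₀ Φ B i ω)) ω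
    else μ₀

open Classical in
/-- The control and the state process produced by a policy; `β₀` is used where no measurement takes
place. The truncated subtraction at `i = 0` does not matter, since there is no observation
at time `0`. -/
noncomputable def policyPath (M : Model d k₁ k₂ Ω S O) (s : ℝ) (μ₀ : P d) (β₀ : E k₂)
    (A : ℕ → ℝ → P d → E k₁) (Φ : ℕ → ℝ → P d → P d) (B : ℕ → P d → E k₂) : Path d k₁ k₂ Ω where
  α t ω := A (M.index t) t (M.policyState s μ₀ Φ B (M.index t) ω)
  β i ω := if i ∈ Icc 1 M.n ∧ s < M.τ i then
    B i (Φ (i - 1) (M.τ i) (M.policyState s μ₀ Φ B (i - 1) ω)) else β₀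
  μ t ω := Φ (M.index t) t (M.policyState s μ₀ Φ B (M.index t) ω)
  pre i ω := Φ (i - 1) (M.τ i) (M.policyState s μ₀ Φ B (i - 1) ω)

namespace IsPolicy

variable {s : ℝ} {A : ℕ → ℝ → P d → E k₁} {Φ : ℕ → ℝ → P d → P d} {B : ℕ → P d → E k₂}

theorem policyState_of_le (μ₀ : P d) {i : ℕ} (h : M.τ i ≤ s) (ω : Ω) :
    M.policyState s μ₀ Φ B i ω = μ₀ := by
  cases i with
  | zero => rfl
  | succ i => simp only [policyState, if_neg h.not_gt]

theorem μ_start (h : M.IsPolicy s A Φ B) (hM : M.Regular) (μ₀ : P d) (β₀ : E k₂) {i : ℕ}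
    (hi : i ≤ M.n) (hs : s < M.τ (i + 1)) (ω : Ω) :
    (M.policyPath s μ₀ β₀ A Φ B).μ (max s (M.τ i)) ω = M.policyState s μ₀ Φ B i ω := by
  simp only [policyPath]
  rw [index_eq hM hi ⟨le_max_right _ _, IsAdmissible.max_lt hM hi hs⟩, h.init i hi hs]

theorem policyState_succ (μ₀ : P d) (β₀ : E k₂) {i : ℕ} (hi : i + 1 ≤ M.n)
    (hs : s < M.τ (i + 1)) (ω : Ω) :
    M.policyState s μ₀ Φ B (i + 1) ω = M.bayes ((M.policyPath s μ₀ β₀ A Φ B).β (i + 1) ω)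
      ((M.policyPath s μ₀ β₀ A Φ B).pre (i + 1) ω)
      (M.Y (M.policyPath s μ₀ β₀ A Φ B) (i + 1) ω) := by
  have hc : i + 1 ∈ Icc 1 M.n ∧ s < M.τ (i + 1) := ⟨⟨by omega, hi⟩, hs⟩
  simp only [policyState, if_pos hs, Y, policyPath, if_pos hc, Nat.add_sub_cancel]
  rfl

theorem measurable_policyState (h : M.IsPolicy s A Φ B) (hM : M.Regular) (μ₀ : P d) (β₀ : E k₂)
    {i : ℕ} (hi : i ≤ M.n) {t : ℝ} (ht : M.τ i ≤ t) :
    Measurable[M.sigma (M.policyPath s μ₀ β₀ A Φ B) s t] (M.policyState s μ₀ Φ B i) := by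
  induction i with
  | zero => exact measurable_const
  | succ i ih =>
    by_cases hs : s < M.τ (i + 1)
    · have hlt := IsAdmissible.max_lt hM (by omega : i ≤ M.n) hs
      have ih' := ih (by omega) ((hM.τ_lt i (by omega)).le.trans ht)
      have hi1 : i + 1 ∈ Icc 1 M.n := ⟨by omega, hi⟩
      have hpre : Measurable[M.sigma (M.policyPath s μ₀ β₀ A Φ B) s t]
          ((M.policyPath s μ₀ β₀ A Φ B).pre (i + 1)) :=
        (h.measurable_state i (by omega) hs _ (right_mem_Icc.2 hlt.le)).comp ih'
      have hβ : Measurable[M.sigma (M.policyPath s μ₀ β₀ A Φ B) s t]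
          ((M.policyPath s μ₀ β₀ A Φ B).β (i + 1)) := by
        have e : (M.policyPath s μ₀ β₀ A Φ B).β (i + 1) = fun ω =>
            B (i + 1) ((M.policyPath s μ₀ β₀ A Φ B).pre (i + 1) ω) := by
          funext ω
          exact if_pos ⟨hi1, hs⟩
        rw [e]
        exact (h.measurable_measurement _ hi1).comp hpre
      have hY : Measurable[M.sigma (M.policyPath s μ₀ β₀ A Φ B) s t]
          (M.Y (M.policyPath s μ₀ β₀ A Φ B) (i + 1)) := by
        have hle : MeasurableSpace.comap (M.Y (M.policyPath s μ₀ β₀ A Φ B) (i + 1)) inferInstance ≤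
            M.sigma (M.policyPath s μ₀ β₀ A Φ B) s t :=
          le_iSup₂_of_le (i + 1) ⟨hi1, hs, ht⟩ le_rfl
        exact Measurable.mono (comap_measurable _) hle le_rfl
      have e : M.policyState s μ₀ Φ B (i + 1) = fun ω =>
          M.bayes ((M.policyPath s μ₀ β₀ A Φ B).β (i + 1) ω)
            ((M.policyPath s μ₀ β₀ A Φ B).pre (i + 1) ω)
            (M.Y (M.policyPath s μ₀ β₀ A Φ B) (i + 1) ω) :=
        funext fun ω => policyState_succ μ₀ β₀ hi hs ω
      rw [e]
      exact hM.measurable_bayes_comp hβ hpre hY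
    · have e : M.policyState s μ₀ Φ B (i + 1) = fun _ => μ₀ := by
        funext ω
        simp only [policyState, if_neg hs]
      rw [e]
      exact measurable_const

theorem measurable_α (h : M.IsPolicy s A Φ B) (hM : M.Regular) (hs : s ∈ Ico 0 M.T) (μ₀ : P d)
    (β₀ : E k₂) {t : ℝ} (ht : t ∈ Icc s M.T) :
    @Measurable (Icc s t × Ω) (E k₁)
      (@Prod.instMeasurableSpace _ _ _ (M.sigma (M.policyPath s μ₀ β₀ A Φ B) s t)) _
      (fun q => (M.policyPath s μ₀ β₀ A Φ B).α q.1 q.2) := by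
  refine @measurable_of_index (Icc s t × Ω) (E k₁) 
    (@Prod.instMeasurableSpace _ _ _ (M.sigma (M.policyPath s μ₀ β₀ A Φ B) s t)) _
    (fun q => M.index q.1) (measurable_index.comp (measurable_subtype_coe.comp measurable_fst))
    (fun i q => A i q.1 (M.policyState s μ₀ Φ B i q.2)) ?_
  rintro i ⟨q, rfl⟩
  obtain ⟨h1, h2, h3⟩ := index_spec hM hs (t := q.1) ⟨q.1.2.1, q.1.2.2.trans ht.2⟩
  have h4 := h.measurable_policyState hM μ₀ β₀ h1 (((le_max_right _ _).trans h3.1).trans q.1.2.2)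
  exact (h.measurable_control _ h1 h2).comp
    ((measurable_subtype_coe.comp measurable_fst).prodMk (h4.comp measurable_snd))

/-- The control produced by a policy is admissible. -/
theorem isAdmissible (h : M.IsPolicy s A Φ B) (hM : M.Regular) (hs : s ∈ Ico 0 M.T) (μ₀ : P d)
    {β₀ : E k₂} (hβ₀ : ∃ u ∈ M.U, u.2 = β₀) :
    M.IsAdmissible s μ₀ (M.policyPath s μ₀ β₀ A Φ B) where
  α_prog t ht := h.measurable_α hM hs μ₀ β₀ ht
  β_pred i hi := by
    by_cases hc : i ∈ Icc 1 M.n ∧ s < M.τ i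
    · obtain ⟨j, rfl⟩ : ∃ j, i = j + 1 := ⟨i - 1, by have := hi.1; omega⟩
      have hj : j + 1 ≤ M.n := hc.1.2
      have e : (M.policyPath s μ₀ β₀ A Φ B).β (j + 1) = fun ω =>
          B (j + 1) (Φ j (M.τ (j + 1)) (M.policyState s μ₀ Φ B j ω)) := by
        funext ω
        exact if_pos hc
      have hst : Measurable[M.sigmaPre (M.policyPath s μ₀ β₀ A Φ B) s (M.τ (j + 1))]
          (M.policyState s μ₀ Φ B j) := by
        refine (h.measurable_policyState hM μ₀ β₀ (by omega) le_rfl).mono (biSup_mono ?_) le_rfl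
        exact fun k hk => ⟨hk.1, hk.2.1, hk.2.2.trans_lt (hM.τ_lt j (by omega))⟩
      rw [e]
      have h1 := (h.measurable_measurement _ hc.1).comp (h.measurable_state j (by omega) hc.2 _
        (right_mem_Icc.2 (IsAdmissible.max_lt hM (by omega) hc.2).le))
      exact h1.comp hst
    · have e : (M.policyPath s μ₀ β₀ A Φ B).β i = fun _ => β₀ := by
        funext ω
        exact if_neg hc
      rw [e]
      exact measurable_const
  mem_U ω t ht := by
    obtain ⟨h1, h2, -⟩ := index_spec hM hs ht
    obtain ⟨u, hu, hue⟩ := h.mem_ctrl _ h1 h2 t (M.policyState s μ₀ Φ B (M.index t) ω)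
    obtain ⟨w, hw, hwe⟩ : ∃ w ∈ M.U,
        w.2 = (M.policyPath s μ₀ β₀ A Φ B).β (M.lastBefore t + 1) ω := by
      simp only [policyPath]
      split_ifs with hc
      · exact h.mem_measurement _ hc.1 _
      · exact hβ₀
    rw [← hwe]
    have := hM.U_prod u hu w hw
    rwa [hue] at this
  init ω := by
    obtain ⟨h1, h2, h3⟩ := index_spec hM hs (left_mem_Icc.2 hs.2.le)
    have hle : M.τ (M.index s) ≤ s := (le_max_right _ _).trans h3.1
    have := h.μ_start hM μ₀ β₀ h1 h2 ω
    rwa [max_eq_left hle, policyState_of_le μ₀ hle] at this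
  μ_adapted t ht := by
    obtain ⟨h1, h2, h3⟩ := index_spec hM hs ht
    exact (h.measurable_state _ h1 h2 t h3).comp
      (h.measurable_policyState hM μ₀ β₀ h1 ((le_max_right _ _).trans h3.1))
  fokkerPlanck ω i hi hsi := by
    refine (h.solves i hi hsi (M.policyState s μ₀ Φ B i ω)).congr (fun r hr => ?_) fun t ht => ?_
    · simp only [policyPath]
      rw [index_eq hM hi ⟨(le_max_right _ _).trans hr.1.le, hr.2⟩]
    · rcases ht.2.lt_or_eq with hlt | rfl
      · rw [Function.update_of_ne hlt.ne]
        simp only [policyPath]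
        rw [index_eq hM hi ⟨(le_max_right _ _).trans ht.1, hlt⟩]
      · rw [Function.update_self]
        rfl
  update ω i hi hsi := by
    obtain ⟨j, rfl⟩ : ∃ j, i = j + 1 := ⟨i - 1, by have := hi.1; omega⟩
    have h1 := h.μ_start hM μ₀ β₀ hi.2 (hsi.trans (hM.τ_lt _ hi.2)) ω
    rw [max_eq_right hsi.le] at h1
    rw [h1]
    exact policyState_succ μ₀ β₀ hi.2 hsi ω
  no_update ω := by
    simp only [policyPath]
    rw [index_T hM]
    rfl

end IsPolicy

variable {W Wt : ℝ → P d → ℝ} {D : ℝ → P d → E d → ℝ}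

/-- Almost optimal controls, obtained by joining the almost optimal policies on the intervals and
at the observation times. -/
theorem IsHJBSolution.exists_J_le (hW : M.IsHJBSolution W Wt D) (hM : M.Regular) {s : ℝ}
    (hs : s ∈ Ico 0 M.T) (μ₀ : P d) {ε : ℝ} (hε : 0 < ε) :
    ∃ X, M.IsAdmissible s μ₀ X ∧ M.FiniteCost s X ∧ M.J s X ≤ W s μ₀ + (2 * M.n + 1) * ε := by
  have hpol : ∀ i, i ≤ M.n → s < M.τ (i + 1) → ∃ (A : ℝ → P d → E k₁) (Φ : ℝ → P d → P d),
      (Measurable fun q : ℝ × P d => A q.1 q.2) ∧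
      (∀ t ∈ Icc (max s (M.τ i)) (M.τ (i + 1)), Measurable (Φ t)) ∧ (∀ t ν, A t ν ∈ M.ctrl) ∧
      ∀ ν, Φ (max s (M.τ i)) ν = ν ∧
        M.SolvesFP (fun t => A t ν) (fun t => Φ t ν) (max s (M.τ i)) (M.τ (i + 1)) ∧
        IntervalIntegrable (fun t => M.ℓ t (Φ t ν) (A t ν)) volume
          (max s (M.τ i)) (M.τ (i + 1)) ∧
        (∫ t in max s (M.τ i)..M.τ (i + 1), M.ℓ t (Φ t ν) (A t ν)) +
          M.valueBefore W (i + 1) (Φ (M.τ (i + 1)) ν) ≤ W (max s (M.τ i)) ν + ε := by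
    intro i hi hsi
    have hin : max s (M.τ i) ∈ Ico (M.τ i) (M.τ (i + 1)) :=
      ⟨le_max_right _ _, IsAdmissible.max_lt hM hi hsi⟩
    exact (hW.solvesHJB hM hi).exists_policy hM hin (hW.continuous_space hi hin) hε
  choose! A Φ hA hΦ hmem hν using hpol
  have hmeas : ∀ i, i ∈ Icc 1 M.n → ∃ B : P d → E k₂, Measurable B ∧
      (∀ μ, ∃ u ∈ M.U, u.2 = B μ) ∧
        ∀ μ, M.impCost W i μ (B μ) ≤ M.valueBefore W i μ + ε :=
    fun i hi => hW.exists_measurement hM hi hε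
  choose! B hB hBmem hBle using hmeas
  have hP : M.IsPolicy s A Φ B := ⟨hA, hΦ, hmem, fun i hi hsi ν => (hν i hi hsi ν).1,
    fun i hi hsi ν => (hν i hi hsi ν).2.1, hB, hBmem⟩
  obtain ⟨u, hu⟩ := hM.U_nonempty
  have hX := hP.isAdmissible hM hs μ₀ ⟨u, hu, rfl⟩
  have hrun : ∀ ω, ∀ i ≤ M.n, s < M.τ (i + 1) →
      IntervalIntegrable (fun t => M.running (M.policyPath s μ₀ u.2 A Φ B) t ω) volume
        (max s (M.τ i)) (M.τ (i + 1)) ∧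
        (∫ t in max s (M.τ i)..M.τ (i + 1), M.running (M.policyPath s μ₀ u.2 A Φ B) t ω) +
          M.valueBefore W (i + 1) ((M.policyPath s μ₀ u.2 A Φ B).pre (i + 1) ω) ≤
            M.valueAtStart W s (M.policyPath s μ₀ u.2 A Φ B) i ω + ε := by
    intro ω i hi hsi
    obtain ⟨-, -, h1, h2⟩ := hν i hi hsi (M.policyState s μ₀ Φ B i ω)
    have hae : (fun t => M.ℓ t (Φ i t (M.policyState s μ₀ Φ B i ω))
        (A i t (M.policyState s μ₀ Φ B i ω)))
        =ᵐ[volume.restrict (uIoc (max s (M.τ i)) (M.τ (i + 1)))]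
          fun t => M.running (M.policyPath s μ₀ u.2 A Φ B) t ω := by
      rw [uIoc_of_le (IsAdmissible.max_lt hM hi hsi).le, ← restrict_Ioo_eq_restrict_Ioc]
      refine (ae_restrict_iff' measurableSet_Ioo).2 (.of_forall fun t ht => ?_)
      simp only [running, policyPath]
      rw [index_eq hM hi ⟨(le_max_right _ _).trans ht.1.le, ht.2⟩]
    refine ⟨h1.congr_ae hae, ?_⟩
    rw [← intervalIntegral.integral_congr_ae_restrict hae, valueAtStart,
      hP.μ_start hM μ₀ u.2 hi hsi]
    exact h2
  have himp : ∀ ω, ∀ i ∈ Icc 1 M.n, s < M.τ i →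
      M.impCost W i ((M.policyPath s μ₀ u.2 A Φ B).pre i ω)
        ((M.policyPath s μ₀ u.2 A Φ B).β i ω) ≤
          M.valueBefore W i ((M.policyPath s μ₀ u.2 A Φ B).pre i ω) + ε := by
    intro ω i hi hsi
    have e : (M.policyPath s μ₀ u.2 A Φ B).β i ω =
        B i ((M.policyPath s μ₀ u.2 A Φ B).pre i ω) := if_pos ⟨hi, hsi⟩
    rw [e]
    exact hBle i hi _
  exact ⟨_, hX, hX.finiteCost hM hs hW hrun himp, hX.J_le hM hs hW hε.le hrun himp⟩

/-- A classical solution is the value function. -/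
theorem IsHJBSolution.isGLB_costs (hW : M.IsHJBSolution W Wt D) (hM : M.Regular) {s : ℝ}
    (hs : s ∈ Ico 0 M.T) (μ₀ : P d) : IsGLB (M.costs s μ₀) (W s μ₀) := by
  refine ⟨?_, fun c hc => le_of_forall_pos_le_add fun ε hε => ?_⟩
  · rintro _ ⟨X, hX, hfin, rfl⟩
    exact hfin.le_J hM hX hs hW
  · have hn : (0 : ℝ) < 2 * M.n + 1 := by positivity
    obtain ⟨X, hX, hfin, hle⟩ := hW.exists_J_le hM hs μ₀ (div_pos hε hn)
    rw [mul_div_cancel₀ _ hn.ne'] at hle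
    exact (hc ⟨X, hX, hfin, rfl⟩).trans hle

end Model
end NoisyObs

/-! ### The verification theorem -/

theorem theorem3p5 {d k₁ k₂ : ℕ} {Ω S O : Type*} [MeasurableSpace Ω] [MeasurableSpace S]
    [MeasurableSpace O] (M : NoisyObs.Model d k₁ k₂ Ω S O) (hM : M.Regular)
    (W Wt : ℝ → NoisyObs.P d → ℝ) (D : ℝ → NoisyObs.P d → NoisyObs.E d → ℝ)
    (hW : M.IsHJBSolution W Wt D) :
    (∀ s ∈ Set.Ico 0 M.T, ∀ μ₀, IsGLB (M.costs s μ₀) (W s μ₀)) ∧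
      ∀ v : ℝ → NoisyObs.P d → NoisyObs.E k₁ × NoisyObs.E k₂, M.IsSelector W D v →
        ∀ s ∈ Set.Ico 0 M.T, ∀ μ₀, ∀ X : NoisyObs.Path d k₁ k₂ Ω,
          M.IsAdmissible s μ₀ X → M.IsFeedback s v X →
            M.FiniteCost s X ∧ M.J s X = W s μ₀ ∧ IsLeast (M.costs s μ₀) (M.J s X) := by
  refine ⟨fun s hs μ₀ => hW.isGLB_costs hM hs μ₀, fun v hv s hs μ₀ X hX hF => ?_⟩
  obtain ⟨hfin, hJ⟩ := hX.finiteCost_and_J_eq_of_feedback hM hs hW hv hF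
  refine ⟨hfin, hJ, ⟨X, hX, hfin, rfl⟩, ?_⟩
  rw [hJ]
  exact (hW.isGLB_costs hM hs μ₀).1
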